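/- Let $n\ge 2$. Let $F:\mathbb{R}^{n+1}\setminus\{0\}\to(0,\infty)$ be of class $C^3$, positively homogeneous of degree one ($F(tz)=tF(z)$ for $t>0$) and elliptic ($D^2F(z)$ is positive definite on $z^\perp$ for $|z|=1$), and suppose that for some $\epsilon_n\in\mathbb{R}$ $$|\xi|^2\le D^2F(z)(\xi,\xi)\le(1+\epsilon_n)|\xi|^2\qquad\text{for all } |z|=1,\ \xi\in z^\perp .$$ Let $X:M^n\to\mathbb{R}^{n+1}$ be a complete two-sided immersion of class $C^3$ of a smooth $n$-dimensional manifold without boundary, with unit normal field $\nu$, and let $A$ be its second fundamental form. Suppose that $X$ is stable $F$-minimal, i.e. the anisotropic area $\mathcal{A}_F(M)=\int_M F(\nu)\,d\mu$ satisfies $\frac{d}{dt}\big|_{t=0}\mathcal{A}_F(M_t)=0$ and $\frac{d^2}{dt^2}\big|_{t=0}\mathcal{A}_F(M_t)\ge 0$ for all compactly supported variations $M_t$ of $M$ (the area being taken over a compact set outside which the variation is constant). Here a variation $X_t$ is twice continuously differentiable in $t$, with $X_t$, $\partial_tX_t$ and $\partial_t^2X_t$ of class $C^1$ in $(t,x)$.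 Let $u:M\to\mathbb{R}$ be harmonic for the induced metric ($u\in C^2$, $\Delta u=0$). Then for every compactly supported $\varphi\in C^1(M)$ the integrals below are finite and $$\Lambda_n\int_M\varphi^2|A|^2|\nabla u|^2+\frac{1}{n-1}\int_M\varphi^2\big|\nabla|\nabla u|\big|^2\le\int_M|\nabla\varphi|^2|\nabla u|^2,$$ where $$\Lambda_n=\frac{1}{1+\epsilon_n}-\frac{n-1}{n}\left(1+\frac{n-2}{\sqrt{n-1}}\,\frac{\epsilon_n}{1+\epsilon_n}\right).$$ Norms, gradients and integrals on $M$ are those of the induced metric; $\nabla|\nabla u|$ is the pointwise gradient, which exists almost everywhere, and is set to $0$ where $|\nabla u|$ is not differentiable. -/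

import Mathlib

open Set Filter Topology MeasureTheory
open scoped Manifold ContDiff ENNReal

noncomputable section

/-! ### Anisotropic integrands -/

/-- An elliptic integrand on `ℝᵐ`: a positive function of class `C³` on `ℝᵐ ∖ {0}`, homogeneous of
degree one, with `D²F(z)` positive definite on `z^⊥` for every unit vector `z` (by homogeneity
`D²F(z) z = 0`, so the orthogonal complement is where definiteness makes sense).
The value `F 0` is irrelevant. -/
structure IsEllipticIntegrand {m : ℕ} (F : EuclideanSpace ℝ (Fin m) → ℝ) : Prop where
  contDiffOn : ContDiffOn ℝ 3 F {0}ᶜ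
  pos : ∀ z, z ≠ 0 → 0 < F z
  homogeneous : ∀ t : ℝ, 0 < t → ∀ z, z ≠ 0 → F (t • z) = t * F z
  elliptic : ∀ z, ‖z‖ = 1 → ∀ ξ, inner ℝ ξ z = 0 → ξ ≠ 0 → 0 < fderiv ℝ (fderiv ℝ F) z ξ ξ

/-- The pinching condition `|ξ|² ≤ D²F(z)(ξ,ξ) ≤ (1 + ε)|ξ|²` for unit `z` and `ξ ⊥ z`. -/
def IsPinched {m : ℕ} (F : EuclideanSpace ℝ (Fin m) → ℝ) (ε : ℝ) : Prop :=
  ∀ z, ‖z‖ = 1 → ∀ ξ, inner ℝ ξ z = 0 →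
    ‖ξ‖ ^ 2 ≤ fderiv ℝ (fderiv ℝ F) z ξ ξ ∧
      fderiv ℝ (fderiv ℝ F) z ξ ξ ≤ (1 + ε) * ‖ξ‖ ^ 2

section Immersed

variable {n : ℕ} {M : Type*} [TopologicalSpace M] [ChartedSpace (EuclideanSpace ℝ (Fin n)) M]

/-! ### Pointwise geometry of an immersion `X : M → ℝⁿ⁺¹` -/

/-- The differential of `Y : M → ℝⁿ⁺¹` at `x`, as a linear map from the tangent space at `x` (which
Mathlib models on `ℝⁿ`). -/
def differential (Y : M → EuclideanSpace ℝ (Fin (n + 1))) (x : M) :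
    EuclideanSpace ℝ (Fin n) →L[ℝ] EuclideanSpace ℝ (Fin (n + 1)) :=
  mfderiv (𝓡 n) 𝓘(ℝ, EuclideanSpace ℝ (Fin (n + 1))) Y x

/-- The differential of a real function at `x`. -/
def differentialReal (f : M → ℝ) (x : M) : EuclideanSpace ℝ (Fin n) →L[ℝ] ℝ :=
  mfderiv (𝓡 n) 𝓘(ℝ, ℝ) f x

/-- The orthogonal projection of `ℝⁿ⁺¹` to the tangent hyperplane `dX(T_x M)`, followed by the
inverse of `dX : T_x M → dX(T_x M)`. In formulas it is `(dX^* dX)⁻¹ dX^*`; for injective `dX` this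
does not depend on the inner product used on `T_x M`. -/
def tangentialPart (X : M → EuclideanSpace ℝ (Fin (n + 1))) (x : M) :
    EuclideanSpace ℝ (Fin (n + 1)) →L[ℝ] EuclideanSpace ℝ (Fin n) :=
  (ContinuousLinearMap.adjoint (differential X x) ∘L differential X x).inverse ∘L
    ContinuousLinearMap.adjoint (differential X x)

/-- The gradient of `f` for the metric induced by `X`, as a vector of `ℝⁿ⁺¹` tangent to the
hypersurface: the vector `w` in `dX(T_x M)` with `⟨w, dX v⟩ = df(v)` for all `v`. It is zero at
points where `f` is not differentiable. As `X` is isometric for the induced metric, its Euclidean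
norm is the Riemannian norm `|∇f|`. -/
def hypGradient (X : M → EuclideanSpace ℝ (Fin (n + 1))) (f : M → ℝ) (x : M) :
    EuclideanSpace ℝ (Fin (n + 1)) :=
  (InnerProductSpace.toDual ℝ (EuclideanSpace ℝ (Fin (n + 1)))).symm
    (differentialReal f x ∘L tangentialPart X x)

/-- The divergence along the hypersurface of a vector field `Y : M → ℝⁿ⁺¹`:
`∑ᵢ ⟨D_{eᵢ} Y, eᵢ⟩` over an orthonormal basis of the tangent space. For tangential `Y` it is the
divergence of the Levi-Civita connection, which is the tangential part of `D`. -/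
def hypDivergence (X Y : M → EuclideanSpace ℝ (Fin (n + 1))) (x : M) : ℝ :=
  LinearMap.trace ℝ (EuclideanSpace ℝ (Fin n))
    (tangentialPart X x ∘L differential Y x).toLinearMap

/-- The Laplace-Beltrami operator of the induced metric. -/
def hypLaplacian (X : M → EuclideanSpace ℝ (Fin (n + 1))) (f : M → ℝ) (x : M) : ℝ :=
  hypDivergence X (hypGradient X f) x

/-- `u` is harmonic for the metric induced by `X`. -/
structure IsHarmonicOn (X : M → EuclideanSpace ℝ (Fin (n + 1))) (u : M → ℝ) : Prop where
  contMDiff : ContMDiff (𝓡 n) 𝓘(ℝ, ℝ) 2 u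
  laplacian_eq_zero : ∀ x, hypLaplacian X u x = 0

/-- The shape operator `S : T_x M → T_x M`, `dX (S v) = D_v ν`. -/
def shapeOperator (X ν : M → EuclideanSpace ℝ (Fin (n + 1))) (x : M) :
    EuclideanSpace ℝ (Fin n) →L[ℝ] EuclideanSpace ℝ (Fin n) :=
  tangentialPart X x ∘L differential ν x

/-- The squared norm `|A|²` of the second fundamental form, i.e. the sum of the squares of the
principal curvatures: the trace of `S²`. -/
def secondFormNormSq (X ν : M → EuclideanSpace ℝ (Fin (n + 1))) (x : M) : ℝ :=
  LinearMap.trace ℝ (EuclideanSpace ℝ (Fin n))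
    (shapeOperator X ν x ∘L shapeOperator X ν x).toLinearMap

/-- A two-sided immersion of class `C³` with a chosen unit normal field `ν`. -/
structure IsTwoSidedImmersion (X ν : M → EuclideanSpace ℝ (Fin (n + 1))) : Prop where
  contMDiff : ContMDiff (𝓡 n) 𝓘(ℝ, EuclideanSpace ℝ (Fin (n + 1))) 3 X
  injective : ∀ x, Function.Injective (differential X x)
  contMDiff_normal : ContMDiff (𝓡 n) 𝓘(ℝ, EuclideanSpace ℝ (Fin (n + 1))) 2 ν
  norm_normal : ∀ x, ‖ν x‖ = 1
  orthogonal : ∀ x v, inner ℝ (differential X x v) (ν x) = 0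

/-! ### Completeness -/

/-- The distance of the metric induced by `X`: the infimum of the lengths of `C¹` curves. -/
def inducedEDist (X : M → EuclideanSpace ℝ (Fin (n + 1))) (x y : M) : ℝ≥0∞ :=
  ⨅ (γ : ℝ → M) (_ : ContMDiffOn 𝓘(ℝ, ℝ) (𝓡 n) 1 γ (Icc 0 1)) (_ : γ 0 = x) (_ : γ 1 = y),
    ∫⁻ t in Ioo (0 : ℝ) 1, ‖deriv (X ∘ γ) t‖ₑ

/-- The induced metric is complete: Cauchy sequences for the induced distance converge. -/
def IsCompleteImmersion (X : M → EuclideanSpace ℝ (Fin (n + 1))) : Prop :=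
  ∀ x : ℕ → M,
    (∀ r : ℝ≥0∞, 0 < r → ∃ N, ∀ k ≥ N, ∀ l ≥ N, inducedEDist X (x k) (x l) < r) →
      ∃ a, Tendsto (fun k => inducedEDist X (x k) a) atTop (𝓝 0)

/-! ### The Riemannian volume measure and the anisotropic area -/

section Volume

variable [MeasurableSpace M]

/-- The measure on the domain of a chart `e` with density `√(det g)` with respect to Lebesgue
measure in the coordinates (`normDet L = √(det (L^* L))`). -/
def chartVolume (X : M → EuclideanSpace ℝ (Fin (n + 1)))
    (e : OpenPartialHomeomorph M (EuclideanSpace ℝ (Fin n))) : Measure M :=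
  ((volume.restrict e.target).withDensity
    (fun y => ENNReal.ofReal
      (fderiv ℝ (X ∘ e.symm) y).toLinearMap.normDet)).map e.symm

/-- The Riemannian volume measure of the metric induced by `X`. The measures `√(det g) dy` of the
charts agree on overlaps, so their supremum is the measure that restricts to each of them. -/
def hypVolume (X : M → EuclideanSpace ℝ (Fin (n + 1))) : Measure M :=
  ⨆ e ∈ atlas (EuclideanSpace ℝ (Fin n)) M, chartVolume X e

/-- The anisotropic area `∫_K F(ν) dμ` of the part over `K` of the hypersurface `X` with unit
normal `ν`. -/
def anisotropicArea (F : EuclideanSpace ℝ (Fin (n + 1)) → ℝ)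
    (X ν : M → EuclideanSpace ℝ (Fin (n + 1))) (K : Set M) : ℝ :=
  ∫ x in K, F (ν x) ∂(hypVolume X)

end Volume

/-- A variation `Φ t`, `|t| < δ`, of the two-sided immersion `X` with unit normal `ν`, fixed outside
the compact set `K`. `N t` is the unit normal of `Φ t` which continues `ν`. The map `Φ` is twice
continuously differentiable in `t`, with `Φ`, `∂ₜΦ` and `∂ₜ²Φ` of class `C¹` in `(t, x)`, so that
variations with velocity `f ν`, `f` of class `C¹` with compact support, are included. -/
structure IsCompactVariation (X ν : M → EuclideanSpace ℝ (Fin (n + 1))) (K : Set M) (δ : ℝ)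
    (Φ N : ℝ → M → EuclideanSpace ℝ (Fin (n + 1))) : Prop where
  isCompact : IsCompact K
  pos : 0 < δ
  map_zero : Φ 0 = X
  normal_zero : N 0 = ν
  eq_outside : ∀ t ∈ Ioo (-δ) δ, ∀ x ∉ K, Φ t x = X x
  regular : ∃ V W : ℝ → M → EuclideanSpace ℝ (Fin (n + 1)),
    (∀ t ∈ Ioo (-δ) δ, ∀ x, HasDerivAt (fun s => Φ s x) (V t x) t) ∧
    (∀ t ∈ Ioo (-δ) δ, ∀ x, HasDerivAt (fun s => V s x) (W t x) t) ∧
    ContMDiffOn (𝓘(ℝ, ℝ).prod (𝓡 n)) 𝓘(ℝ, EuclideanSpace ℝ (Fin (n + 1))) 1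
      (fun p : ℝ × M => Φ p.1 p.2) (Ioo (-δ) δ ×ˢ univ) ∧
    ContMDiffOn (𝓘(ℝ, ℝ).prod (𝓡 n)) 𝓘(ℝ, EuclideanSpace ℝ (Fin (n + 1))) 1
      (fun p : ℝ × M => V p.1 p.2) (Ioo (-δ) δ ×ˢ univ) ∧
    ContMDiffOn (𝓘(ℝ, ℝ).prod (𝓡 n)) 𝓘(ℝ, EuclideanSpace ℝ (Fin (n + 1))) 1
      (fun p : ℝ × M => W p.1 p.2) (Ioo (-δ) δ ×ˢ univ)
  injective : ∀ t ∈ Ioo (-δ) δ, ∀ x, Function.Injective (differential (Φ t) x)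
  continuousOn_normal : ContinuousOn (fun p : ℝ × M => N p.1 p.2) (Ioo (-δ) δ ×ˢ univ)
  norm_normal : ∀ t ∈ Ioo (-δ) δ, ∀ x, ‖N t x‖ = 1
  orthogonal : ∀ t ∈ Ioo (-δ) δ, ∀ x v, inner ℝ (differential (Φ t) x v) (N t x) = 0

variable [MeasurableSpace M]

/-- `X` is `F`-minimal: the first derivative of the anisotropic area vanishes for all compactly
supported variations. The area is measured over the compact set outside which nothing moves. -/
def IsFMinimal (F : EuclideanSpace ℝ (Fin (n + 1)) → ℝ)
    (X ν : M → EuclideanSpace ℝ (Fin (n + 1))) : Prop :=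
  ∀ (K : Set M) (δ : ℝ) (Φ N : ℝ → M → EuclideanSpace ℝ (Fin (n + 1))),
    IsCompactVariation X ν K δ Φ N →
      HasDerivAt (fun t => anisotropicArea F (Φ t) (N t) K) 0 0

/-- `X` is stable `F`-minimal: it is `F`-minimal and the second derivative of the anisotropic area
is nonnegative for all compactly supported variations. -/
def IsStableFMinimal (F : EuclideanSpace ℝ (Fin (n + 1)) → ℝ)
    (X ν : M → EuclideanSpace ℝ (Fin (n + 1))) : Prop :=
  IsFMinimal F X ν ∧
  ∀ (K : Set M) (δ : ℝ) (Φ N : ℝ → M → EuclideanSpace ℝ (Fin (n + 1))),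
    IsCompactVariation X ν K δ Φ N →
      0 ≤ deriv (deriv (fun t => anisotropicArea F (Φ t) (N t) K)) 0

end Immersed

/-- The constant
`Λ = 1/(1+ε) - ((n-1)/n) (1 + ((n-2)/√(n-1)) (ε/(1+ε)))`. -/
def lambdaConst (n : ℕ) (ε : ℝ) : ℝ :=
  1 / (1 + ε) -
    ((n : ℝ) - 1) / n * (1 + ((n : ℝ) - 2) / Real.sqrt ((n : ℝ) - 1) * (ε / (1 + ε)))

end

set_option linter.unusedSectionVars false

/-! Write `S` for the shape operator, `H` for its trace, `Q = D²F(ν)` and `v = ∇u`. Stability is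
tested with the normal velocity `f = φ √(|v|² + δ)`, a `C¹` substitute for `φ |∇u|`. For an
`F`-minimal hypersurface `tr (Q S) = 0`, and the second variation gives `∫ f² tr (Q S²) ≤ ∫ ⟨Q ∇f,
∇f⟩`; pinching turns this into `∫ f² |A|² ≤ (1 + ε) ∫ |∇f|²`
(`integral_sq_mul_secondFormNormSq_le`).

Expanding `|∇f|²` produces the cross term `2 φ ⟨∇φ, D²u v⟩`. The Bochner formula integrated against
`φ²` (`integral_bochnerIntegrand`) contains the same term, so subtracting it removes the cross term
and leaves `φ²` times `|D²u v|² / (|v|² + δ) - |D²u|²` plus `|S v|² - H ⟨S v, v⟩ = -Ric(v, v)`. The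
first quantity is at most `-|∇|∇u||² / (n - 1)` by the refined Kato inequality `n |∇|∇u||² ≤ (n - 1)
|D²u|²`, because the Hessian of a harmonic function is traceless. The second is bounded by algebra:
`tr (Q S) = 0` with `Q` between `1` and `1 + ε` forces `|H| ≤ √n (ε / (1 + ε)) |A|`
(`abs_traceL_le_of_pinched`), and splitting `S` into its traceless part and a multiple of the
identity yields the coefficient subtracted in `Λ` (`norm_apply_sq_sub_trace_mul_le`). Finally `δ →
0`.

The regularity is too low for the classical Bochner formula: `u` is only `C²`, so `∇u` is only `C¹`.
All integral identities come instead from one weak statement, `integral_commutator`, valid for `C¹`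
fields `ζ` (tangential) and `w`: the commutation of second derivatives of `w`, traced against `ψ ζ`
and integrated by parts so that only first derivatives remain. It rests on the symmetry of mixed
distributional derivatives, proved by convolution (`integral_inner_fderiv_comm`). Taking `w = X`
gives the divergence theorem; `w = ν` with `ζ` the tangential part of `∇F(ν)` brings the second
variation to its usual form; `w = ζ = ∇u` gives Bochner.

The area of `X + t f ν` is computed exactly: its Jacobian is `det (1 + t f S)` times the length of
an explicit unnormalized normal, and the homogeneity of `F` absorbs that length (`normDet_tilt`,
`anisotropicArea_normalVariation`). The integrand is then a smooth function of `t` and of `(ν, f S,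
∇f)`, and is differentiated twice under the integral sign. -/

noncomputable section

/-! ### Linear algebra -/

section LinearAlgebra

variable {V E : Type*} [NormedAddCommGroup V] [InnerProductSpace ℝ V] [FiniteDimensional ℝ V]
  [NormedAddCommGroup E] [InnerProductSpace ℝ E] [FiniteDimensional ℝ E]

/-- The trace as a continuous linear functional. -/
def traceL (E : Type*) [NormedAddCommGroup E] [InnerProductSpace ℝ E] [FiniteDimensional ℝ E] :
    (E →L[ℝ] E) →L[ℝ] ℝ :=
  LinearMap.toContinuousLinearMap (LinearMap.trace ℝ E ∘ₗ ContinuousLinearMap.coeLM ℝ)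

lemma traceL_apply (A : E →L[ℝ] E) : traceL E A = LinearMap.trace ℝ E A.toLinearMap := rfl

lemma traceL_comp_comm (A : V →L[ℝ] E) (B : E →L[ℝ] V) :
    traceL V (B ∘L A) = traceL E (A ∘L B) :=
  LinearMap.trace_comp_comm' A.toLinearMap B.toLinearMap

lemma traceL_mul_comm (A B : E →L[ℝ] E) : traceL E (B ∘L A) = traceL E (A ∘L B) :=
  traceL_comp_comm A B

lemma traceL_eq_sum {ι : Type*} [Fintype ι] (b : OrthonormalBasis ι ℝ E) (A : E →L[ℝ] E) :
    traceL E A = ∑ i, inner ℝ (b i) (A (b i)) :=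
  LinearMap.trace_eq_sum_inner A.toLinearMap b

lemma traceL_smulRight (φ : E →L[ℝ] ℝ) (a : E) : traceL E (φ.smulRight a) = φ a := by
  have := stdOrthonormalBasis ℝ E
  rw [traceL_eq_sum (stdOrthonormalBasis ℝ E)]
  simp only [ContinuousLinearMap.smulRight_apply, inner_smul_right]
  conv_rhs => rw [← (stdOrthonormalBasis ℝ E).sum_repr' a, map_sum]
  simp [mul_comm]

lemma traceL_id : traceL E (ContinuousLinearMap.id ℝ E) = Module.finrank ℝ E := by
  simp [traceL_apply]

lemma traceL_adjoint (A : E →L[ℝ] E) : traceL E (ContinuousLinearMap.adjoint A) = traceL E A := by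
  rw [traceL_eq_sum (stdOrthonormalBasis ℝ E), traceL_eq_sum (stdOrthonormalBasis ℝ E)]
  refine Finset.sum_congr rfl fun i _ => ?_
  rw [ContinuousLinearMap.adjoint_inner_right, real_inner_comm]

lemma det_one_add_comp_comm (A : V →L[ℝ] E) (B : E →L[ℝ] V) :
    (1 + A ∘L B).det = (1 + B ∘L A).det := by
  classical
  let b := (stdOrthonormalBasis ℝ V).toBasis
  let c := (stdOrthonormalBasis ℝ E).toBasis
  have h1 : (1 + A ∘L B).det = LinearMap.det (LinearMap.id + A.toLinearMap ∘ₗ B.toLinearMap) := rfl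
  have h2 : (1 + B ∘L A).det = LinearMap.det (LinearMap.id + B.toLinearMap ∘ₗ A.toLinearMap) := rfl
  rw [h1, h2, ← LinearMap.det_toMatrix c, ← LinearMap.det_toMatrix b, map_add, map_add,
    LinearMap.toMatrix_comp c b c, LinearMap.toMatrix_comp b c b, LinearMap.toMatrix_id,
    LinearMap.toMatrix_id, Matrix.det_one_add_mul_comm]

lemma det_one_add_smulRight (φ : E →L[ℝ] ℝ) (a : E) : (1 + φ.smulRight a).det = 1 + φ a := by
  have h : φ.smulRight a = (ContinuousLinearMap.toSpanSingleton ℝ a) ∘L φ := by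
    ext x; simp
  rw [h, det_one_add_comp_comm]
  have : (1 + φ ∘L ContinuousLinearMap.toSpanSingleton ℝ a) =
      (1 + φ a) • (ContinuousLinearMap.id ℝ ℝ) := by
    ext; simp
  rw [this]
  simp [ContinuousLinearMap.det]

lemma det_comp (A B : E →L[ℝ] E) : (A ∘L B).det = A.det * B.det :=
  LinearMap.det_comp A.toLinearMap B.toLinearMap

lemma det_adjoint (A : E →L[ℝ] E) : (ContinuousLinearMap.adjoint A).det = A.det := by
  classical
  have h : LinearMap.det (LinearMap.adjoint A.toLinearMap) = LinearMap.det A.toLinearMap := by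
    rw [← LinearMap.det_toMatrix (stdOrthonormalBasis ℝ E).toBasis, LinearMap.toMatrix_adjoint,
      Matrix.det_conjTranspose, LinearMap.det_toMatrix]
    simp
  exact h

lemma contDiff_det_clm {k : WithTop ℕ∞} : ContDiff ℝ k (fun A : E →L[ℝ] E => A.det) := by
  classical
  let b := (stdOrthonormalBasis ℝ E).toBasis
  have h : (fun A : E →L[ℝ] E => A.det) = fun A => (LinearMap.toMatrix b b A.toLinearMap).det := by
    ext A; rw [LinearMap.det_toMatrix]
  rw [h]
  simp only [Matrix.det_apply]
  refine ContDiff.sum fun σ _ => ContDiff.const_smul _ (contDiff_prod fun i _ => ?_)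
  let l : (E →L[ℝ] E) →ₗ[ℝ] ℝ :=
    { toFun := fun A => LinearMap.toMatrix b b A.toLinearMap (σ i) i
      map_add' := by intro A B; simp
      map_smul' := by intro c A; simp }
  exact (LinearMap.toContinuousLinearMap l).contDiff

/-- The derivative of the determinant. -/
lemma hasDerivAt_det_one_add_smul (B : E →L[ℝ] E) :
    HasDerivAt (fun t : ℝ => (1 + t • B).det) (traceL E B) 0 := by
  classical
  let b := (stdOrthonormalBasis ℝ E).toBasis
  set m := LinearMap.toMatrix b b B.toLinearMap with hm
  have h : (fun t : ℝ => (1 + t • B).det) = fun t : ℝ => 1 + m.trace * t +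
      Polynomial.eval t (1 + (Polynomial.X : Polynomial ℝ) • m.map ⇑Polynomial.C).det.divX.divX * t ^ 2 := by
    ext t
    have : (1 + t • B).det = LinearMap.det (LinearMap.id + t • B.toLinearMap) := rfl
    rw [this, ← LinearMap.det_toMatrix b, map_add, map_smul, LinearMap.toMatrix_id, ← hm,
      Matrix.det_one_add_smul]
  rw [h, traceL_apply, ← LinearMap.trace_eq_matrix_trace ℝ b B.toLinearMap |>.symm, ← hm]
  have := ((hasDerivAt_const (0 : ℝ) (1 : ℝ)).add ((hasDerivAt_id (0 : ℝ)).const_mul m.trace)).add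
    (((Polynomial.hasDerivAt (1 + (Polynomial.X : Polynomial ℝ) • m.map ⇑Polynomial.C).det.divX.divX 0)).mul
      (hasDerivAt_pow 2 (0 : ℝ)))
  exact this.congr_deriv (by simp)

/-- Jacobi's formula. The derivative depends only on `A'`, so the curve may be replaced by the line
`A t + s A' = A t (1 + s R A')`, whose determinant factors. -/
lemma hasDerivAt_det_of_isUnit {A : ℝ → E →L[ℝ] E} {A' R : E →L[ℝ] E} {t : ℝ}
    (hA : HasDerivAt A A' t) (hR : A t ∘L R = 1) :
    HasDerivAt (fun s => (A s).det) ((A t).det * traceL E (R ∘L A')) t := by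
  have hd : HasFDerivAt (fun A : E →L[ℝ] E => A.det) (fderiv ℝ (fun A : E →L[ℝ] E => A.det) (A t))
      (A t) := (contDiff_det_clm (k := 1)).differentiable (by norm_num) |>.differentiableAt.hasFDerivAt
  have h1 := hd.comp_hasDerivAt t hA
  have h2 : HasDerivAt (fun s : ℝ => (A t + s • A').det)
      (fderiv ℝ (fun A : E →L[ℝ] E => A.det) (A t) A') 0 := by
    have hl : HasDerivAt (fun s : ℝ => A t + s • A') A' 0 := by
      simpa using ((hasDerivAt_id (0 : ℝ)).smul_const A').const_add (A t)
    have hd' : HasFDerivAt (fun A : E →L[ℝ] E => A.det)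
      (fderiv ℝ (fun A : E →L[ℝ] E => A.det) (A t)) (A t + (0 : ℝ) • A') := by simpa using hd
    exact hd'.comp_hasDerivAt (0 : ℝ) hl
  have h3 : HasDerivAt (fun s : ℝ => (A t + s • A').det)
      ((A t).det * traceL E (R ∘L A')) 0 := by
    have : (fun s : ℝ => (A t + s • A').det) = fun s => (A t).det * (1 + s • (R ∘L A')).det := by
      ext s
      rw [← det_comp]
      congr 1
      ext x
      have : (A t) (R (A' x)) = A' x := congrArg (fun L => L (A' x)) hR
      simp [this]
    rw [this]
    exact (hasDerivAt_det_one_add_smul _).const_mul _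
  rw [← h2.unique h3]
  exact h1

/-- The Moore-Penrose inverse of an injective map. -/
def pinv (L : V →L[ℝ] E) : E →L[ℝ] V :=
  (ContinuousLinearMap.adjoint L ∘L L).inverse ∘L ContinuousLinearMap.adjoint L

lemma isInvertible_adjoint_comp {L : V →L[ℝ] E} (hL : Function.Injective L) :
    (ContinuousLinearMap.adjoint L ∘L L).IsInvertible := by
  have hinj : Function.Injective (ContinuousLinearMap.adjoint L ∘L L).toLinearMap := by
    rw [← LinearMap.ker_eq_bot, LinearMap.ker_eq_bot']
    intro v hv
    have hv' : ContinuousLinearMap.adjoint L (L v) = 0 := hv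
    have : inner ℝ (L v) (L v) = 0 := by
      rw [← ContinuousLinearMap.adjoint_inner_right, hv', inner_zero_right]
    exact hL (by simpa using this)
  exact ⟨(LinearEquiv.ofInjectiveEndo _ hinj).toContinuousLinearEquiv, by ext x; rfl⟩

lemma adjoint_comp_comp_pinv {L : V →L[ℝ] E} (hL : Function.Injective L) :
    (ContinuousLinearMap.adjoint L ∘L L) ∘L pinv L = ContinuousLinearMap.adjoint L := by
  ext1 e
  exact (isInvertible_adjoint_comp hL).self_apply_inverse _

/-- The normal equation `L* L T = L*` determines `T`, as `L* L` is invertible. -/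
lemma eq_pinv {L : V →L[ℝ] E} (hL : Function.Injective L) {T : E →L[ℝ] V}
    (hT : (ContinuousLinearMap.adjoint L ∘L L) ∘L T = ContinuousLinearMap.adjoint L) :
    T = pinv L := by
  obtain ⟨e, he⟩ := isInvertible_adjoint_comp hL
  ext1 x
  apply e.injective
  have h1 := congrArg (fun l => l x) (hT.trans (adjoint_comp_comp_pinv hL).symm)
  rw [← he] at h1
  exact h1

lemma pinv_comp_self {L : V →L[ℝ] E} (hL : Function.Injective L) :
    pinv L ∘L L = ContinuousLinearMap.id ℝ V := by
  ext1 v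
  exact (isInvertible_adjoint_comp hL).inverse_apply_self _

lemma pinv_apply_self {L : V →L[ℝ] E} (hL : Function.Injective L) (v : V) : pinv L (L v) = v :=
  congrArg (fun l => l v) (pinv_comp_self hL)

lemma pinv_apply_normal {L : V →L[ℝ] E} {ν : E} (hν : ∀ v, inner ℝ (L v) ν = 0) :
    pinv L ν = 0 := by
  have : ContinuousLinearMap.adjoint L ν = 0 := by
    refine ext_inner_left ℝ fun v => ?_
    rw [ContinuousLinearMap.adjoint_inner_right, hν, inner_zero_right]
  simp [pinv, this]

/-- Reparametrization invariance: cancelling the injective `A*` in the normal equation for `L A`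
leaves the one for `L`. It makes tangential derivatives computable in any chart. -/
lemma comp_pinv_comp_equiv {L : V →L[ℝ] E} (hL : Function.Injective L) (A : V ≃L[ℝ] V) :
    A.toContinuousLinearMap ∘L pinv (L ∘L A.toContinuousLinearMap) = pinv L := by
  apply eq_pinv hL
  have hLA : Function.Injective (L ∘L A.toContinuousLinearMap) := hL.comp A.injective
  have h := adjoint_comp_comp_pinv hLA
  ext1 e
  have h1 := congrArg (fun l => l e) h
  have hA : Function.Injective (ContinuousLinearMap.adjoint A.toContinuousLinearMap) := by
    rw [injective_iff_map_eq_zero]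
    intro v hv
    have : inner ℝ (A (A.symm v)) v = 0 := by
      have := ContinuousLinearMap.adjoint_inner_right A.toContinuousLinearMap (A.symm v) v
      rw [hv, inner_zero_right] at this
      exact this.symm
    simpa using this
  apply hA
  rw [ContinuousLinearMap.adjoint_comp] at h1
  exact h1

variable {L : V →L[ℝ] E} {ν : E}

lemma exists_eq_of_orthogonal (hdim : Module.finrank ℝ E = Module.finrank ℝ V + 1)
    (hL : Function.Injective L) (hν : ∀ v, inner ℝ (L v) ν = 0) (hν1 : ‖ν‖ = 1) {e : E}
    (he : inner ℝ e ν = 0) : ∃ v, L v = e := by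
  have : Fact (Module.finrank ℝ E = Module.finrank ℝ V + 1) := ⟨hdim⟩
  have hν0 : ν ≠ 0 := by rintro rfl; simp at hν1
  have hle : LinearMap.range L.toLinearMap ≤ (ℝ ∙ ν)ᗮ := by
    rintro _ ⟨v, rfl⟩
    rw [Submodule.mem_orthogonal_singleton_iff_inner_left]
    exact hν v
  have heq := Submodule.eq_of_le_of_finrank_eq hle (by
    rw [LinearMap.finrank_range_of_inj hL, Submodule.finrank_orthogonal_span_singleton (n := Module.finrank ℝ V) hν0])
  have : e ∈ LinearMap.range L.toLinearMap := by
    rw [heq, Submodule.mem_orthogonal_singleton_iff_inner_left]; exact he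
  exact this

/-- In codimension one the range of `L` is all of `ν^⊥`, so `L ∘ pinv L` is the orthogonal
projection along `ν`. -/
lemma apply_pinv_apply (hdim : Module.finrank ℝ E = Module.finrank ℝ V + 1)
    (hL : Function.Injective L) (hν : ∀ v, inner ℝ (L v) ν = 0) (hν1 : ‖ν‖ = 1) (e : E) :
    L (pinv L e) = e - (inner ℝ ν e : ℝ) • ν := by
  obtain ⟨v, hv⟩ := exists_eq_of_orthogonal (e := e - (inner ℝ ν e : ℝ) • ν) hdim hL hν hν1 (by
    rw [inner_sub_left, inner_smul_left, real_inner_self_eq_norm_sq, hν1, real_inner_comm]; simp)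
  have h2 : e = L v + (inner ℝ ν e : ℝ) • ν := by rw [hv]; simp
  conv_lhs => rw [h2]
  rw [map_add, map_smul, pinv_apply_normal hν, pinv_apply_self hL, smul_zero, add_zero, hv]

/-- The Jacobian of a graph-like perturbation of an injective map of codimension one. -/
lemma normDet_tilt (hdim : Module.finrank ℝ E = Module.finrank ℝ V + 1)
    (hL : Function.Injective L) (hν : ∀ v, inner ℝ (L v) ν = 0) (hν1 : ‖ν‖ = 1)
    {L' : V →L[ℝ] E} {D : V →L[ℝ] E} {z : E} (hD : ∀ v, inner ℝ (D v) ν = 0)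
    (hz : inner ℝ z ν = 0)
    (hL' : ∀ v, L' v = L v + D v + (inner ℝ z (L v + D v) : ℝ) • ν) :
    L'.toLinearMap.normDet =
      |(1 + D ∘L pinv L).det| * ‖ν - z‖ * L.toLinearMap.normDet := by
  -- `ν - z` is orthogonal to the range of `L'`; its squared length is the determinant of the rank
  -- one factor `1 + φ ⊗ pinv L z` below.
  have hnz : ‖ν - z‖ ^ 2 = 1 + ‖z‖ ^ 2 := by
    rw [norm_sub_sq_real, hν1, real_inner_comm, hz]; ring
  have hz' : inner ℝ ν z = 0 := by rw [real_inner_comm, hz]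
  -- The tangential perturbation is a change of parameter, `L + D = L P`, because `D` takes values
  -- in `ν^⊥`.
  set P : V →L[ℝ] V := 1 + pinv L ∘L D with hP
  have hLP : ∀ v, L (P v) = L v + D v := by
    intro v
    have : P v = v + pinv L (D v) := rfl
    rw [this, map_add, apply_pinv_apply hdim hL hν hν1, real_inner_comm, hD]; simp
  set φ : V →L[ℝ] ℝ := innerSL ℝ z ∘L L with hφ
  -- The Gram operator of `L'` factors; its determinant is `(det P)² (1 + |z|²) det (L* L)`, and
  -- Sylvester's identity moves `det P` from `V` to `E`.
  have hG : ContinuousLinearMap.adjoint L' ∘L L' =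
      ContinuousLinearMap.adjoint P ∘L (ContinuousLinearMap.adjoint L ∘L L) ∘L
        (1 + φ.smulRight (pinv L z)) ∘L P := by
    ext1 v
    refine ext_inner_left ℝ fun w => ?_
    have hRHS : (ContinuousLinearMap.adjoint P ∘L (ContinuousLinearMap.adjoint L ∘L L) ∘L
        (1 + φ.smulRight (pinv L z)) ∘L P) v =
        ContinuousLinearMap.adjoint P (ContinuousLinearMap.adjoint L
          (L (P v + (inner ℝ z (L (P v)) : ℝ) • pinv L z))) := rfl
    rw [hRHS, ContinuousLinearMap.adjoint_inner_right, ContinuousLinearMap.adjoint_inner_right,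
      ContinuousLinearMap.comp_apply, ContinuousLinearMap.adjoint_inner_right, map_add, map_smul,
      apply_pinv_apply hdim hL hν hν1 z, hz', hL', hL', ← hLP, ← hLP]
    have hν' : ∀ v, inner ℝ ν (L v) = 0 := fun v => by rw [real_inner_comm, hν]
    simp only [inner_add_left, inner_add_right, inner_smul_left, inner_smul_right, hν, hν',
      real_inner_self_eq_norm_sq, hν1, zero_smul, sub_zero, real_inner_comm z]
    simp
  have hdet : L'.toLinearMap.normDet ^ 2 =
      ((1 + D ∘L pinv L).det * ‖ν - z‖ * L.toLinearMap.normDet) ^ 2 := by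
    have h1 := ContinuousLinearMap.normDet_sq (𝕜 := ℝ) L'
    have h2 := ContinuousLinearMap.normDet_sq (𝕜 := ℝ) L
    simp only [RCLike.ofReal_real_eq_id, id_eq] at h1 h2
    have h3 : (1 + φ.smulRight (pinv L z)).det = ‖ν - z‖ ^ 2 := by
      rw [det_one_add_smulRight, hnz, hφ]
      simp [apply_pinv_apply hdim hL hν hν1, hz']
    rw [h1, hG, det_comp, det_comp, det_comp, det_adjoint, mul_pow, mul_pow, h2, h3, hP,
      ← det_one_add_comp_comm]
    ring
  have h0 : 0 ≤ |(1 + D ∘L pinv L).det| * ‖ν - z‖ * L.toLinearMap.normDet := by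
    have := L.toLinearMap.normDet_nonneg
    positivity
  rw [← sq_eq_sq₀ (LinearMap.normDet_nonneg _) h0, hdet, mul_pow, mul_pow, mul_pow, mul_pow, sq_abs]

end LinearAlgebra

/-! ### Inequalities for symmetric operators with a kernel vector -/

section Inequalities

/-- The list has `n + 1` entries because operators on the tangent space are extended by zero to the
normal; the zero entry `j` is discarded. The `n - 1` entries other than `i` and `j` sum to `-κ i`,
and Cauchy-Schwarz on them gives the constant. -/
lemma card_mul_sq_le_of_sum_eq_zero {ι : Type*} [Fintype ι] {n : ℕ} (hn : 1 ≤ n)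
    (hι : Fintype.card ι = n + 1) (κ : ι → ℝ) (hsum : ∑ i, κ i = 0) {j : ι} (hj : κ j = 0) (i : ι) :
    n * κ i ^ 2 ≤ (n - 1) * ∑ k, κ k ^ 2 := by
  classical
  have hn' : (0 : ℝ) ≤ (n : ℝ) - 1 := by
    have : (1 : ℝ) ≤ n := by exact_mod_cast hn
    linarith
  have h0 : 0 ≤ ∑ k, κ k ^ 2 := Finset.sum_nonneg fun k _ => sq_nonneg _
  by_cases hij : i = j
  · rw [hij, hj]; simp; positivity
  set s := (Finset.univ.erase i).erase j with hs
  have hji : j ∈ Finset.univ.erase i := by simp [Ne.symm hij]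
  have h1 : ∑ k, κ k = κ i + (κ j + ∑ k ∈ s, κ k) := by
    rw [hs, Finset.add_sum_erase _ _ hji, Finset.add_sum_erase _ _ (Finset.mem_univ i)]
  have h2 : ∑ k, κ k ^ 2 = κ i ^ 2 + (κ j ^ 2 + ∑ k ∈ s, κ k ^ 2) := by
    rw [hs, Finset.add_sum_erase _ (fun k => κ k ^ 2) hji,
      Finset.add_sum_erase _ (fun k => κ k ^ 2) (Finset.mem_univ i)]
  have hcard : (s.card : ℝ) = n - 1 := by
    rw [hs, Finset.card_erase_of_mem hji, Finset.card_erase_of_mem (Finset.mem_univ i),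
      Finset.card_univ, hι]
    simp
    rw [Nat.cast_sub hn]; simp
  have h3 := sq_sum_le_card_mul_sum_sq (s := s) (f := κ)
  rw [hcard] at h3
  have h4 : ∑ k ∈ s, κ k = -κ i := by rw [hsum, hj] at h1; linarith
  rw [h4] at h3
  rw [h2, hj]
  nlinarith

variable {E : Type*} [NormedAddCommGroup E] [InnerProductSpace ℝ E] [FiniteDimensional ℝ E]
  {n : ℕ} {ν : E}

/-- The eigenbasis of a symmetric operator that kills a unit vector. -/
lemma exists_eigenbasis (hdim : Module.finrank ℝ E = n + 1) {A : E →L[ℝ] E}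
    (hA : ∀ x y, inner ℝ (A x) y = inner ℝ x (A y)) (hν : A ν = 0) (hν1 : ‖ν‖ = 1) :
    ∃ (b : OrthonormalBasis (Fin (n + 1)) ℝ E) (κ : Fin (n + 1) → ℝ),
      (∀ i, A (b i) = κ i • b i) ∧ (∃ j, κ j = 0) ∧ ∀ i, κ i ≠ 0 → inner ℝ (b i) ν = 0 := by
  have hsym : A.toLinearMap.IsSymmetric := hA
  let b := hsym.eigenvectorBasis hdim
  let κ := hsym.eigenvalues hdim
  have hb : ∀ i, A (b i) = κ i • b i := fun i => hsym.apply_eigenvectorBasis hdim i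
  have hort : ∀ i, κ i ≠ 0 → inner ℝ (b i) ν = 0 := by
    intro i hi
    have h := hA (b i) ν
    rw [hν, inner_zero_right, hb, real_inner_smul_left] at h
    exact (mul_eq_zero.mp h).resolve_left hi
  refine ⟨b, κ, hb, ?_, hort⟩
  -- If no eigenvalue vanished, `ν` would be orthogonal to the whole basis.
  by_contra! hne
  have : ν = 0 := by
    rw [← b.sum_repr' ν]
    exact Finset.sum_eq_zero fun i _ => by rw [hort i (hne i), zero_smul]
  rw [this] at hν1
  simp at hν1

variable {b : OrthonormalBasis (Fin (n + 1)) ℝ E} {κ : Fin (n + 1) → ℝ} {A : E →L[ℝ] E}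

lemma traceL_comp_eigen (hb : ∀ i, A (b i) = κ i • b i) (Q : E →L[ℝ] E) :
    traceL E (Q ∘L A) = ∑ i, κ i * inner ℝ (b i) (Q (b i)) := by
  rw [traceL_eq_sum b]
  simp [hb, inner_smul_right]

lemma traceL_eigen (hb : ∀ i, A (b i) = κ i • b i) : traceL E A = ∑ i, κ i := by
  have h := traceL_comp_eigen hb (ContinuousLinearMap.id ℝ E)
  simpa using h

lemma comp_eigen (hb : ∀ i, A (b i) = κ i • b i) (i : Fin (n + 1)) :
    (A ∘L A) (b i) = (κ i ^ 2) • b i := by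
  simp [hb, smul_smul, sq]

lemma traceL_sq_eigen (hb : ∀ i, A (b i) = κ i • b i) :
    traceL E (A ∘L A) = ∑ i, κ i ^ 2 :=
  traceL_eigen (comp_eigen hb)

lemma traceL_sq_nonneg (hdim : Module.finrank ℝ E = n + 1)
    (hA : ∀ x y, inner ℝ (A x) y = inner ℝ x (A y)) (hν : A ν = 0) (hν1 : ‖ν‖ = 1) :
    0 ≤ traceL E (A ∘L A) := by
  obtain ⟨b, κ, hb, -, -⟩ := exists_eigenbasis hdim hA hν hν1
  rw [traceL_sq_eigen hb]
  exact Finset.sum_nonneg fun i _ => sq_nonneg _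

/-- A traceless symmetric operator on the `n`-dimensional space `ν^⊥` satisfies
`|A e|² ≤ (n - 1) / n |A|² |e|²`. -/
lemma norm_apply_sq_le_of_traceless (hn : 1 ≤ n) (hdim : Module.finrank ℝ E = n + 1)
    (hA : ∀ x y, inner ℝ (A x) y = inner ℝ x (A y)) (hν : A ν = 0) (hν1 : ‖ν‖ = 1)
    (htr : traceL E A = 0) (e : E) :
    n * ‖A e‖ ^ 2 ≤ (n - 1) * traceL E (A ∘L A) * ‖e‖ ^ 2 := by
  obtain ⟨b, κ, hb, ⟨j, hj⟩, -⟩ := exists_eigenbasis hdim hA hν hν1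
  rw [traceL_eigen hb] at htr
  rw [traceL_sq_eigen hb, ← b.sum_sq_norm_inner_right e, ← b.sum_sq_norm_inner_right (A e),
    Finset.mul_sum, Finset.mul_sum]
  refine Finset.sum_le_sum fun i _ => ?_
  rw [← hA, hb, real_inner_smul_left, norm_mul, mul_pow]
  have := card_mul_sq_le_of_sum_eq_zero hn (by simp) κ htr hj i
  rw [Real.norm_eq_abs, sq_abs, ← mul_assoc]
  exact mul_le_mul_of_nonneg_right this (sq_nonneg _)

/-- Lower bound for the Ricci curvature of a hypersurface whose mean curvature is small compared
with the second fundamental form. -/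
lemma norm_apply_sq_sub_trace_mul_le (hn : 2 ≤ n) (hdim : Module.finrank ℝ E = n + 1)
    (hA : ∀ x y, inner ℝ (A x) y = inner ℝ x (A y)) (hν : A ν = 0) (hν1 : ‖ν‖ = 1) {θ : ℝ}
    (htr : |traceL E A| ≤ Real.sqrt n * θ * Real.sqrt (traceL E (A ∘L A))) {e : E}
    (he : inner ℝ e ν = 0) :
    ‖A e‖ ^ 2 - traceL E A * inner ℝ (A e) e ≤
      ((n : ℝ) - 1) / n * (1 + ((n : ℝ) - 2) / Real.sqrt ((n : ℝ) - 1) * θ) *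
        traceL E (A ∘L A) * ‖e‖ ^ 2 := by
  have hn2 : (2 : ℝ) ≤ n := by exact_mod_cast hn
  have hn0 : (0 : ℝ) < n := by linarith
  set H := traceL E A with hH
  set a := traceL E (A ∘L A) with ha
  -- The projection to `ν^⊥` plays the role of the identity of the tangent space; it has trace `n`.
  set P : E →L[ℝ] E := ContinuousLinearMap.id ℝ E - (innerSL ℝ ν).smulRight ν with hP
  have hPν : P ν = 0 := by simp [hP, hν1]
  have hPe : P e = e := by simp [hP, real_inner_comm e ν, he]
  have hAP : A ∘L P = A := by ext x; simp [hP, hν]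
  have hPA : P ∘L A = A := by
    ext x
    have : inner ℝ ν (A x) = 0 := by rw [← hA, hν, inner_zero_left]
    simp [hP, this]
  have hPP : P ∘L P = P := by
    ext x
    simp [hP, hν1]
  have htrP : traceL E P = n := by
    rw [hP, map_sub, traceL_id, traceL_smulRight, hdim]; simp [hν1]
  -- The traceless part of `A`, with `|B|² = |A|² - H² / n`.
  set B : E →L[ℝ] E := A - (H / n) • P with hB
  have hBsym : ∀ x y, inner ℝ (B x) y = inner ℝ x (B y) := by
    intro x y
    have hPsym : inner ℝ (P x) y = inner ℝ x (P y) := by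
      simp only [hP, sub_apply, ContinuousLinearMap.id_apply,
        ContinuousLinearMap.smulRight_apply, innerSL_apply_apply, inner_sub_left, inner_sub_right,
        inner_smul_left, inner_smul_right, real_inner_comm x ν]
      simp; ring
    simp [hB, inner_sub_left, inner_sub_right, inner_smul_left, inner_smul_right, hA, hPsym]
  have hBν : B ν = 0 := by simp [hB, hν, hPν]
  have htrB : traceL E B = 0 := by
    rw [hB, map_sub, map_smul, htrP, ← hH]; simp; field_simp; ring
  have hBB : traceL E (B ∘L B) = a - H ^ 2 / n := by
    have : B ∘L B = A ∘L A - (2 * (H / n)) • A + (H / n) ^ 2 • P := by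
      rw [hB, ContinuousLinearMap.sub_comp, ContinuousLinearMap.comp_sub,
        ContinuousLinearMap.comp_sub, ContinuousLinearMap.comp_smul, ContinuousLinearMap.smul_comp,
        ContinuousLinearMap.smul_comp, ContinuousLinearMap.comp_smul, hAP, hPA, hPP]
      module
    rw [this, map_add, map_sub, map_smul, map_smul, htrP, ← ha, ← hH]
    simp; field_simp; ring
  have hkey := norm_apply_sq_le_of_traceless (by omega) hdim hBsym hBν hν1 htrB e
  rw [hBB] at hkey
  have hAe : A e = B e + (H / n) • e := by simp [hB, hPe]
  set l := inner ℝ (B e) e with hl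
  have hlB : |l| ≤ ‖B e‖ * ‖e‖ := abs_real_inner_le_norm _ _
  have h1 : ‖A e‖ ^ 2 = ‖B e‖ ^ 2 + 2 * (H / n) * l + (H / n) ^ 2 * ‖e‖ ^ 2 := by
    rw [hAe, norm_add_sq_real, norm_smul, inner_smul_right, mul_pow, Real.norm_eq_abs, sq_abs]
    ring
  have h2 : inner ℝ (A e) e = l + (H / n) * ‖e‖ ^ 2 := by
    rw [hAe, inner_add_left, inner_smul_left, real_inner_self_eq_norm_sq]; simp [hl]
  have ha0 : 0 ≤ a := traceL_sq_nonneg hdim hA hν hν1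
  set s := Real.sqrt a with hs
  have hs2 : s ^ 2 = a := Real.sq_sqrt ha0
  have hs0 : 0 ≤ s := Real.sqrt_nonneg _
  set r := Real.sqrt ((n : ℝ) - 1) with hr
  have hr2 : r ^ 2 = n - 1 := Real.sq_sqrt (by linarith)
  have hr0 : 0 < r := Real.sqrt_pos.mpr (by linarith)
  set q := Real.sqrt n with hq
  have hq2 : q ^ 2 = n := Real.sq_sqrt hn0.le
  have hq0 : 0 < q := Real.sqrt_pos.mpr hn0
  have hH2 : 0 ≤ H ^ 2 / n := by positivity
  -- The traceless bound for `B`, with the favourable `-H² / n` in `|B|²` dropped.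
  have hBe2 : (q * ‖B e‖) ^ 2 ≤ (r * s * ‖e‖) ^ 2 := by
    rw [mul_pow, mul_pow, mul_pow, hq2, hr2, hs2]
    refine hkey.trans ?_
    have : 0 ≤ ((n : ℝ) - 1) * (H ^ 2 / n) * ‖e‖ ^ 2 :=
      mul_nonneg (mul_nonneg (by linarith) hH2) (sq_nonneg _)
    nlinarith
  have hBe : q * ‖B e‖ ≤ r * s * ‖e‖ := abs_le_of_sq_le_sq' hBe2 (by positivity) |>.2
  -- The factor `√n` in the bound on `H` is exactly what the bound on `√n ‖B e‖` consumes.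
  have hHl : |H * l| ≤ θ * s * (r * s * ‖e‖) * ‖e‖ := by
    rw [abs_mul]
    calc |H| * |l| ≤ (q * θ * s) * (‖B e‖ * ‖e‖) :=
          mul_le_mul htr hlB (abs_nonneg _) ((abs_nonneg _).trans htr)
      _ = (θ * s) * (q * ‖B e‖) * ‖e‖ := by ring
      _ ≤ (θ * s) * (r * s * ‖e‖) * ‖e‖ := by
          have : 0 ≤ θ * s := by
            have h := (abs_nonneg _).trans htr
            rw [mul_assoc] at h
            exact nonneg_of_mul_nonneg_right h hq0
          gcongr
  -- The coefficient `n - 2` is `n` from the trace term minus `2` from the square. The last term has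
  -- a favourable sign and is dropped at the end.
  have h3 : ‖A e‖ ^ 2 - H * inner ℝ (A e) e =
      ‖B e‖ ^ 2 - ((n : ℝ) - 2) / n * (H * l) - ((n : ℝ) - 1) / n ^ 2 * H ^ 2 * ‖e‖ ^ 2 := by
    rw [h1, h2]; field_simp; ring
  have h4 : ((n : ℝ) - 1) / n * (1 + ((n : ℝ) - 2) / r * θ) * a * ‖e‖ ^ 2 =
      ((n : ℝ) - 1) / n * a * ‖e‖ ^ 2 + ((n : ℝ) - 2) / n * (θ * s * (r * s * ‖e‖) * ‖e‖) := by
    rw [← hr2, ← hs2]; field_simp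
  rw [h3, h4]
  have h5 : ‖B e‖ ^ 2 ≤ ((n : ℝ) - 1) / n * a * ‖e‖ ^ 2 := by
    have : n * ‖B e‖ ^ 2 ≤ (n - 1) * a * ‖e‖ ^ 2 := by
      rw [mul_pow, mul_pow, mul_pow, hq2, hr2, hs2] at hBe2; exact hBe2
    rw [div_mul_eq_mul_div, div_mul_eq_mul_div, le_div_iff₀ hn0]; linarith
  have h6 : -(((n : ℝ) - 2) / n * (H * l)) ≤
      ((n : ℝ) - 2) / n * (θ * s * (r * s * ‖e‖) * ‖e‖) := by
    rw [← mul_neg]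
    refine mul_le_mul_of_nonneg_left ?_ (div_nonneg (by linarith) hn0.le)
    exact (neg_le_abs _).trans hHl
  have h7 : 0 ≤ ((n : ℝ) - 1) / n ^ 2 * H ^ 2 * ‖e‖ ^ 2 :=
    mul_nonneg (mul_nonneg (div_nonneg (by linarith) (by positivity)) (sq_nonneg _)) (sq_nonneg _)
  linarith

variable {Q : E →L[ℝ] E} {ε : ℝ}

/-- Only eigenvectors with nonzero eigenvalue contribute; they are orthogonal to `ν`, where `Q` is
bounded below. Nothing is needed about `Q` in the normal direction. -/
lemma traceL_sq_le_of_pinched (hdim : Module.finrank ℝ E = n + 1)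
    (hA : ∀ x y, inner ℝ (A x) y = inner ℝ x (A y)) (hν : A ν = 0) (hν1 : ‖ν‖ = 1)
    (hQ : ∀ ξ, inner ℝ ξ ν = 0 → ‖ξ‖ ^ 2 ≤ inner ℝ ξ (Q ξ)) :
    traceL E (A ∘L A) ≤ traceL E (Q ∘L (A ∘L A)) := by
  obtain ⟨b, κ, hb, -, hort⟩ := exists_eigenbasis hdim hA hν hν1
  rw [traceL_sq_eigen hb, traceL_comp_eigen (comp_eigen hb)]
  refine Finset.sum_le_sum fun i _ => ?_
  by_cases hi : κ i = 0
  · simp [hi]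
  · have := hQ (b i) (hort i hi)
    rw [b.norm_eq_one] at this
    nlinarith [sq_nonneg (κ i)]

/-- If `tr (Q A) = 0` with `Q` close to the identity, then the trace of `A` is small compared
with `|A|`. -/
lemma abs_traceL_le_of_pinched (hdim : Module.finrank ℝ E = n + 1)
    (hA : ∀ x y, inner ℝ (A x) y = inner ℝ x (A y)) (hν : A ν = 0) (hν1 : ‖ν‖ = 1) (hε : 0 ≤ ε)
    (hQ : ∀ ξ, inner ℝ ξ ν = 0 →
      ‖ξ‖ ^ 2 ≤ inner ℝ ξ (Q ξ) ∧ inner ℝ ξ (Q ξ) ≤ (1 + ε) * ‖ξ‖ ^ 2)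
    (htr : traceL E (Q ∘L A) = 0) :
    |traceL E A| ≤ Real.sqrt n * (ε / (1 + ε)) * Real.sqrt (traceL E (A ∘L A)) := by
  classical
  obtain ⟨b, κ, hb, ⟨j, hj⟩, hort⟩ := exists_eigenbasis hdim hA hν hν1
  rw [traceL_comp_eigen hb] at htr
  rw [traceL_eigen hb, traceL_sq_eigen hb]
  set θ := ε / (1 + ε) with hθ
  have hθ0 : 0 ≤ θ := by positivity
  -- A multiple of `tr (Q A) = 0` is subtracted. Dividing by `1 + ε` puts the bracket in `[0, ε / (1
  -- + ε)]` wherever `κ i ≠ 0`.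
  have h1 : ∑ i, κ i = ∑ i, κ i * (1 - inner ℝ (b i) (Q (b i)) / (1 + ε)) := by
    simp only [mul_sub, mul_one, Finset.sum_sub_distrib, ← mul_div_assoc, ← Finset.sum_div, htr]
    simp
  have h2 : |∑ i, κ i| ≤ θ * ∑ i, |κ i| := by
    rw [h1, Finset.mul_sum]
    refine (Finset.abs_sum_le_sum_abs _ _).trans (Finset.sum_le_sum fun i _ => ?_)
    by_cases hi : κ i = 0
    · simp [hi]
    have h := hQ (b i) (hort i hi)
    rw [b.norm_eq_one] at h
    rw [abs_mul, mul_comm]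
    refine mul_le_mul_of_nonneg_right ?_ (abs_nonneg _)
    have h1e : 0 < 1 + ε := by linarith
    rw [abs_le]
    constructor
    · have : inner ℝ (b i) (Q (b i)) / (1 + ε) ≤ 1 := by rw [div_le_one h1e]; linarith
      linarith
    · have : 1 / (1 + ε) ≤ inner ℝ (b i) (Q (b i)) / (1 + ε) := by gcongr; linarith
      have h' : 1 - 1 / (1 + ε) = θ := by rw [hθ]; field_simp; ring
      linarith
  -- Removing the zero eigenvalue before Cauchy-Schwarz gives `√n` instead of `√(n + 1)`.
  have h3 : (∑ i, |κ i|) ≤ Real.sqrt n * Real.sqrt (∑ i, κ i ^ 2) := by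
    have hs : ∑ i, |κ i| = ∑ i ∈ Finset.univ.erase j, |κ i| := by
      rw [← Finset.add_sum_erase _ _ (Finset.mem_univ j), hj]; simp
    have hs2 : ∑ i, κ i ^ 2 = ∑ i ∈ Finset.univ.erase j, |κ i| ^ 2 := by
      rw [← Finset.add_sum_erase _ _ (Finset.mem_univ j), hj]; simp
    rw [hs, hs2, ← Real.sqrt_mul (by positivity)]
    refine Real.le_sqrt_of_sq_le ?_
    have := sq_sum_le_card_mul_sum_sq (s := Finset.univ.erase j) (f := fun i => |κ i|)
    simpa using this
  calc _ ≤ θ * ∑ i, |κ i| := h2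
    _ ≤ θ * (Real.sqrt n * Real.sqrt (∑ i, κ i ^ 2)) := by gcongr
    _ = _ := by ring

end Inequalities

/-! ### Smooth dependence of the Moore-Penrose inverse -/

section Smoothness

variable {V E : Type*} [NormedAddCommGroup V] [InnerProductSpace ℝ V] [FiniteDimensional ℝ V]
  [NormedAddCommGroup E] [InnerProductSpace ℝ E] [FiniteDimensional ℝ E]

lemma contDiff_adjoint {k : WithTop ℕ∞} :
    ContDiff ℝ k (fun L : V →L[ℝ] E => ContinuousLinearMap.adjoint L) := by
  let l : (V →L[ℝ] E) →ₗ[ℝ] (E →L[ℝ] V) :=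
    { toFun := fun L => ContinuousLinearMap.adjoint L
      map_add' := by intro A B; simp
      map_smul' := by intro c A; simp }
  exact (LinearMap.toContinuousLinearMap l).contDiff

lemma contDiffAt_pinv {k : WithTop ℕ∞} {L : V →L[ℝ] E} (hL : Function.Injective L) :
    ContDiffAt ℝ k (fun L : V →L[ℝ] E => pinv L) L := by
  have h1 : ContDiff ℝ k (fun L : V →L[ℝ] E => ContinuousLinearMap.adjoint L ∘L L) :=
    contDiff_adjoint.clm_comp contDiff_id
  have h2 : ContDiffAt ℝ k (fun L : V →L[ℝ] E => (ContinuousLinearMap.adjoint L ∘L L).inverse) L :=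
    ContDiffAt.comp (g := ContinuousLinearMap.inverse) L
      (isInvertible_adjoint_comp hL).contDiffAt_map_inverse h1.contDiffAt
  exact h2.clm_comp contDiff_adjoint.contDiffAt

end Smoothness

/-! ### Charts and tangential derivatives -/

/-- Euclidean space of dimension `k`. -/
abbrev Euc (k : ℕ) := EuclideanSpace ℝ (Fin k)

lemma finrank_euc_succ (n : ℕ) :
    Module.finrank ℝ (Euc (n + 1)) = Module.finrank ℝ (Euc n) + 1 := by simp

section Charts

variable {n : ℕ} {M : Type*} [TopologicalSpace M] [ChartedSpace (EuclideanSpace ℝ (Fin n)) M]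
  [IsManifold (𝓡 n) ∞ M]
  {W W' : Type*} [NormedAddCommGroup W] [NormedSpace ℝ W] [NormedAddCommGroup W'] [NormedSpace ℝ W']
  {e : OpenPartialHomeomorph M (EuclideanSpace ℝ (Fin n))} {k : WithTop ℕ∞}

lemma contMDiffOn_symm_of_mem_atlas (he : e ∈ atlas (Euc n) M) (hk : k ≤ (∞ : WithTop ℕ∞)) :
    ContMDiffOn (𝓡 n) (𝓡 n) k e.symm e.target :=
  (contMDiffOn_symm_of_mem_maximalAtlas
    (IsManifold.subset_maximalAtlas (I := 𝓡 n) (n := ∞) he)).of_le hk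

lemma contMDiffOn_of_mem_atlas (he : e ∈ atlas (Euc n) M) (hk : k ≤ (∞ : WithTop ℕ∞)) :
    ContMDiffOn (𝓡 n) (𝓡 n) k e e.source :=
  (contMDiffOn_of_mem_maximalAtlas
    (IsManifold.subset_maximalAtlas (I := 𝓡 n) (n := ∞) he)).of_le hk

lemma ContMDiff.contDiffOn_comp_chart_symm {Y : M → W} (hY : ContMDiff (𝓡 n) 𝓘(ℝ, W) k Y)
    (he : e ∈ atlas (Euc n) M) (hk : k ≤ (∞ : WithTop ℕ∞)) :
    ContDiffOn ℝ k (Y ∘ e.symm) e.target :=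
  contMDiffOn_iff_contDiffOn.mp (hY.comp_contMDiffOn (contMDiffOn_symm_of_mem_atlas he hk))

lemma contMDiff_of_comp_chart_symm {Y : M → W} (hk : k ≤ (∞ : WithTop ℕ∞))
    (hY : ∀ e ∈ atlas (Euc n) M, ContDiffOn ℝ k (Y ∘ e.symm) e.target) :
    ContMDiff (𝓡 n) 𝓘(ℝ, W) k Y := by
  intro x
  have he := chart_mem_atlas (Euc n) x
  have h1 : ContMDiffOn (𝓡 n) 𝓘(ℝ, W) k ((Y ∘ (chartAt (Euc n) x).symm) ∘ chartAt (Euc n) x)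
      (chartAt (Euc n) x).source :=
    (contMDiffOn_iff_contDiffOn.mpr (hY _ he)).comp (contMDiffOn_of_mem_atlas he hk)
      (fun y hy => (chartAt (Euc n) x).map_source hy)
  have h2 : ContMDiffOn (𝓡 n) 𝓘(ℝ, W) k Y (chartAt (Euc n) x).source :=
    h1.congr fun y hy => by simp [(chartAt (Euc n) x).left_inv hy]
  exact h2.contMDiffAt ((chartAt (Euc n) x).open_source.mem_nhds (mem_chart_source _ x))

lemma exists_chart_symm_eq (x : M) :
    ∃ e ∈ atlas (Euc n) M, ∃ y ∈ e.target, e.symm y = x :=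
  ⟨chartAt (Euc n) x, chart_mem_atlas _ x, chartAt (Euc n) x x,
    (chartAt (Euc n) x).map_source (mem_chart_source _ x),
    (chartAt (Euc n) x).left_inv (mem_chart_source _ x)⟩

/-- The differential of a map to a vector space, on the model space. -/
def mdiff (Y : M → W) (x : M) : Euc n →L[ℝ] W := mfderiv (𝓡 n) 𝓘(ℝ, W) Y x

/-- The derivative of `Y` along the hypersurface, extended by zero to the normal direction. -/
def tangDeriv (X : M → EuclideanSpace ℝ (Fin (n + 1))) (Y : M → W) (x : M) :
    EuclideanSpace ℝ (Fin (n + 1)) →L[ℝ] W :=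
  mdiff Y x ∘L tangentialPart X x

lemma tangDeriv_apply (X : M → EuclideanSpace ℝ (Fin (n + 1))) (Y : M → W) (x : M)
    (v : Euc (n + 1)) : tangDeriv X Y x v = mdiff Y x (tangentialPart X x v) := rfl

lemma differential_eq_mdiff (X : M → EuclideanSpace ℝ (Fin (n + 1))) (x : M) :
    differential X x = mdiff X x := rfl

lemma tangentialPart_eq_pinv (X : M → EuclideanSpace ℝ (Fin (n + 1))) (x : M) :
    tangentialPart X x = pinv (differential X x) := rfl

/-- The differential of an inverse chart as a continuous linear equivalence. -/
def chartSymmDeriv (he : e ∈ atlas (Euc n) M) {y : Euc n} (hy : y ∈ e.target) :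
    Euc n ≃L[ℝ] Euc n :=
  (mdifferentiable_of_mem_atlas (I := 𝓡 n) he).symm.mfderiv hy

lemma hasFDerivAt_comp_chart_symm (he : e ∈ atlas (Euc n) M) {y : Euc n} (hy : y ∈ e.target)
    {Y : M → W} (hY : MDifferentiableAt (𝓡 n) 𝓘(ℝ, W) Y (e.symm y)) :
    HasFDerivAt (Y ∘ e.symm)
      (mdiff Y (e.symm y) ∘L (chartSymmDeriv he hy).toContinuousLinearMap) y := by
  have h1 : MDifferentiableAt (𝓡 n) (𝓡 n) e.symm y :=
    (mdifferentiable_of_mem_atlas (I := 𝓡 n) he).symm.mdifferentiableAt hy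
  exact (hY.hasMFDerivAt.comp y h1.hasMFDerivAt).hasFDerivAt

lemma fderiv_comp_chart_symm (he : e ∈ atlas (Euc n) M) {y : Euc n} (hy : y ∈ e.target)
    {Y : M → W} (hY : MDifferentiableAt (𝓡 n) 𝓘(ℝ, W) Y (e.symm y)) :
    fderiv ℝ (Y ∘ e.symm) y =
      mdiff Y (e.symm y) ∘L (chartSymmDeriv he hy).toContinuousLinearMap :=
  (hasFDerivAt_comp_chart_symm he hy hY).fderiv

/-- The differential of the chart cancels by `comp_pinv_comp_equiv`, so tangential derivatives
become ordinary derivatives in coordinates. -/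
lemma tangDeriv_eq_fderiv_comp_pinv {X : M → Euc (n + 1)} {Y : M → W}
    (he : e ∈ atlas (Euc n) M) {y : Euc n} (hy : y ∈ e.target)
    (hX : MDifferentiableAt (𝓡 n) 𝓘(ℝ, Euc (n + 1)) X (e.symm y))
    (hXi : Function.Injective (differential X (e.symm y)))
    (hY : MDifferentiableAt (𝓡 n) 𝓘(ℝ, W) Y (e.symm y)) :
    tangDeriv X Y (e.symm y) =
      fderiv ℝ (Y ∘ e.symm) y ∘L pinv (fderiv ℝ (X ∘ e.symm) y) := by
  rw [fderiv_comp_chart_symm he hy hY, fderiv_comp_chart_symm he hy hX,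
    ContinuousLinearMap.comp_assoc, ← differential_eq_mdiff, comp_pinv_comp_equiv hXi]
  rfl

lemma injective_fderiv_comp_chart_symm {X : M → Euc (n + 1)}
    (he : e ∈ atlas (Euc n) M) {y : Euc n} (hy : y ∈ e.target)
    (hX : MDifferentiableAt (𝓡 n) 𝓘(ℝ, Euc (n + 1)) X (e.symm y))
    (hXi : Function.Injective (differential X (e.symm y))) :
    Function.Injective (fderiv ℝ (X ∘ e.symm) y) := by
  rw [fderiv_comp_chart_symm he hy hX]
  exact hXi.comp (chartSymmDeriv he hy).injective

/-- Exactly one derivative is lost, since `pinv` is smooth at injective maps. -/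
lemma ContMDiff.tangDeriv {X : M → Euc (n + 1)} {Y : M → W} {m : WithTop ℕ∞} (hm : m + 1 ≤ (∞ : WithTop ℕ∞))
    (hX : ContMDiff (𝓡 n) 𝓘(ℝ, Euc (n + 1)) (m + 1) X)
    (hXi : ∀ x, Function.Injective (differential X x))
    (hY : ContMDiff (𝓡 n) 𝓘(ℝ, W) (m + 1) Y) :
    ContMDiff (𝓡 n) 𝓘(ℝ, Euc (n + 1) →L[ℝ] W) m (tangDeriv X Y) := by
  have hm0 : m ≤ (∞ : WithTop ℕ∞) := le_self_add.trans hm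
  have h1 : (m + 1 : WithTop ℕ∞) ≠ 0 := by simp
  have hXd : MDifferentiable (𝓡 n) 𝓘(ℝ, Euc (n + 1)) X := hX.mdifferentiable h1
  have hYd : MDifferentiable (𝓡 n) 𝓘(ℝ, W) Y := hY.mdifferentiable h1
  refine contMDiff_of_comp_chart_symm hm0 fun e he => ?_
  have hYc := (hY.contDiffOn_comp_chart_symm he hm).fderiv_of_isOpen e.open_target le_rfl
  have hXc := (hX.contDiffOn_comp_chart_symm he hm).fderiv_of_isOpen e.open_target le_rfl
  have hp : ContDiffOn ℝ m (fun y => pinv (fderiv ℝ (X ∘ e.symm) y)) e.target := fun y hy =>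
    (contDiffAt_pinv (injective_fderiv_comp_chart_symm he hy (hXd _) (hXi _))).comp_contDiffWithinAt
      y (hXc y hy)
  refine (hYc.clm_comp hp).congr fun y hy => ?_
  exact tangDeriv_eq_fderiv_comp_pinv he hy (hXd _) (hXi _) (hYd _)

end Charts

/-! ### Product and chain rules for tangential derivatives; symmetry of the shape operator -/

section Rules

variable {n : ℕ} {M : Type*} [TopologicalSpace M] [ChartedSpace (EuclideanSpace ℝ (Fin n)) M]
  [IsManifold (𝓡 n) ∞ M]
  {W W' : Type*} [NormedAddCommGroup W] [NormedSpace ℝ W] [NormedAddCommGroup W'] [NormedSpace ℝ W']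
  {X ν : M → EuclideanSpace ℝ (Fin (n + 1))}

lemma mdiff_comp {Y : M → W} {G : W → W'} {x : M} (hG : DifferentiableAt ℝ G (Y x))
    (hY : MDifferentiableAt (𝓡 n) 𝓘(ℝ, W) Y x) :
    mdiff (n := n) (fun x => G (Y x)) x = fderiv ℝ G (Y x) ∘L mdiff Y x :=
  (HasMFDerivAt.comp x hG.hasFDerivAt.hasMFDerivAt hY.hasMFDerivAt).mfderiv

lemma tangDeriv_comp {Y : M → W} {G : W → W'} {x : M} (hG : DifferentiableAt ℝ G (Y x))
    (hY : MDifferentiableAt (𝓡 n) 𝓘(ℝ, W) Y x) :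
    tangDeriv X (fun x => G (Y x)) x = fderiv ℝ G (Y x) ∘L tangDeriv X Y x := by
  unfold tangDeriv
  rw [← ContinuousLinearMap.comp_assoc, mdiff_comp hG hY]

lemma MDifferentiableAt.pair {Y : M → W} {Z : M → W'} {x : M}
    (hY : MDifferentiableAt (𝓡 n) 𝓘(ℝ, W) Y x)
    (hZ : MDifferentiableAt (𝓡 n) 𝓘(ℝ, W') Z x) :
    MDifferentiableAt (𝓡 n) 𝓘(ℝ, W × W') (fun x => (Y x, Z x)) x := by
  have h := hY.prodMk hZ
  rw [← modelWithCornersSelf_prod, chartedSpaceSelf_prod] at h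
  exact h

lemma mdiff_pair {Y : M → W} {Z : M → W'} {x : M} (hY : MDifferentiableAt (𝓡 n) 𝓘(ℝ, W) Y x)
    (hZ : MDifferentiableAt (𝓡 n) 𝓘(ℝ, W') Z x) :
    mdiff (n := n) (fun x => (Y x, Z x)) x = (mdiff Y x).prod (mdiff Z x) := by
  obtain ⟨e, he, y, hy, rfl⟩ := exists_chart_symm_eq (n := n) x
  have h1 := (hasFDerivAt_comp_chart_symm he hy hY).prodMk (hasFDerivAt_comp_chart_symm he hy hZ)
  have h2 := hasFDerivAt_comp_chart_symm he hy (hY.pair hZ)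
  have h3 := h2.unique h1
  ext1 v
  obtain ⟨w, rfl⟩ := (chartSymmDeriv he hy).surjective v
  exact congrArg (fun l => l w) h3

lemma tangDeriv_bilin {W'' : Type*} [NormedAddCommGroup W''] [NormedSpace ℝ W'']
    (B : W →L[ℝ] W' →L[ℝ] W'') {Y : M → W} {Z : M → W'} {x : M}
    (hY : MDifferentiableAt (𝓡 n) 𝓘(ℝ, W) Y x)
    (hZ : MDifferentiableAt (𝓡 n) 𝓘(ℝ, W') Z x) (v : Euc (n + 1)) :
    tangDeriv X (fun x => B (Y x) (Z x)) x v =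
      B (tangDeriv X Y x v) (Z x) + B (Y x) (tangDeriv X Z x v) := by
  have hp := hY.pair hZ
  have hG := B.isBoundedBilinearMap.hasFDerivAt (Y x, Z x)
  have h := tangDeriv_comp (X := X) (Y := fun x => (Y x, Z x))
    (G := fun p : W × W' => B p.1 p.2) hG.differentiableAt hp
  have h2 : tangDeriv X (fun x => B (Y x) (Z x)) x v =
    fderiv ℝ (fun p : W × W' => B p.1 p.2) (Y x, Z x) (tangDeriv X (fun x => (Y x, Z x)) x v) :=
    congrArg (fun l => l v) h
  have h3 : tangDeriv X (fun x => (Y x, Z x)) x v = (tangDeriv X Y x v, tangDeriv X Z x v) := by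
    rw [tangDeriv_apply, mdiff_pair hY hZ]; rfl
  rw [h2, hG.fderiv, h3]
  simp [IsBoundedBilinearMap.deriv, add_comm]

lemma tangDeriv_add {Y Z : M → W} {x : M} (hY : MDifferentiableAt (𝓡 n) 𝓘(ℝ, W) Y x)
    (hZ : MDifferentiableAt (𝓡 n) 𝓘(ℝ, W) Z x) :
    tangDeriv X (fun x => Y x + Z x) x = tangDeriv X Y x + tangDeriv X Z x := by
  have h : mdiff (n := n) (fun x => Y x + Z x) x = mdiff Y x + mdiff Z x := mfderiv_add hY hZ
  unfold tangDeriv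
  rw [← ContinuousLinearMap.add_comp, ← h]

lemma tangDeriv_inner {Y Z : M → Euc (n + 1)} {x : M}
    (hY : MDifferentiableAt (𝓡 n) 𝓘(ℝ, Euc (n + 1)) Y x)
    (hZ : MDifferentiableAt (𝓡 n) 𝓘(ℝ, Euc (n + 1)) Z x) (v : Euc (n + 1)) :
    tangDeriv X (fun x => inner ℝ (Y x) (Z x)) x v =
      inner ℝ (tangDeriv X Y x v) (Z x) + inner ℝ (Y x) (tangDeriv X Z x v) :=
  tangDeriv_bilin (innerSL ℝ) hY hZ v

lemma tangDeriv_smul {f : M → ℝ} {Z : M → W} {x : M}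
    (hf : MDifferentiableAt (𝓡 n) 𝓘(ℝ, ℝ) f x)
    (hZ : MDifferentiableAt (𝓡 n) 𝓘(ℝ, W) Z x) (v : Euc (n + 1)) :
    tangDeriv X (fun x => f x • Z x) x v =
      tangDeriv X f x v • Z x + f x • tangDeriv X Z x v :=
  tangDeriv_bilin (ContinuousLinearMap.lsmul ℝ ℝ) hf hZ v

lemma tangDeriv_mul {f g : M → ℝ} {x : M} (hf : MDifferentiableAt (𝓡 n) 𝓘(ℝ, ℝ) f x)
    (hg : MDifferentiableAt (𝓡 n) 𝓘(ℝ, ℝ) g x) (v : Euc (n + 1)) :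
    tangDeriv X (fun x => f x * g x) x v =
      tangDeriv X f x v * g x + f x * tangDeriv X g x v :=
  tangDeriv_smul hf hg v

lemma tangDeriv_const (c : W) (x : M) : tangDeriv X (fun _ => c) x = 0 := by
  have h : mdiff (n := n) (fun _ : M => c) x = 0 := mfderiv_const
  unfold tangDeriv
  rw [h, ContinuousLinearMap.zero_comp]

lemma inner_hypGradient (f : M → ℝ) (x : M) (v : Euc (n + 1)) :
    inner ℝ (hypGradient X f x) v = tangDeriv X f x v := by
  unfold hypGradient
  rw [InnerProductSpace.toDual_symm_apply]
  rfl

lemma hypGradient_eq_toDual_symm (f : M → ℝ) (x : M) :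
    hypGradient X f x = (InnerProductSpace.toDual ℝ (Euc (n + 1))).symm (tangDeriv X f x) := rfl

/-- Cyclicity of the trace moves the computation from the tangent space to the fixed space `ℝⁿ⁺¹`,
where the operators vanish on `ν`. -/
lemma hypDivergence_eq_traceL (Y : M → Euc (n + 1)) (x : M) :
    hypDivergence X Y x = traceL (Euc (n + 1)) (tangDeriv X Y x) := by
  change traceL (Euc n) (tangentialPart X x ∘L differential Y x) = _
  rw [traceL_comp_comm]
  rfl

lemma secondFormNormSq_eq_traceL (x : M) :
    secondFormNormSq X ν x = traceL (Euc (n + 1)) (tangDeriv X ν x ∘L tangDeriv X ν x) := by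
  change traceL (Euc n) ((tangentialPart X x ∘L differential ν x) ∘L
    (tangentialPart X x ∘L differential ν x)) = _
  rw [ContinuousLinearMap.comp_assoc, traceL_comp_comm]
  rfl

namespace IsTwoSidedImmersion

variable (hX : IsTwoSidedImmersion X ν)
include hX

lemma mdifferentiable : MDifferentiable (𝓡 n) 𝓘(ℝ, Euc (n + 1)) X :=
  hX.contMDiff.mdifferentiable (by simp)

lemma mdifferentiable_normal : MDifferentiable (𝓡 n) 𝓘(ℝ, Euc (n + 1)) ν :=
  hX.contMDiff_normal.mdifferentiable (by simp)

lemma tangDeriv_differential (Y : M → W) (x : M) (a : Euc n) :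
    tangDeriv X Y x (differential X x a) = mdiff Y x a := by
  rw [tangDeriv_apply, tangentialPart_eq_pinv, pinv_apply_self (hX.injective x)]

lemma tangDeriv_normal_apply (Y : M → W) (x : M) : tangDeriv X Y x (ν x) = 0 := by
  rw [tangDeriv_apply, tangentialPart_eq_pinv, pinv_apply_normal (hX.orthogonal x), map_zero]

lemma differential_tangentialPart (x : M) (v : Euc (n + 1)) :
    differential X x (tangentialPart X x v) = v - (inner ℝ (ν x) v : ℝ) • ν x :=
  apply_pinv_apply (finrank_euc_succ n) (hX.injective x) (hX.orthogonal x) (hX.norm_normal x) v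

lemma tangDeriv_self (x : M) (v : Euc (n + 1)) :
    tangDeriv X X x v = v - (inner ℝ (ν x) v : ℝ) • ν x :=
  hX.differential_tangentialPart x v

lemma inner_tangDeriv_normal (x : M) (v : Euc (n + 1)) :
    inner ℝ (tangDeriv X ν x v) (ν x) = 0 := by
  have h := tangDeriv_inner (X := X) (hX.mdifferentiable_normal x) (hX.mdifferentiable_normal x) v
  have h1 : (fun x => inner ℝ (ν x) (ν x)) = fun _ : M => (1 : ℝ) := by
    ext x; rw [real_inner_self_eq_norm_sq, hX.norm_normal]; norm_num
  rw [h1, tangDeriv_const, real_inner_comm (tangDeriv X ν x v)] at h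
  simp at h
  linarith

lemma inner_hypGradient_normal (f : M → ℝ) (x : M) : inner ℝ (hypGradient X f x) (ν x) = 0 := by
  rw [inner_hypGradient, hX.tangDeriv_normal_apply]

/-- The tangential part of the derivative of a field dual to an exact form is symmetric. -/
lemma inner_tangDeriv_comm_of_exact {v : M → Euc (n + 1)} {u : M → ℝ}
    (hv : ContMDiff (𝓡 n) 𝓘(ℝ, Euc (n + 1)) 1 v) (hu : ContMDiff (𝓡 n) 𝓘(ℝ, ℝ) 2 u)
    (huv : ∀ x w, inner ℝ (v x) w - inner ℝ (v x) (ν x) * inner ℝ (ν x) w = tangDeriv X u x w)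
    (x : M) (a b : Euc n) :
    inner ℝ (tangDeriv X v x (differential X x a)) (differential X x b) =
      inner ℝ (tangDeriv X v x (differential X x b)) (differential X x a) := by
  obtain ⟨e, he, y, hyt, rfl⟩ := exists_chart_symm_eq (n := n) x
  have hvd : MDifferentiable (𝓡 n) 𝓘(ℝ, Euc (n + 1)) v := hv.mdifferentiable (by simp)
  have hud : MDifferentiable (𝓡 n) 𝓘(ℝ, ℝ) u := hu.mdifferentiable (by simp)
  have hXc := hX.contMDiff.contDiffOn_comp_chart_symm he (by norm_cast)
  have huc := hu.contDiffOn_comp_chart_symm he (by norm_cast)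
  have hnhds : e.target ∈ 𝓝 y := e.open_target.mem_nhds hyt
  have hXa : ContDiffAt ℝ 3 (X ∘ e.symm) y := hXc.contDiffAt hnhds
  have hua : ContDiffAt ℝ 2 (u ∘ e.symm) y := huc.contDiffAt hnhds
  -- the relation between `v` and `du` in the chart
  have hrel : ∀ c : Euc n, (fun z => inner ℝ ((v ∘ e.symm) z) (fderiv ℝ (X ∘ e.symm) z c)) =ᶠ[𝓝 y]
      fun z => fderiv ℝ (u ∘ e.symm) z c := by
    intro c
    filter_upwards [hnhds] with z hz
    rw [fderiv_comp_chart_symm he hz (hX.mdifferentiable _), fderiv_comp_chart_symm he hz (hud _)]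
    have h1 := huv (e.symm z) (differential X (e.symm z) (chartSymmDeriv he hz c))
    rw [hX.tangDeriv_differential, real_inner_comm _ (ν _), hX.orthogonal, mul_zero, sub_zero] at h1
    exact h1
  have hX1 : ContDiffAt ℝ 1 (fderiv ℝ (X ∘ e.symm)) y :=
    hXa.fderiv_right (by norm_num)
  have hu1 : ContDiffAt ℝ 1 (fderiv ℝ (u ∘ e.symm)) y :=
    hua.fderiv_right (by norm_num)
  have hX2 : HasFDerivAt (fderiv ℝ (X ∘ e.symm)) (fderiv ℝ (fderiv ℝ (X ∘ e.symm)) y) y :=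
    (hX1.differentiableAt (by simp)).hasFDerivAt
  have hu2 : HasFDerivAt (fderiv ℝ (u ∘ e.symm)) (fderiv ℝ (fderiv ℝ (u ∘ e.symm)) y) y :=
    (hu1.differentiableAt (by simp)).hasFDerivAt
  have hsymX : IsSymmSndFDerivAt ℝ (X ∘ e.symm) y := hXa.isSymmSndFDerivAt (by simp; norm_num)
  have hsymu : IsSymmSndFDerivAt ℝ (u ∘ e.symm) y := hua.isSymmSndFDerivAt (by simp)
  -- Differentiating `⟨v, ∂_c X⟩ = ∂_c u` in the direction `d` expresses the bilinear form through
  -- second derivatives of `u` and `X`, which are symmetric in `c` and `d`.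
  have hkey : ∀ c d : Euc n, inner ℝ (fderiv ℝ (v ∘ e.symm) y d) (fderiv ℝ (X ∘ e.symm) y c) =
      fderiv ℝ (fderiv ℝ (u ∘ e.symm)) y d c -
        inner ℝ (v (e.symm y)) (fderiv ℝ (fderiv ℝ (X ∘ e.symm)) y d c) := by
    intro c d
    have hv1 : HasFDerivAt (v ∘ e.symm) (fderiv ℝ (v ∘ e.symm) y) y :=
      (hasFDerivAt_comp_chart_symm he hyt (hvd _)).differentiableAt.hasFDerivAt
    have h1 := hv1.inner ℝ (hX2.clm_apply (hasFDerivAt_const c y))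
    have h2 := (hu2.clm_apply (hasFDerivAt_const c y)).congr_of_eventuallyEq (hrel c)
    have h3 := congrArg (fun l => l d) (h1.unique h2)
    simp [fderivInnerCLM_apply] at h3
    linarith
  have hfin : ∀ c d : Euc n,
      inner ℝ (fderiv ℝ (v ∘ e.symm) y d) (fderiv ℝ (X ∘ e.symm) y c) =
        inner ℝ (fderiv ℝ (v ∘ e.symm) y c) (fderiv ℝ (X ∘ e.symm) y d) := by
    intro c d
    rw [hkey, hkey, hsymX.eq, hsymu.eq]
  have h := hfin ((chartSymmDeriv he hyt).symm b) ((chartSymmDeriv he hyt).symm a)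
  rw [fderiv_comp_chart_symm he hyt (hX.mdifferentiable _), fderiv_comp_chart_symm he hyt (hvd _)]
    at h
  rw [hX.tangDeriv_differential, hX.tangDeriv_differential, differential_eq_mdiff]
  simpa using h

lemma inner_tangDeriv_comm_of_exact' {v : M → Euc (n + 1)} {u : M → ℝ}
    (hv : ContMDiff (𝓡 n) 𝓘(ℝ, Euc (n + 1)) 1 v) (hu : ContMDiff (𝓡 n) 𝓘(ℝ, ℝ) 2 u)
    (huv : ∀ x w, inner ℝ (v x) w - inner ℝ (v x) (ν x) * inner ℝ (ν x) w = tangDeriv X u x w)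
    (x : M) {a b : Euc (n + 1)} (ha : inner ℝ a (ν x) = 0) (hb : inner ℝ b (ν x) = 0) :
    inner ℝ (tangDeriv X v x a) b = inner ℝ (tangDeriv X v x b) a := by
  have h := hX.inner_tangDeriv_comm_of_exact hv hu huv x (tangentialPart X x a)
    (tangentialPart X x b)
  rw [hX.differential_tangentialPart, hX.differential_tangentialPart, 
    real_inner_comm a, ha, real_inner_comm b, hb] at h
  simpa using h

/-- The extended shape operator is symmetric. -/
lemma inner_tangDeriv_normal_comm (x : M) (a b : Euc (n + 1)) :
    inner ℝ (tangDeriv X ν x a) b = inner ℝ a (tangDeriv X ν x b) := by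
  -- The normal has zero tangential part, hence is dual to the differential of a constant.
  have h := hX.inner_tangDeriv_comm_of_exact (v := ν) (u := fun _ => 0)
    (hX.contMDiff_normal.of_le (by norm_num)) contMDiff_const (fun x w => by
      rw [tangDeriv_const, real_inner_self_eq_norm_sq, hX.norm_normal]; simp) x
      (tangentialPart X x a) (tangentialPart X x b)
  rw [hX.differential_tangentialPart, hX.differential_tangentialPart] at h
  simp only [map_sub, map_smul, hX.tangDeriv_normal_apply, smul_zero, sub_zero, inner_sub_right,
    inner_smul_right, hX.inner_tangDeriv_normal, mul_zero] at h
  rw [h, real_inner_comm]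

end IsTwoSidedImmersion

end Rules

/-! ### The Riemannian volume measure -/

lemma ContinuousOn.measurableSet_inter_preimage {α β : Type*} [TopologicalSpace α]
    [MeasurableSpace α] [OpensMeasurableSpace α] [TopologicalSpace β] [MeasurableSpace β]
    [BorelSpace β] {f : α → β} {s : Set α} (hf : ContinuousOn f s) (hs : MeasurableSet s)
    {t : Set β} (ht : MeasurableSet t) : MeasurableSet (s ∩ f ⁻¹' t) := by
  have h1 : Measurable (s.domRestrict f) :=
    (continuousOn_iff_continuous_domRestrict.mp hf).measurable
  have h2 := hs.subtype_image (h1 ht)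
  convert! h2 using 1
  ext x; simp [Set.domRestrict, and_comm]

lemma continuous_normDet {V E : Type*} [NormedAddCommGroup V] [InnerProductSpace ℝ V]
    [FiniteDimensional ℝ V] [NormedAddCommGroup E] [InnerProductSpace ℝ E]
    [FiniteDimensional ℝ E] : Continuous (fun L : V →L[ℝ] E => L.toLinearMap.normDet) := by
  have h : (fun L : V →L[ℝ] E => L.toLinearMap.normDet) =
      fun L => Real.sqrt (ContinuousLinearMap.adjoint L ∘L L).det := by
    ext L
    rw [← ContinuousLinearMap.normDet_sq (𝕜 := ℝ) L]
    simp [Real.sqrt_sq (LinearMap.normDet_nonneg _)]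
  rw [h]
  have h1 : Continuous (fun L : V →L[ℝ] E => ContinuousLinearMap.adjoint L ∘L L) :=
    ((contDiff_adjoint (k := 0)).clm_comp contDiff_id).continuous
  exact ((contDiff_det_clm (k := 0)).continuous.comp h1).sqrt

section Volume

variable {n : ℕ} {M : Type*} [TopologicalSpace M] [ChartedSpace (EuclideanSpace ℝ (Fin n)) M]
  [IsManifold (𝓡 n) ∞ M] [T2Space M] [SigmaCompactSpace M] [MeasurableSpace M] [BorelSpace M]
  {X Y : M → EuclideanSpace ℝ (Fin (n + 1))}
  {e e' : OpenPartialHomeomorph M (EuclideanSpace ℝ (Fin n))}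

/-- The volume density `√(det g)` in a chart. -/
def chartDensity (X : M → EuclideanSpace ℝ (Fin (n + 1)))
    (e : OpenPartialHomeomorph M (EuclideanSpace ℝ (Fin n))) (y : EuclideanSpace ℝ (Fin n)) : ℝ :=
  (fderiv ℝ (X ∘ e.symm) y).toLinearMap.normDet

lemma chartDensity_nonneg (y : Euc n) : 0 ≤ chartDensity X e y := LinearMap.normDet_nonneg _

lemma continuousOn_chartDensity (hX : ContMDiff (𝓡 n) 𝓘(ℝ, Euc (n + 1)) 1 X)
    (he : e ∈ atlas (Euc n) M) : ContinuousOn (chartDensity X e) e.target :=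
  continuous_normDet.comp_continuousOn
    ((hX.contDiffOn_comp_chart_symm he (by norm_cast)).continuousOn_fderiv_of_isOpen
      e.open_target le_rfl)

lemma aemeasurable_chartDensity (hX : ContMDiff (𝓡 n) 𝓘(ℝ, Euc (n + 1)) 1 X)
    (he : e ∈ atlas (Euc n) M) : AEMeasurable (chartDensity X e) (volume.restrict e.target) :=
  (continuousOn_chartDensity hX he).aemeasurable e.open_target.measurableSet

lemma aemeasurable_chart_symm (d : Euc n → ℝ≥0∞) :
    AEMeasurable e.symm ((volume.restrict e.target).withDensity d) :=
  (e.continuousOn_symm.aemeasurable e.open_target.measurableSet).mono_ac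
    (withDensity_absolutelyContinuous _ _)

lemma chartVolume_eq_map : chartVolume X e = ((volume.restrict e.target).withDensity
    fun y => ENNReal.ofReal (chartDensity X e y)).map e.symm := rfl

lemma chartVolume_apply {A : Set M} (hA : MeasurableSet A) :
    chartVolume X e A =
      ∫⁻ y in e.target ∩ e.symm ⁻¹' A, ENNReal.ofReal (chartDensity X e y) := by
  rw [chartVolume_eq_map, Measure.map_apply_of_aemeasurable (aemeasurable_chart_symm _) hA, withDensity_apply',
    Measure.restrict_restrict' e.open_target.measurableSet, inter_comm]

/-- Change of variables by the transition map `τ`: the Jacobian `|det Dτ|` is absorbed because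
`normDet` is multiplicative under precomposition with an endomorphism. -/
lemma chartVolume_congr_chart (hX : ContMDiff (𝓡 n) 𝓘(ℝ, Euc (n + 1)) 1 X)
    (he : e ∈ atlas (Euc n) M) (he' : e' ∈ atlas (Euc n) M) {A : Set M} (hA : MeasurableSet A)
    (hAe : A ⊆ e.source) (hAe' : A ⊆ e'.source) : chartVolume X e A = chartVolume X e' A := by
  rw [chartVolume_apply hA, chartVolume_apply hA]
  set s := e.target ∩ e.symm ⁻¹' A with hs
  set τ : Euc n → Euc n := e' ∘ e.symm with hτ
  have hsm : MeasurableSet s :=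
    e.continuousOn_symm.measurableSet_inter_preimage e.open_target.measurableSet hA
  have hτd : ∀ y ∈ s, DifferentiableAt ℝ τ y := by
    intro y hy
    have h1 := (contMDiffOn_symm_of_mem_atlas (k := 1) he (by norm_cast)).contMDiffAt
      (e.open_target.mem_nhds hy.1)
    have h2 := (contMDiffOn_of_mem_atlas (k := 1) he' (by norm_cast)).contMDiffAt
      (e'.open_source.mem_nhds (hAe' hy.2))
    exact ((h2.comp y h1).contDiffAt).differentiableAt (by simp)
  have himg : τ '' s = e'.target ∩ e'.symm ⁻¹' A := by
    ext z
    constructor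
    · rintro ⟨y, hy, rfl⟩
      refine ⟨e'.map_source (hAe' hy.2), ?_⟩
      simp only [hτ, mem_preimage, Function.comp_apply, e'.left_inv (hAe' hy.2)]
      exact hy.2
    · rintro ⟨hz, hzA⟩
      refine ⟨e (e'.symm z), ⟨e.map_source (hAe hzA), ?_⟩, ?_⟩
      · simpa only [mem_preimage, e.left_inv (hAe hzA)] using hzA
      · simp only [hτ, Function.comp_apply, e.left_inv (hAe hzA), e'.right_inv hz]
  have hinj : InjOn τ s := by
    intro y hy z hz h
    have h1 : e.symm y = e.symm z := e'.injOn (hAe' hy.2) (hAe' hz.2) h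
    rw [← e.right_inv hy.1, h1, e.right_inv hz.1]
  rw [← himg, lintegral_image_eq_lintegral_abs_det_fderiv_mul volume hsm
    (fun y hy => (hτd y hy).hasFDerivAt.hasFDerivWithinAt) hinj]
  refine setLIntegral_congr_fun hsm fun y hy => ?_
  rw [← ENNReal.ofReal_mul (abs_nonneg _)]
  congr 1
  have hy' : τ y ∈ e'.target := e'.map_source (hAe' hy.2)
  have hd : DifferentiableAt ℝ (X ∘ e'.symm) (τ y) :=
    (hasFDerivAt_comp_chart_symm he' hy' (hX.mdifferentiable (by simp) _)).differentiableAt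
  have heq : X ∘ e.symm =ᶠ[𝓝 y] (X ∘ e'.symm) ∘ τ := by
    have : e.symm ⁻¹' e'.source ∈ 𝓝 y :=
      (e.continuousAt_symm hy.1).preimage_mem_nhds (e'.open_source.mem_nhds (hAe' hy.2))
    filter_upwards [this] with z hz
    simp only [hτ, Function.comp_apply, e'.left_inv hz]
  unfold chartDensity
  rw [heq.fderiv_eq, fderiv_comp _ hd (hτd y hy)]
  have := LinearMap.normDet_comp_of_finrank_eq (𝕜 := ℝ) (fderiv ℝ τ y).toLinearMap
    (fderiv ℝ (X ∘ e'.symm) (τ y)).toLinearMap rfl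
  rw [LinearMap.normDet_eq_abs_det] at this
  rw [mul_comm]
  exact this

/-- Countably many chart domains cover a σ-compact manifold; making them disjoint reduces statements
about measures to one chart at a time. -/
lemma exists_chart_partition [Nonempty M] :
    ∃ (c : ℕ → OpenPartialHomeomorph M (Euc n)) (B : ℕ → Set M),
      (∀ k, c k ∈ atlas (Euc n) M) ∧ (∀ k, MeasurableSet (B k)) ∧
      Pairwise (Function.onFun Disjoint B) ∧ (⋃ k, B k) = univ ∧ ∀ k, B k ⊆ (c k).source := by
  obtain ⟨s, hs, hsu⟩ := countable_cover_nhds_of_sigmaCompact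
    (fun x : M => chart_source_mem_nhds (Euc n) x)
  have hne : s.Nonempty := by
    by_contra h
    rw [not_nonempty_iff_eq_empty] at h
    simp only [h, biUnion_empty] at hsu
    exact empty_ne_univ hsu
  obtain ⟨f, rfl⟩ := hs.exists_eq_range hne
  refine ⟨fun k => chartAt _ (f k), disjointed fun k => (chartAt (Euc n) (f k)).source,
    fun k => chart_mem_atlas _ _, fun k => MeasurableSet.disjointed
      (fun k => (chartAt (Euc n) (f k)).open_source.measurableSet) k,
    disjoint_disjointed _, ?_, fun k => disjointed_subset _ k⟩
  rw [iUnion_disjointed]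
  simpa using hsu

lemma measure_eq_tsum_inter_partition {μ : Measure M} {B : ℕ → Set M}
    (hB : ∀ k, MeasurableSet (B k)) (hd : Pairwise (Function.onFun Disjoint B))
    (hu : (⋃ k, B k) = univ) {A : Set M} (hA : MeasurableSet A) : μ A = ∑' k, μ (A ∩ B k) := by
  rw [← measure_iUnion (fun i j hij => (hd hij).mono inter_subset_right inter_subset_right)
    (fun k => hA.inter (hB k)), ← inter_iUnion, hu, inter_univ]

lemma chartVolume_inter_source {A : Set M} (hA : MeasurableSet A) :
    chartVolume X e (A ∩ e.source) = chartVolume X e A := by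
  rw [chartVolume_apply hA, chartVolume_apply (hA.inter e.open_source.measurableSet)]
  congr 2
  ext y
  simp only [mem_inter_iff, mem_preimage]
  exact ⟨fun h => ⟨h.1, h.2.1⟩, fun h => ⟨h.1, h.2, e.map_target h.1⟩⟩

lemma hypVolume_apply_of_subset (hX : ContMDiff (𝓡 n) 𝓘(ℝ, Euc (n + 1)) 1 X)
    (he : e ∈ atlas (Euc n) M) {A : Set M} (hA : MeasurableSet A) (hAe : A ⊆ e.source) :
    hypVolume X A = chartVolume X e A := by
  rcases isEmpty_or_nonempty M with hM | hM
  · simp [Set.eq_empty_of_isEmpty A]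
  obtain ⟨c, B, hc, hBm, hBd, hBu, hBs⟩ := exists_chart_partition (n := n) (M := M)
  have hAB : ∀ A : Set M, MeasurableSet A → A ⊆ e.source → ∀ k,
      chartVolume X e (A ∩ B k) = chartVolume X (c k) (A ∩ B k) := fun A hA hAe k =>
    chartVolume_congr_chart hX he (hc k) (hA.inter (hBm k)) (inter_subset_left.trans hAe)
      (inter_subset_right.trans (hBs k))
  apply le_antisymm
  -- The glued measure dominates every chart measure, by agreement on overlaps, hence it dominates
  -- their supremum.
  · have hle : hypVolume X ≤ Measure.sum fun k => (chartVolume X (c k)).restrict (B k) := by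
      unfold hypVolume
      refine iSup₂_le fun e' he' => Measure.le_iff.mpr fun S hS => ?_
      have hS' := hS.inter e'.open_source.measurableSet
      rw [← chartVolume_inter_source hS, Measure.sum_apply _ hS,
        measure_eq_tsum_inter_partition hBm hBd hBu hS']
      refine ENNReal.tsum_le_tsum fun k => ?_
      rw [Measure.restrict_apply hS, chartVolume_congr_chart hX he' (hc k) (hS'.inter (hBm k))
        (inter_subset_left.trans inter_subset_right) (inter_subset_right.trans (hBs k))]
      exact measure_mono (inter_subset_inter_left _ inter_subset_left)
    refine (hle A).trans ?_
    rw [Measure.sum_apply _ hA, measure_eq_tsum_inter_partition hBm hBd hBu hA (μ := chartVolume X e)]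
    refine ENNReal.tsum_le_tsum fun k => ?_
    rw [Measure.restrict_apply hA, hAB A hA hAe]
  · exact (le_iSup₂ (f := fun e (_ : e ∈ atlas (Euc n) M) => chartVolume X e) e he : _) A

lemma hypVolume_restrict_source (hX : ContMDiff (𝓡 n) 𝓘(ℝ, Euc (n + 1)) 1 X)
    (he : e ∈ atlas (Euc n) M) : (hypVolume X).restrict e.source = chartVolume X e := by
  ext A hA
  rw [Measure.restrict_apply hA, hypVolume_apply_of_subset hX he
    (hA.inter e.open_source.measurableSet) inter_subset_right, chartVolume_inter_source hA]

lemma isLocallyFiniteMeasure_hypVolume (hX : ContMDiff (𝓡 n) 𝓘(ℝ, Euc (n + 1)) 1 X) :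
    IsLocallyFiniteMeasure (hypVolume X) := by
  refine ⟨fun x => ?_⟩
  obtain ⟨e, he, y, hy, rfl⟩ := exists_chart_symm_eq (n := n) x
  have hρ := (continuousOn_chartDensity hX he).continuousAt (e.open_target.mem_nhds hy)
  have h1 : ∀ᶠ z in 𝓝 y, chartDensity X e z < chartDensity X e y + 1 :=
    hρ.eventually_lt continuousAt_const (by simp)
  obtain ⟨r, hr, hball⟩ := Metric.eventually_nhds_iff_ball.mp
    (h1.and (e.open_target.mem_nhds hy : ∀ᶠ z in 𝓝 y, z ∈ e.target))
  have hopen : IsOpen (e.source ∩ e ⁻¹' Metric.ball y r) :=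
    e.isOpen_inter_preimage Metric.isOpen_ball
  refine ⟨_, hopen.mem_nhds ⟨e.map_target hy, ?_⟩, ?_⟩
  · simp [e.right_inv hy, hr]
  rw [hypVolume_apply_of_subset hX he hopen.measurableSet inter_subset_left,
    chartVolume_apply hopen.measurableSet]
  have hsub : e.target ∩ e.symm ⁻¹' (e.source ∩ e ⁻¹' Metric.ball y r) ⊆ Metric.ball y r := by
    rintro z ⟨hz, -, hz2⟩
    simpa only [mem_preimage, e.right_inv hz] using hz2
  calc _ ≤ ∫⁻ z in Metric.ball y r, ENNReal.ofReal (chartDensity X e z) :=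
        lintegral_mono_set hsub
    _ ≤ ∫⁻ _ in Metric.ball y r, ENNReal.ofReal (chartDensity X e y + 1) :=
        setLIntegral_mono' measurableSet_ball fun z hz =>
          ENNReal.ofReal_le_ofReal (hball z hz).1.le
    _ < ⊤ := by
        rw [setLIntegral_const]
        exact ENNReal.mul_lt_top ENNReal.ofReal_lt_top measure_ball_lt_top

/-- Integrals of functions supported in the domain of a chart. -/
lemma integral_hypVolume_eq_chart (hX : ContMDiff (𝓡 n) 𝓘(ℝ, Euc (n + 1)) 1 X)
    (he : e ∈ atlas (Euc n) M) {h : M → ℝ} (hh : Continuous h)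
    (hsupp : ∀ x ∉ e.source, h x = 0) :
    ∫ x, h x ∂(hypVolume X) = ∫ y in e.target, chartDensity X e y * h (e.symm y) := by
  rw [← setIntegral_eq_integral_of_forall_compl_eq_zero hsupp, hypVolume_restrict_source hX he]
  rw [chartVolume_eq_map, integral_map (aemeasurable_chart_symm _) hh.measurable.aestronglyMeasurable,
    integral_withDensity_eq_integral_toReal_smul₀
      (aemeasurable_chartDensity hX he).ennreal_ofReal (by simp)]
  refine integral_congr_ae (Eventually.of_forall fun y => ?_)
  dsimp only
  rw [ENNReal.toReal_ofReal (chartDensity_nonneg _), smul_eq_mul]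

/-- For transferring integrals over a deformed hypersurface to the volume measure of `X`: only the
ratio of the densities in each chart has to be known. -/
lemma hypVolume_eq_withDensity (hX : ContMDiff (𝓡 n) 𝓘(ℝ, Euc (n + 1)) 1 X)
    (hY : ContMDiff (𝓡 n) 𝓘(ℝ, Euc (n + 1)) 1 Y) {J : M → ℝ} (hJ : Continuous J)
    (hJ0 : ∀ x, 0 ≤ J x)
    (hYX : ∀ e ∈ atlas (Euc n) M, ∀ y ∈ e.target,
      chartDensity Y e y = J (e.symm y) * chartDensity X e y) :
    hypVolume Y = (hypVolume X).withDensity fun x => ENNReal.ofReal (J x) := by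
  rcases isEmpty_or_nonempty M with hM | hM
  · ext A; simp [Set.eq_empty_of_isEmpty A]
  obtain ⟨c, B, hc, hBm, hBd, hBu, hBs⟩ := exists_chart_partition (n := n) (M := M)
  ext A hA
  rw [measure_eq_tsum_inter_partition hBm hBd hBu hA,
    measure_eq_tsum_inter_partition hBm hBd hBu hA]
  refine tsum_congr fun k => ?_
  have hm := hA.inter (hBm k)
  have hs : A ∩ B k ⊆ (c k).source := inter_subset_right.trans (hBs k)
  have hJm : Measurable fun x => ENNReal.ofReal (J x) := hJ.measurable.ennreal_ofReal
  have hms : MeasurableSet ((c k).target ∩ (c k).symm ⁻¹' (A ∩ B k)) :=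
    (c k).continuousOn_symm.measurableSet_inter_preimage (c k).open_target.measurableSet hm
  rw [withDensity_apply _ hm, ← Set.inter_eq_left.mpr hs, ← Measure.restrict_restrict hm,
    hypVolume_restrict_source hX (hc k), Set.inter_eq_left.mpr hs,
    hypVolume_apply_of_subset hY (hc k) hm hs, chartVolume_apply hm]
  have hR := lintegral_withDensity_eq_lintegral_mul₀'
    (aemeasurable_chartDensity hX (hc k)).ennreal_ofReal
      ((hJm.indicator hm).comp_aemeasurable (aemeasurable_chart_symm (e := c k) _))
  simp only [Function.comp_apply, Pi.mul_apply] at hR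
  rw [← lintegral_indicator hm, chartVolume_eq_map,
    lintegral_map' ((hJm.indicator hm).aemeasurable) (aemeasurable_chart_symm _), hR]
  rw [← lintegral_indicator hms, ← lintegral_indicator (c k).open_target.measurableSet]
  refine lintegral_congr fun y => ?_
  by_cases hy : y ∈ (c k).target
  · by_cases hyA : (c k).symm y ∈ A ∩ B k
    · rw [indicator_of_mem (show y ∈ (c k).target ∩ (c k).symm ⁻¹' (A ∩ B k) from ⟨hy, hyA⟩),
        indicator_of_mem hy, indicator_of_mem hyA, hYX _ (hc k) y hy, ENNReal.ofReal_mul (hJ0 _), mul_comm]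
    · rw [indicator_of_notMem (fun h => hyA h.2), indicator_of_mem hy,
        indicator_of_notMem hyA, mul_zero]
  · rw [indicator_of_notMem (fun h => hy h.1), indicator_of_notMem hy]

end Volume

/-! ### Weak symmetry of mixed derivatives -/

section WeakSymmetry

variable {V E : Type*} [NormedAddCommGroup V] [InnerProductSpace ℝ V] [FiniteDimensional ℝ V]
  [MeasurableSpace V] [BorelSpace V]
  [NormedAddCommGroup E] [InnerProductSpace ℝ E] [FiniteDimensional ℝ E]

/-- With `k(y) = g(-y)`, the convolution `f * k` is twice differentiable although each factor is
only `C¹`: one derivative falls on `k`, the next on `f`. Its second derivative at `0` is minus the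
integral in question, and second derivatives are symmetric. -/
lemma integral_inner_fderiv_comm {f g : V → E} (hf : ContDiff ℝ 1 f) (hg : ContDiff ℝ 1 g)
    (hfc : HasCompactSupport f) (hgc : HasCompactSupport g) (p q : V) :
    ∫ y, inner ℝ (fderiv ℝ f y p) (fderiv ℝ g y q) =
      ∫ y, inner ℝ (fderiv ℝ f y q) (fderiv ℝ g y p) := by
  set k : V → E := fun y => g (-y) with hk
  have hkC : ContDiff ℝ 1 k := hg.comp contDiff_neg
  have hkc : HasCompactSupport k := hgc.comp_homeomorph (Homeomorph.neg V)
  have hk' : ∀ y, fderiv ℝ k y = -fderiv ℝ g (-y) := fun y => by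
    have h1 : HasFDerivAt g (fderiv ℝ g (-y)) (-y) :=
      (hg.differentiable one_ne_zero).differentiableAt.hasFDerivAt
    have h2 := h1.comp y (hasFDerivAt_id y).neg
    refine h2.fderiv.trans ?_
    ext v; simp
  let L : E →L[ℝ] E →L[ℝ] ℝ := innerSL ℝ
  have h1 := fun x : V => hkc.hasFDerivAt_convolution_right L (μ := volume)
    hf.continuous.locallyIntegrable hkC x
  have hkd : Continuous (fderiv ℝ k) := hkC.continuous_fderiv one_ne_zero
  obtain ⟨D, hD⟩ : ∃ D, HasFDerivAt (convolution f (fderiv ℝ k) (L.precompR V) volume) D (0 : V) :=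
    ⟨_, hfc.hasFDerivAt_convolution_left (L.precompR V) (μ := volume) hf
      hkd.locallyIntegrable (0 : V)⟩
  have hsymm := second_derivative_symmetric h1 hD p q
  have hfd : Continuous (fderiv ℝ f) := hf.continuous_fderiv one_ne_zero
  have heval : ∀ p q : V, D p q = -∫ y, inner ℝ (fderiv ℝ f y p) (fderiv ℝ g y q) := by
    intro p q
    have hkq : Continuous fun y => fderiv ℝ k y q := hkd.clm_apply continuous_const
    have h2 := hfc.hasFDerivAt_convolution_left L (μ := volume) hf hkq.locallyIntegrable (0 : V)
    have h3 := hD.clm_apply (hasFDerivAt_const q (0 : V))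
    have h4 : (fun x => convolution f (fderiv ℝ k) (L.precompR V) volume x q) =
        convolution f (fun y => fderiv ℝ k y q) L volume := by
      ext x
      exact convolution_precompR_apply L hf.continuous.locallyIntegrable (hkc.fderiv ℝ) hkd x q
    rw [h4] at h3
    have h5 := congrArg (fun l => l p) (h3.unique h2)
    have hint : Integrable (fun t : V => L.precompL V (fderiv ℝ f t) (fderiv ℝ k (0 - t) q))
        volume := by
      refine Continuous.integrable_of_hasCompactSupport (μ := volume) ?_ ?_
      · exact ((L.precompL V).continuous.comp hfd).clm_apply
          (hkq.comp (continuous_const.sub continuous_id))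
      · refine (hfc.fderiv ℝ).mono fun y hy => ?_
        contrapose! hy
        simp [Function.notMem_support.mp hy]
    have h6 : convolution (fderiv ℝ f) (fun y => fderiv ℝ k y q) (L.precompL V) volume (0 : V) p =
        -∫ y, inner ℝ (fderiv ℝ f y p) (fderiv ℝ g y q) := by
      refine (ContinuousLinearMap.integral_apply hint p).trans ?_
      rw [← integral_neg]
      refine integral_congr_ae (Eventually.of_forall fun t => ?_)
      change inner ℝ (fderiv ℝ f t p) (fderiv ℝ k (0 - t) q) = _
      simp [hk']
    rw [h6] at h5
    simpa using h5
  rw [heval, heval, neg_inj] at hsymm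
  exact hsymm

lemma contDiff_of_forall_mem_tsupport {f : V → E} {k : WithTop ℕ∞}
    (h : ∀ y ∈ tsupport f, ContDiffAt ℝ k f y) : ContDiff ℝ k f := by
  rw [contDiff_iff_contDiffAt]
  intro y
  by_cases hy : y ∈ tsupport f
  · exact h y hy
  · exact contDiffAt_const.congr_of_eventuallyEq (notMem_tsupport_iff_eventuallyEq.mp hy)

/-- Only `f` has compact support in `U`; `g` is multiplied by a cutoff equal to `1` near the support
of `f`, which leaves the integrals unchanged. -/
lemma integral_inner_fderiv_comm_of_contDiffOn {U : Set V} (hU : IsOpen U) {f g : V → E}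
    (hf : ContDiffOn ℝ 1 f U) (hg : ContDiffOn ℝ 1 g U)
    (hfc : HasCompactSupport f) (hfU : tsupport f ⊆ U) (p q : V) :
    ∫ y, inner ℝ (fderiv ℝ f y p) (fderiv ℝ g y q) =
      ∫ y, inner ℝ (fderiv ℝ f y q) (fderiv ℝ g y p) := by
  have hfC : ContDiff ℝ 1 f := contDiff_of_forall_mem_tsupport fun y hy =>
    hf.contDiffAt (hU.mem_nhds (hfU hy))
  obtain ⟨K, hK, hfK, hKU⟩ := exists_compact_between hfc hU hfU
  obtain ⟨χ, hχ1, hχ0, -⟩ := exists_contMDiffMap_one_nhds_of_subset_interior 𝓘(ℝ, V) (n := 1)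
    (isClosed_tsupport f) hfK
  have hχC : ContDiff ℝ 1 χ := χ.contMDiff.contDiff
  have hsup : Function.support (χ : V → ℝ) ⊆ K := fun y hy => by
    by_contra h; exact hy (hχ0 y h)
  have hts : tsupport (χ : V → ℝ) ⊆ K := closure_minimal hsup hK.isClosed
  have hχc : HasCompactSupport (χ : V → ℝ) := hK.of_isClosed_subset (isClosed_tsupport _) hts
  have hgC : ContDiff ℝ 1 (fun y => χ y • g y) := by
    refine contDiff_of_forall_mem_tsupport fun y hy => ?_
    have : y ∈ U := hKU (hts (tsupport_smul_subset_left _ _ hy))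
    exact hχC.contDiffAt.smul (hg.contDiffAt (hU.mem_nhds this))
  have h := integral_inner_fderiv_comm hfC hgC hfc (hχc.smul_right) p q
  have heq : ∀ y r s, inner ℝ (fderiv ℝ f y r) (fderiv ℝ (fun y => χ y • g y) y s) =
      inner ℝ (fderiv ℝ f y r) (fderiv ℝ g y s) := by
    intro y r s
    by_cases hy : y ∈ tsupport f
    · have h1 : (fun y => χ y • g y) =ᶠ[𝓝 y] g := by
        have : ∀ᶠ z in 𝓝 y, χ z = 1 := hχ1.filter_mono (nhds_le_nhdsSet hy)
        filter_upwards [this] with z hz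
        rw [hz, one_smul]
      rw [h1.fderiv_eq]
    · have h1 : fderiv ℝ f y = 0 := by
        rw [(notMem_tsupport_iff_eventuallyEq.mp hy).fderiv_eq]; simp
      simp [h1]
  simpa only [heq] using h

end WeakSymmetry

/-! ### Derivative of the volume density and an algebraic identity -/

section Algebra

variable {V E : Type*} [NormedAddCommGroup V] [InnerProductSpace ℝ V] [FiniteDimensional ℝ V]
  [NormedAddCommGroup E] [InnerProductSpace ℝ E] [FiniteDimensional ℝ E]

lemma normDet_pos {L : V →L[ℝ] E} (hL : Function.Injective L) : 0 < L.toLinearMap.normDet := by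
  refine lt_of_le_of_ne (LinearMap.normDet_nonneg _) (Ne.symm ?_)
  rw [Ne, LinearMap.normDet_eq_zero_iff_ker_ne_bot, not_not]
  exact LinearMap.ker_eq_bot.mpr hL

lemma normDet_eq_sqrt (L : V →L[ℝ] E) :
    L.toLinearMap.normDet = Real.sqrt (ContinuousLinearMap.adjoint L ∘L L).det := by
  rw [← ContinuousLinearMap.normDet_sq (𝕜 := ℝ) L]
  simp [Real.sqrt_sq (LinearMap.normDet_nonneg _)]

lemma contDiffAt_normDet {k : WithTop ℕ∞} {L : V →L[ℝ] E} (hL : Function.Injective L) :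
    ContDiffAt ℝ k (fun L : V →L[ℝ] E => L.toLinearMap.normDet) L := by
  simp only [normDet_eq_sqrt]
  have h1 : ContDiff ℝ k (fun L : V →L[ℝ] E => ContinuousLinearMap.adjoint L ∘L L) :=
    contDiff_adjoint.clm_comp contDiff_id
  refine (contDiff_det_clm.comp h1).contDiffAt.sqrt ?_
  have h2 := normDet_pos hL
  rw [normDet_eq_sqrt] at h2
  exact (Real.sqrt_pos.mp h2).ne'

/-- Jacobi's formula applied to `normDet² = det (L* L)`. The variation of `L* L` is `D* L + L* D`,
and the two summands contribute equal traces since `(L* L)⁻¹` is self-adjoint. -/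
lemma fderiv_normDet {L : V →L[ℝ] E} (hL : Function.Injective L) (D : V →L[ℝ] E) :
    fderiv ℝ (fun L : V →L[ℝ] E => L.toLinearMap.normDet) L D =
      L.toLinearMap.normDet * traceL V (pinv L ∘L D) := by
  have hpos := normDet_pos hL
  have hd : HasFDerivAt (fun L : V →L[ℝ] E => L.toLinearMap.normDet)
      (fderiv ℝ (fun L : V →L[ℝ] E => L.toLinearMap.normDet) L) (L + (0 : ℝ) • D) := by
    simpa using ((contDiffAt_normDet (k := 1) hL).differentiableAt (by simp)).hasFDerivAt
  have hl : HasDerivAt (fun s : ℝ => L + s • D) D 0 := by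
    simpa using ((hasDerivAt_id (0 : ℝ)).smul_const D).const_add L
  have h1 := hd.comp_hasDerivAt (0 : ℝ) hl
  have h2 := h1.pow 2
  let R := (ContinuousLinearMap.adjoint L ∘L L).inverse
  have hR : (ContinuousLinearMap.adjoint L ∘L L) ∘L R = 1 := by
    ext1 v
    exact (isInvertible_adjoint_comp hL).self_apply_inverse v
  have hRsym : ContinuousLinearMap.adjoint R = R := by
    have h3 := congrArg ContinuousLinearMap.adjoint hR
    rw [ContinuousLinearMap.adjoint_comp, ContinuousLinearMap.adjoint_comp,
      ContinuousLinearMap.adjoint_adjoint] at h3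
    have h4 : ContinuousLinearMap.adjoint R ∘L ((ContinuousLinearMap.adjoint L ∘L L) ∘L R) = R := by
      rw [← ContinuousLinearMap.comp_assoc, h3]
      ext x
      have := ContinuousLinearMap.adjoint_inner_left (1 : V →L[ℝ] V)
      refine ext_inner_left ℝ fun w => ?_
      rw [ContinuousLinearMap.comp_apply, ContinuousLinearMap.adjoint_inner_right]
      rfl
    rw [hR] at h4
    exact h4
  have hA : HasDerivAt (fun s : ℝ => ContinuousLinearMap.adjoint (L + s • D) ∘L (L + s • D))
      (ContinuousLinearMap.adjoint D ∘L L + ContinuousLinearMap.adjoint L ∘L D) 0 := by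
    have h3 : HasDerivAt (fun s : ℝ => ContinuousLinearMap.adjoint (L + s • D))
        (ContinuousLinearMap.adjoint D) 0 := by
      have : (fun s : ℝ => ContinuousLinearMap.adjoint (L + s • D)) =
          fun s => ContinuousLinearMap.adjoint L + s • ContinuousLinearMap.adjoint D := by
        ext1 s; simp
      rw [this]
      simpa using ((hasDerivAt_id (0 : ℝ)).smul_const
        (ContinuousLinearMap.adjoint D)).const_add (ContinuousLinearMap.adjoint L)
    simpa using h3.clm_comp hl
  have h3 := hasDerivAt_det_of_isUnit (A := fun s : ℝ =>
    ContinuousLinearMap.adjoint (L + s • D) ∘L (L + s • D)) (R := R) hA (by simpa using hR)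
  have h4 : (fun s : ℝ => (ContinuousLinearMap.adjoint (L + s • D) ∘L (L + s • D)).det) =
      ((fun L : V →L[ℝ] E => L.toLinearMap.normDet) ∘ fun s : ℝ => L + s • D) ^ 2 := by
    ext s
    simp only [Pi.pow_apply, Function.comp_apply]
    have := ContinuousLinearMap.normDet_sq (𝕜 := ℝ) (L + s • D)
    simpa using this.symm
  rw [h4] at h3
  have h5 := h2.unique h3
  have hdet : (ContinuousLinearMap.adjoint L ∘L L).det = L.toLinearMap.normDet ^ 2 := by
    simpa using (ContinuousLinearMap.normDet_sq (𝕜 := ℝ) L).symm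
  have htr : traceL V (R ∘L (ContinuousLinearMap.adjoint D ∘L L)) = traceL V (pinv L ∘L D) := by
    rw [← traceL_adjoint, ContinuousLinearMap.adjoint_comp, ContinuousLinearMap.adjoint_comp,
      ContinuousLinearMap.adjoint_adjoint, hRsym, traceL_mul_comm]
    rfl
  have htr2 : traceL V (R ∘L (ContinuousLinearMap.adjoint L ∘L D)) = traceL V (pinv L ∘L D) := rfl
  have htot : traceL V (R ∘L (ContinuousLinearMap.adjoint D ∘L L + ContinuousLinearMap.adjoint L ∘L D))
      = 2 * traceL V (pinv L ∘L D) := by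
    rw [ContinuousLinearMap.comp_add, map_add, htr, htr2]; ring
  rw [htot] at h5
  simp only [zero_smul, add_zero, hdet, Function.comp_apply] at h5
  have h6 : L.toLinearMap.normDet * fderiv ℝ (fun L : V →L[ℝ] E => L.toLinearMap.normDet) L D =
      L.toLinearMap.normDet * (L.toLinearMap.normDet * traceL V (pinv L ∘L D)) := by
    simp at h5
    linarith
  exact mul_left_cancel₀ hpos.ne' h6

end Algebra

/-! ### The pointwise computation behind the commutator identity -/

section CommutatorAlgebra

variable {V E : Type*} [NormedAddCommGroup V] [InnerProductSpace ℝ V] [FiniteDimensional ℝ V]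
  [NormedAddCommGroup E] [InnerProductSpace ℝ E] [FiniteDimensional ℝ E]
  {ι : Type*} [Fintype ι] (b : OrthonormalBasis ι ℝ V)

lemma sum_apply_mul_inner (φ : V →L[ℝ] ℝ) (v : V) : ∑ i, φ (b i) * inner ℝ (b i) v = φ v := by
  conv_rhs => rw [← b.sum_repr' v, map_sum]
  simp [mul_comm]

lemma sum_inner_mul_inner_apply (A : V →L[ℝ] V) (ξ v : V) :
    ∑ j, inner ℝ (b j) ξ * inner ℝ v (A (b j)) = inner ℝ v (A ξ) := by
  conv_rhs => rw [← b.sum_repr' ξ, map_sum, inner_sum]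
  simp [inner_smul_right]

lemma sum_sum_inner_mul_inner (A B : V →L[ℝ] V) :
    ∑ i, ∑ j, inner ℝ (b j) (A (b i)) * inner ℝ (b i) (B (b j)) = traceL V (B ∘L A) := by
  simp only [sum_inner_mul_inner_apply b B]
  rw [traceL_eq_sum b]
  rfl

/-- The commutator identity for derivatives along a hypersurface, in terms of the first and second
derivatives of all the maps involved. -/
lemma commutator_algebra {L : V →L[ℝ] E} {X2 : V →L[ℝ] V →L[ℝ] E} {T : E →L[ℝ] V}
    {T' : V →L[ℝ] E →L[ℝ] V} {ρ ψ : ℝ} {ρ' ψ' : V →L[ℝ] ℝ} {ξ : V} {ξ' : V →L[ℝ] V}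
    {W N ζ' : V →L[ℝ] E} {ν : E}
    (hX2 : ∀ a c, X2 a c = X2 c a) (hρ : ∀ a, ρ' a = ρ * traceL V (T ∘L X2 a))
    (hT'L : ∀ a c, T' a (L c) = -T (X2 a c)) (hT'ν : ∀ a, T' a ν = -T (N a))
    (hLT : ∀ e, L (T e) = e - (inner ℝ ν e : ℝ) • ν) (hTL : ∀ v, T (L v) = v)
    (hζ : ∀ a, ζ' a = X2 a ξ + L (ξ' a)) :
    (∑ i, ∑ j, ((ψ' (b i) * ρ * inner ℝ (b j) ξ + ψ * ρ' (b i) * inner ℝ (b j) ξ +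
          ψ * ρ * inner ℝ (b j) (ξ' (b i))) * inner ℝ (b i) (T (W (b j))) +
          ψ * ρ * inner ℝ (b j) ξ * inner ℝ (b i) (T' (b i) (W (b j))))) -
      (∑ i, ∑ j, ((ψ' (b j) * ρ * inner ℝ (b j) ξ + ψ * ρ' (b j) * inner ℝ (b j) ξ +
          ψ * ρ * inner ℝ (b j) (ξ' (b j))) * inner ℝ (b i) (T (W (b i))) +
          ψ * ρ * inner ℝ (b j) ξ * inner ℝ (b i) (T' (b j) (W (b i))))) =
      ρ * (ψ' (T (W ξ)) - ψ' ξ * traceL V (T ∘L W) +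
        ψ * (traceL V ((T ∘L ζ') ∘L (T ∘L W)) - traceL V (T ∘L ζ') * traceL V (T ∘L W) -
          traceL V (T ∘L N) * inner ℝ ν (W ξ) + inner ℝ ν (W (T (N ξ))))) := by
  -- Differentiating `T L = 1` and `T ν = 0` determines the derivative of `T` on the range of `L`
  -- and on `ν`, which together span `E`.
  have hT' : ∀ a e, T' a e = -T (X2 a (T e)) - (inner ℝ ν e : ℝ) • T (N a) := by
    intro a e
    have h : e = L (T e) + (inner ℝ ν e : ℝ) • ν := by rw [hLT]; simp
    conv_lhs => rw [h, map_add, map_smul, hT'L, hT'ν]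
    rw [smul_neg, sub_eq_add_neg]
  have h1 : ∀ φ : V →L[ℝ] ℝ,
      ∑ i, ∑ j, φ (b i) * inner ℝ (b j) ξ * inner ℝ (b i) (T (W (b j))) = φ (T (W ξ)) := by
    intro φ
    have := fun i => sum_inner_mul_inner_apply b (T ∘L W) ξ (b i)
    simp only [ContinuousLinearMap.comp_apply] at this
    simp only [mul_assoc, ← Finset.mul_sum, this]
    exact sum_apply_mul_inner b φ _
  have h2 := sum_sum_inner_mul_inner b ξ' (T ∘L W)
  simp only [ContinuousLinearMap.comp_apply] at h2
  have h3 : ∑ i, ∑ j, inner ℝ (b j) ξ * inner ℝ (b i) (T' (b i) (W (b j))) =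
      -traceL V (T ∘L X2 (T (W ξ))) - inner ℝ ν (W ξ) * traceL V (T ∘L N) := by
    have := fun i => sum_inner_mul_inner_apply b (T' (b i) ∘L W) ξ (b i)
    simp only [ContinuousLinearMap.comp_apply] at this
    simp only [this]
    simp only [hT', hX2 _ (T (W ξ)), inner_sub_right, inner_neg_right, inner_smul_right,
      Finset.sum_sub_distrib, Finset.sum_neg_distrib, ← Finset.mul_sum]
    rw [traceL_eq_sum b, traceL_eq_sum b]
    rfl
  have h4 : ∀ φ : V →L[ℝ] ℝ, ∑ i, ∑ j, φ (b j) * inner ℝ (b j) ξ * inner ℝ (b i) (T (W (b i))) =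
      φ ξ * traceL V (T ∘L W) := by
    intro φ
    simp only [← Finset.sum_mul, sum_apply_mul_inner b φ, ← Finset.mul_sum]
    rw [traceL_eq_sum b]
    rfl
  have h5 : ∑ i, ∑ j, inner ℝ (b j) (ξ' (b j)) * inner ℝ (b i) (T (W (b i))) =
      traceL V ξ' * traceL V (T ∘L W) := by
    simp only [← Finset.sum_mul, ← Finset.mul_sum]
    rw [traceL_eq_sum b, traceL_eq_sum b]
    rfl
  have h6 : ∑ i, ∑ j, inner ℝ (b j) ξ * inner ℝ (b i) (T' (b j) (W (b i))) =
      -traceL V ((T ∘L X2 ξ) ∘L (T ∘L W)) - inner ℝ ν (W (T (N ξ))) := by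
    have h : ∀ i, ∑ j, inner ℝ (b j) ξ * inner ℝ (b i) (T' (b j) (W (b i))) =
        inner ℝ (b i) (T' ξ (W (b i))) := fun i =>
      sum_inner_mul_inner_apply b (T'.flip (W (b i))) ξ (b i)
    simp only [h]
    simp only [hT', inner_sub_right, inner_neg_right, inner_smul_right,
      Finset.sum_sub_distrib, Finset.sum_neg_distrib]
    have h7 := sum_apply_mul_inner b (innerSL ℝ ν ∘L W) (T (N ξ))
    simp only [ContinuousLinearMap.comp_apply, innerSL_apply_apply] at h7
    rw [h7, traceL_eq_sum b]
    rfl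
  -- The covariant derivative of `ζ` in coordinates; `T ∘ X2` carries the Christoffel symbols, which
  -- cancel against those in `ρ'` and `T'`.
  have h7 : T ∘L ζ' = T ∘L X2 ξ + ξ' := by
    ext1 a
    simp [hζ, hTL, hX2 a ξ]
  have h8 : traceL V (ξ' ∘L (T ∘L W)) = traceL V ((T ∘L W) ∘L ξ') := traceL_mul_comm _ _
  rw [h7, ContinuousLinearMap.add_comp, map_add, map_add, h8, ← h2]
  have e1 : ∀ i j, ((ψ' (b i) * ρ * inner ℝ (b j) ξ + ψ * ρ' (b i) * inner ℝ (b j) ξ +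
          ψ * ρ * inner ℝ (b j) (ξ' (b i))) * inner ℝ (b i) (T (W (b j))) +
          ψ * ρ * inner ℝ (b j) ξ * inner ℝ (b i) (T' (b i) (W (b j)))) =
      ρ * (ψ' (b i) * inner ℝ (b j) ξ * inner ℝ (b i) (T (W (b j)))) +
      ψ * (ρ' (b i) * inner ℝ (b j) ξ * inner ℝ (b i) (T (W (b j)))) +
      ψ * ρ * (inner ℝ (b j) (ξ' (b i)) * inner ℝ (b i) (T (W (b j)))) +
      ψ * ρ * (inner ℝ (b j) ξ * inner ℝ (b i) (T' (b i) (W (b j)))) := fun i j => by ring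
  have e2 : ∀ i j, ((ψ' (b j) * ρ * inner ℝ (b j) ξ + ψ * ρ' (b j) * inner ℝ (b j) ξ +
          ψ * ρ * inner ℝ (b j) (ξ' (b j))) * inner ℝ (b i) (T (W (b i))) +
          ψ * ρ * inner ℝ (b j) ξ * inner ℝ (b i) (T' (b j) (W (b i)))) =
      ρ * (ψ' (b j) * inner ℝ (b j) ξ * inner ℝ (b i) (T (W (b i)))) +
      ψ * (ρ' (b j) * inner ℝ (b j) ξ * inner ℝ (b i) (T (W (b i)))) +
      ψ * ρ * (inner ℝ (b j) (ξ' (b j)) * inner ℝ (b i) (T (W (b i)))) +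
      ψ * ρ * (inner ℝ (b j) ξ * inner ℝ (b i) (T' (b j) (W (b i)))) := fun i j => by ring
  simp only [e1, e2]
  simp only [Finset.sum_add_distrib, ← Finset.mul_sum, h1, h3, h4, h5, h6]
  simp only [hρ]
  ring

end CommutatorAlgebra

/-! ### The commutator identity in a parametrized patch -/

section ChartIdentity

variable {V E : Type*} [NormedAddCommGroup V] [InnerProductSpace ℝ V] [FiniteDimensional ℝ V]
  [MeasurableSpace V] [BorelSpace V]
  [NormedAddCommGroup E] [InnerProductSpace ℝ E] [FiniteDimensional ℝ E]

lemma integrable_of_continuousOn_of_compact {U K : Set V} {f : V → ℝ}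
    (hf : ContinuousOn f U) (hK : IsCompact K) (hKU : K ⊆ U) (h0 : ∀ y ∉ K, f y = 0) :
    Integrable f := by
  rw [← integrableOn_iff_integrable_of_support_subset (s := K)
    (fun y hy => by by_contra h; exact hy (h0 y h))]
  exact (hf.mono hKU).integrableOn_compact hK

/-- The commutator identity for derivatives along a parametrized hypersurface, integrated against a
test function. -/
lemma integral_commutator_chart {U : Set V} (hU : IsOpen U)
    (hdim : Module.finrank ℝ E = Module.finrank ℝ V + 1) {X ν ζ w : V → E} {ψ : V → ℝ}
    (hX : ContDiffOn ℝ 2 X U) (hXi : ∀ y ∈ U, Function.Injective (fderiv ℝ X y))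
    (hν : ContDiffOn ℝ 1 ν U) (hν1 : ∀ y ∈ U, ‖ν y‖ = 1)
    (hort : ∀ y ∈ U, ∀ a, inner ℝ (fderiv ℝ X y a) (ν y) = 0)
    (hζ : ContDiffOn ℝ 1 ζ U) (hζν : ∀ y ∈ U, inner ℝ (ν y) (ζ y) = 0)
    (hw : ContDiffOn ℝ 1 w U) (hψ : ContDiff ℝ 1 ψ) (hψc : HasCompactSupport ψ)
    (hψU : tsupport ψ ⊆ U) :
    ∫ y, (fderiv ℝ X y).toLinearMap.normDet *
      (fderiv ℝ ψ y (pinv (fderiv ℝ X y) (fderiv ℝ w y (pinv (fderiv ℝ X y) (ζ y)))) -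
        fderiv ℝ ψ y (pinv (fderiv ℝ X y) (ζ y)) *
          traceL V (pinv (fderiv ℝ X y) ∘L fderiv ℝ w y) +
        ψ y * (traceL V ((pinv (fderiv ℝ X y) ∘L fderiv ℝ ζ y) ∘L
            (pinv (fderiv ℝ X y) ∘L fderiv ℝ w y)) -
          traceL V (pinv (fderiv ℝ X y) ∘L fderiv ℝ ζ y) *
            traceL V (pinv (fderiv ℝ X y) ∘L fderiv ℝ w y) -
          traceL V (pinv (fderiv ℝ X y) ∘L fderiv ℝ ν y) *
            inner ℝ (ν y) (fderiv ℝ w y (pinv (fderiv ℝ X y) (ζ y))) +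
          inner ℝ (ν y) (fderiv ℝ w y (pinv (fderiv ℝ X y)
            (fderiv ℝ ν y (pinv (fderiv ℝ X y) (ζ y))))))) = 0 := by
  let b := stdOrthonormalBasis ℝ V
  have hdX : ContDiffOn ℝ 1 (fderiv ℝ X) U := hX.fderiv_of_isOpen hU (by norm_num)
  set T : V → E →L[ℝ] V := fun y => pinv (fderiv ℝ X y) with hTdef
  have hT : ContDiffOn ℝ 1 T U := fun y hy =>
    (contDiffAt_pinv (hXi y hy)).comp_contDiffWithinAt y (hdX y hy)
  set ρ : V → ℝ := fun y => (fderiv ℝ X y).toLinearMap.normDet with hρdef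
  have hρ : ContDiffOn ℝ 1 ρ U := fun y hy =>
    ContDiffAt.comp_contDiffWithinAt (g := fun L : V →L[ℝ] E => L.toLinearMap.normDet) y
      (contDiffAt_normDet (hXi y hy)) (hdX y hy)
  set ξ : V → V := fun y => T y (ζ y) with hξdef
  have hξ : ContDiffOn ℝ 1 ξ U := hT.clm_apply hζ
  -- Chosen so that `⟨c i j, e⟩ = ψ ρ ξʲ (T e)ⁱ`: summing mixed derivatives of `w` against `c i j`
  -- traces them tangentially and contracts with `ζ`, including the volume density.
  set c : _ → _ → V → E := fun i j y =>
    (ψ y * ρ y * inner ℝ (b j) (ξ y)) • ContinuousLinearMap.adjoint (T y) (b i) with hcdef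
  have hc : ∀ i j, ContDiffOn ℝ 1 (c i j) U := fun i j =>
    ((hψ.contDiffOn.mul hρ).mul (contDiffOn_const.inner ℝ hξ)).smul
      ((contDiff_adjoint.comp_contDiffOn hT).clm_apply contDiffOn_const)
  have hcsupp : ∀ i j, tsupport (c i j) ⊆ tsupport ψ := fun i j =>
    closure_mono fun y hy => by
      contrapose! hy
      simp only [hcdef, Function.mem_support, not_not] at hy ⊢
      simp [hy]
  have hcc : ∀ i j, HasCompactSupport (c i j) := fun i j =>
    hψc.of_isClosed_subset (isClosed_tsupport _) (hcsupp i j)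
  have hweak := fun i j => integral_inner_fderiv_comm_of_contDiffOn hU (hc i j) hw (hcc i j)
    ((hcsupp i j).trans hψU) (b i) (b j)
  have hdw : ContinuousOn (fderiv ℝ w) U := hw.continuousOn_fderiv_of_isOpen hU le_rfl
  have hint : ∀ i j p q, Integrable fun y => inner ℝ (fderiv ℝ (c i j) y p) (fderiv ℝ w y q) := by
    intro i j p q
    refine integrable_of_continuousOn_of_compact (U := U) ?_ hψc hψU fun y hy => ?_
    · exact (((hc i j).continuousOn_fderiv_of_isOpen hU le_rfl).clm_apply continuousOn_const).inner
        (hdw.clm_apply continuousOn_const)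
    · have : fderiv ℝ (c i j) y = 0 := by
        rw [(notMem_tsupport_iff_eventuallyEq.mp (fun h => hy (hcsupp i j h))).fderiv_eq]; simp
      simp [this]
  -- The weak form of `∑ ⟨c i j, ∂ᵢ∂ⱼ w - ∂ⱼ∂ᵢ w⟩ = 0`.
  have hsum : ∫ y, ((∑ i, ∑ j, inner ℝ (fderiv ℝ (c i j) y (b i)) (fderiv ℝ w y (b j))) -
      ∑ i, ∑ j, inner ℝ (fderiv ℝ (c i j) y (b j)) (fderiv ℝ w y (b i))) = 0 := by
    rw [integral_sub (integrable_finsetSum _ fun i _ => integrable_finsetSum _ fun j _ =>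
        hint i j _ _) (integrable_finsetSum _ fun i _ => integrable_finsetSum _ fun j _ =>
        hint i j _ _),
      integral_finsetSum _ fun i _ => integrable_finsetSum _ fun j _ => hint i j _ _,
      integral_finsetSum _ fun i _ => integrable_finsetSum _ fun j _ => hint i j _ _, sub_eq_zero]
    refine Finset.sum_congr rfl fun i _ => ?_
    rw [integral_finsetSum _ fun j _ => hint i j _ _, integral_finsetSum _ fun j _ => hint i j _ _]
    exact Finset.sum_congr rfl fun j _ => hweak i j
  rw [← hsum]
  refine integral_congr_ae (Eventually.of_forall fun y => ?_)
  dsimp only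
  by_cases hy : y ∈ tsupport ψ
  swap
  · have h1 : ∀ i j, fderiv ℝ (c i j) y = 0 := fun i j => by
      rw [(notMem_tsupport_iff_eventuallyEq.mp (fun h => hy (hcsupp i j h))).fderiv_eq]; simp
    have h2 : fderiv ℝ ψ y = 0 := by
      rw [(notMem_tsupport_iff_eventuallyEq.mp hy).fderiv_eq]; simp
    simp [h1, h2, image_eq_zero_of_notMem_tsupport hy]
  have hyU := hψU hy
  have hnhds := hU.mem_nhds hyU
  have hTd : HasFDerivAt T (fderiv ℝ T y) y :=
    ((hT.contDiffAt hnhds).differentiableAt (by simp)).hasFDerivAt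
  have hρd : HasFDerivAt ρ (fderiv ℝ ρ y) y :=
    ((hρ.contDiffAt hnhds).differentiableAt (by simp)).hasFDerivAt
  have hξd : HasFDerivAt ξ (fderiv ℝ ξ y) y :=
    ((hξ.contDiffAt hnhds).differentiableAt (by simp)).hasFDerivAt
  have hζd : HasFDerivAt ζ (fderiv ℝ ζ y) y :=
    ((hζ.contDiffAt hnhds).differentiableAt (by simp)).hasFDerivAt
  have hνd : HasFDerivAt ν (fderiv ℝ ν y) y :=
    ((hν.contDiffAt hnhds).differentiableAt (by simp)).hasFDerivAt
  have hψd : HasFDerivAt ψ (fderiv ℝ ψ y) y :=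
    (hψ.contDiffAt.differentiableAt (by simp)).hasFDerivAt
  have hXd : HasFDerivAt (fderiv ℝ X) (fderiv ℝ (fderiv ℝ X) y) y :=
    ((hdX.contDiffAt hnhds).differentiableAt (by simp)).hasFDerivAt
  have hcd : ∀ i j a e, inner ℝ (fderiv ℝ (c i j) y a) e =
      (fderiv ℝ ψ y a * ρ y * inner ℝ (b j) (ξ y) + ψ y * fderiv ℝ ρ y a * inner ℝ (b j) (ξ y) +
        ψ y * ρ y * inner ℝ (b j) (fderiv ℝ ξ y a)) * inner ℝ (b i) (T y e) +
        ψ y * ρ y * inner ℝ (b j) (ξ y) * inner ℝ (b i) (fderiv ℝ T y a e) := by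
    intro i j a e
    have h1 : HasFDerivAt (c i j) (fderiv ℝ (c i j) y) y :=
      (((hc i j).contDiffAt hnhds).differentiableAt (by simp)).hasFDerivAt
    have h2 := h1.inner ℝ (hasFDerivAt_const e y)
    have h3 := ((hψd.mul hρd).mul ((hasFDerivAt_const (b j) y).inner ℝ hξd)).mul
      ((hasFDerivAt_const (b i) y).inner ℝ (hTd.clm_apply (hasFDerivAt_const e y)))
    have h4 : (fun y => inner ℝ (c i j y) e) = fun y =>
        ψ y * ρ y * inner ℝ (b j) (ξ y) * inner ℝ (b i) (T y e) := by
      ext y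
      simp only [hcdef, real_inner_smul_left, ContinuousLinearMap.adjoint_inner_left]
    rw [h4] at h2
    have h5 := congrArg (fun l => l a) (h2.unique h3)
    simp [fderivInnerCLM_apply] at h5
    linarith
  simp only [hcd]
  refine (commutator_algebra b (L := fderiv ℝ X y) (X2 := fderiv ℝ (fderiv ℝ X) y) (T := T y)
    (T' := fderiv ℝ T y) (ζ' := fderiv ℝ ζ y) (N := fderiv ℝ ν y) (W := fderiv ℝ w y)
    (ξ := ξ y) (ξ' := fderiv ℝ ξ y) (ν := ν y) (ψ' := fderiv ℝ ψ y) (ρ' := fderiv ℝ ρ y)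
    ?_ ?_ ?_ ?_ ?_ ?_ ?_).symm
  · intro p q
    exact ((hX.contDiffAt hnhds).isSymmSndFDerivAt (by simp)).eq p q
  · intro a
    have h1 : HasFDerivAt ρ ((fderiv ℝ (fun L : V →L[ℝ] E => L.toLinearMap.normDet)
        (fderiv ℝ X y)) ∘L (fderiv ℝ (fderiv ℝ X) y)) y :=
      HasFDerivAt.comp (g := fun L : V →L[ℝ] E => L.toLinearMap.normDet) y
        (((contDiffAt_normDet (k := 1) (hXi y hyU)).differentiableAt (by simp)).hasFDerivAt) hXd
    rw [h1.fderiv, ContinuousLinearMap.comp_apply, fderiv_normDet (hXi y hyU)]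
  · intro a q
    have h1 := hTd.clm_apply (hXd.clm_apply (hasFDerivAt_const q y))
    have h2 : (fun z => T z (fderiv ℝ X z q)) =ᶠ[𝓝 y] fun _ => q := by
      filter_upwards [hnhds] with z hz
      exact pinv_apply_self (hXi z hz) q
    have h3 := congrArg (fun l => l a)
      (h1.unique ((hasFDerivAt_const q y).congr_of_eventuallyEq h2))
    simp at h3
    exact eq_neg_of_add_eq_zero_right h3
  · intro a
    have h1 := hTd.clm_apply hνd
    have h2 : (fun z => T z (ν z)) =ᶠ[𝓝 y] fun _ => 0 := by
      filter_upwards [hnhds] with z hz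
      exact pinv_apply_normal (hort z hz)
    have h3 := congrArg (fun l => l a)
      (h1.unique ((hasFDerivAt_const (0 : V) y).congr_of_eventuallyEq h2))
    simp at h3
    exact eq_neg_of_add_eq_zero_right h3
  · exact apply_pinv_apply hdim (hXi y hyU) (hort y hyU) (hν1 y hyU)
  · exact pinv_apply_self (hXi y hyU)
  · intro a
    have h1 := hXd.clm_apply hξd
    have h2 : (fun z => fderiv ℝ X z (ξ z)) =ᶠ[𝓝 y] ζ := by
      filter_upwards [hnhds] with z hz
      rw [hξdef, hTdef]
      dsimp only
      rw [apply_pinv_apply hdim (hXi z hz) (hort z hz) (hν1 z hz), hζν z hz]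
      simp
    have h3 := congrArg (fun l => l a) ((hζd.congr_of_eventuallyEq h2).unique h1)
    simp at h3
    rw [h3, add_comm]

end ChartIdentity

/-! ### The commutator identity on the hypersurface -/

section WeakIdentity

variable {n : ℕ} {M : Type*} [TopologicalSpace M] [ChartedSpace (EuclideanSpace ℝ (Fin n)) M]
  [IsManifold (𝓡 n) ∞ M] {W : Type*} [NormedAddCommGroup W] [NormedSpace ℝ W]
  {X ν : M → EuclideanSpace ℝ (Fin (n + 1))}

lemma tangDeriv_congr_of_eventuallyEq {Y Z : M → W} {x : M} (h : Y =ᶠ[𝓝 x] Z) :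
    tangDeriv X Y x = tangDeriv X Z x := by
  have h1 : mdiff (n := n) Y x = mdiff Z x := h.mfderiv_eq
  unfold tangDeriv
  rw [h1]

lemma tangDeriv_eq_zero_of_notMem_tsupport {Y : M → W} {x : M} (h : x ∉ tsupport Y) :
    tangDeriv X Y x = 0 := by
  rw [tangDeriv_congr_of_eventuallyEq (notMem_tsupport_iff_eventuallyEq.mp h)]
  exact tangDeriv_const 0 x

lemma tangDeriv_sum {ι : Type*} (s : Finset ι) {Y : ι → M → W} {x : M}
    (hY : ∀ i, MDifferentiable (𝓡 n) 𝓘(ℝ, W) (Y i)) :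
    tangDeriv X (fun x => ∑ i ∈ s, Y i x) x = ∑ i ∈ s, tangDeriv X (Y i) x := by
  classical
  suffices h : MDifferentiable (𝓡 n) 𝓘(ℝ, W) (fun x => ∑ i ∈ s, Y i x) ∧
      tangDeriv X (fun x => ∑ i ∈ s, Y i x) x = ∑ i ∈ s, tangDeriv X (Y i) x from h.2
  induction s using Finset.induction_on with
  | empty => exact ⟨by simpa using mdifferentiable_const, by simpa using tangDeriv_const 0 x⟩
  | insert i s hi ih =>
    simp only [Finset.sum_insert hi]
    exact ⟨(hY i).add ih.1, by rw [tangDeriv_add (hY i x) (ih.1 x), ih.2]⟩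

lemma hasCompactSupport_tangDeriv_add_mul {ψ : M → ℝ} (hψc : HasCompactSupport ψ)
    (a : M → Euc (n + 1)) (R : M → ℝ) :
    HasCompactSupport fun x => tangDeriv X ψ x (a x) + ψ x * R x := by
  refine hψc.of_isClosed_subset (isClosed_tsupport _) (closure_minimal (fun x hx => ?_)
    (isClosed_tsupport _))
  by_contra h
  refine hx ?_
  simp [tangDeriv_eq_zero_of_notMem_tsupport h, image_eq_zero_of_notMem_tsupport h]

lemma continuous_tangDeriv (hX : IsTwoSidedImmersion X ν) {Y : M → W}
    (hY : ContMDiff (𝓡 n) 𝓘(ℝ, W) 1 Y) : Continuous (tangDeriv X Y) :=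
  (ContMDiff.tangDeriv (m := 0) (by simp) (hX.contMDiff.of_le (by norm_num)) hX.injective
    (by simpa using hY)).continuous

lemma continuous_tangDeriv_add_mul (hX : IsTwoSidedImmersion X ν) {ψ : M → ℝ}
    (hψ : ContMDiff (𝓡 n) 𝓘(ℝ, ℝ) 1 ψ) {a : M → Euc (n + 1)} {R : M → ℝ} (ha : Continuous a)
    (hR : Continuous R) : Continuous fun x => tangDeriv X ψ x (a x) + ψ x * R x :=
  ((continuous_tangDeriv hX hψ).clm_apply ha).add (hψ.continuous.mul hR)

variable [T2Space M] [SigmaCompactSpace M] [MeasurableSpace M] [BorelSpace M]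

lemma integrable_hypVolume_of_continuous
    (hX : ContMDiff (𝓡 n) 𝓘(ℝ, Euc (n + 1)) 1 X) {h : M → ℝ} (hh : Continuous h)
    (hc : HasCompactSupport h) : Integrable h (hypVolume X) := by
  have := isLocallyFiniteMeasure_hypVolume hX
  exact hh.integrable_of_hasCompactSupport hc

/-- A first order linear functional of test functions vanishes if it vanishes on functions
supported in chart domains. -/
lemma integral_tangDeriv_add_mul_eq_zero_of_local (hX : IsTwoSidedImmersion X ν)
    {a : M → Euc (n + 1)} {R : M → ℝ} (ha : Continuous a) (hR : Continuous R)
    (hloc : ∀ e ∈ atlas (Euc n) M, ∀ ψ : M → ℝ, ContMDiff (𝓡 n) 𝓘(ℝ, ℝ) 1 ψ →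
      HasCompactSupport ψ → tsupport ψ ⊆ e.source →
      ∫ x, (tangDeriv X ψ x (a x) + ψ x * R x) ∂(hypVolume X) = 0)
    {ψ : M → ℝ} (hψ : ContMDiff (𝓡 n) 𝓘(ℝ, ℝ) 1 ψ) (hψc : HasCompactSupport ψ) :
    ∫ x, (tangDeriv X ψ x (a x) + ψ x * R x) ∂(hypVolume X) = 0 := by
  classical
  obtain ⟨f, hf⟩ := SmoothPartitionOfUnity.exists_isSubordinate_chartAt_source (𝓡 n) M
  -- Compact support makes the decomposition of `ψ` by the partition of unity a finite sum, so no
  -- convergence question arises.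
  have hfin : {i | (Function.support (f i) ∩ tsupport ψ).Nonempty}.Finite :=
    f.locallyFinite.finite_nonempty_inter_compact hψc
  set s := hfin.toFinset with hs
  set ψi : M → M → ℝ := fun i x => f i x * ψ x with hψi
  have hC : ∀ i, ContMDiff (𝓡 n) 𝓘(ℝ, ℝ) 1 (ψi i) := fun i =>
    ((f i).contMDiff.of_le (by norm_cast)).mul hψ
  have hsum : ψ = fun x => ∑ i ∈ s, ψi i x := by
    ext x
    rw [hψi]
    dsimp only
    rw [← Finset.sum_mul]
    by_cases hx : ψ x = 0
    · simp [hx]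
    have h1 := f.sum_eq_one (mem_univ x)
    rw [finsum_eq_sum_of_support_subset (s := s)] at h1
    · rw [h1, one_mul]
    · intro i hi
      rw [hs, Finite.coe_toFinset]
      exact ⟨x, hi, subset_tsupport _ hx⟩
  have hts : ∀ i, tsupport (ψi i) ⊆ tsupport (f i) := fun i => tsupport_mul_subset_left
  have hcs : ∀ i, HasCompactSupport (ψi i) := fun i => hψc.mul_left
  have hint : ∀ i, Integrable (fun x => tangDeriv X (ψi i) x (a x) + ψi i x * R x)
      (hypVolume X) := fun i =>
    integrable_hypVolume_of_continuous (hX.contMDiff.of_le (by norm_num))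
      (continuous_tangDeriv_add_mul hX (hC i) ha hR)
      (hasCompactSupport_tangDeriv_add_mul (hcs i) a R)
  have heq : ∀ x, tangDeriv X ψ x (a x) + ψ x * R x =
      ∑ i ∈ s, (tangDeriv X (ψi i) x (a x) + ψi i x * R x) := by
    intro x
    have h1 : tangDeriv X ψ x = ∑ i ∈ s, tangDeriv X (ψi i) x := by
      conv_lhs => rw [hsum]
      exact tangDeriv_sum s fun i => (hC i).mdifferentiable (by simp)
    rw [h1, Finset.sum_add_distrib, ← Finset.sum_mul, ← congrFun hsum x]
    simp
  simp only [heq]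
  rw [integral_finsetSum _ fun i _ => hint i]
  exact Finset.sum_eq_zero fun i _ =>
    hloc _ (chart_mem_atlas _ i) _ (hC i) (hcs i) ((hts i).trans (hf i))

/-- The commutator identity for derivatives along a hypersurface, integrated against a test
function. -/
theorem integral_commutator (hX : IsTwoSidedImmersion X ν) {ζ w : M → Euc (n + 1)} {ψ : M → ℝ}
    (hζ : ContMDiff (𝓡 n) 𝓘(ℝ, Euc (n + 1)) 1 ζ) (hζν : ∀ x, inner ℝ (ν x) (ζ x) = 0)
    (hw : ContMDiff (𝓡 n) 𝓘(ℝ, Euc (n + 1)) 1 w)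
    (hψ : ContMDiff (𝓡 n) 𝓘(ℝ, ℝ) 1 ψ) (hψc : HasCompactSupport ψ) :
    ∫ x, (tangDeriv X ψ x (tangDeriv X w x (ζ x) - traceL _ (tangDeriv X w x) • ζ x) +
      ψ x * (traceL _ (tangDeriv X ζ x ∘L tangDeriv X w x) -
        traceL _ (tangDeriv X ζ x) * traceL _ (tangDeriv X w x) -
        traceL _ (tangDeriv X ν x) * inner ℝ (ν x) (tangDeriv X w x (ζ x)) +
        inner ℝ (ν x) (tangDeriv X w x (tangDeriv X ν x (ζ x))))) ∂(hypVolume X) = 0 := by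
  have hν1 : ContMDiff (𝓡 n) 𝓘(ℝ, Euc (n + 1)) 1 ν := hX.contMDiff_normal.of_le (by norm_num)
  have hX1 : ContMDiff (𝓡 n) 𝓘(ℝ, Euc (n + 1)) 1 X := hX.contMDiff.of_le (by norm_num)
  have cw := continuous_tangDeriv hX hw
  have cζ := continuous_tangDeriv hX hζ
  have cν := continuous_tangDeriv hX hν1
  have ct := (traceL (Euc (n + 1))).continuous
  have ha : Continuous fun x => tangDeriv X w x (ζ x) - traceL _ (tangDeriv X w x) • ζ x :=
    (cw.clm_apply hζ.continuous).sub ((ct.comp cw).smul hζ.continuous)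
  have hR : Continuous fun x => traceL _ (tangDeriv X ζ x ∘L tangDeriv X w x) -
        traceL _ (tangDeriv X ζ x) * traceL _ (tangDeriv X w x) -
        traceL _ (tangDeriv X ν x) * inner ℝ (ν x) (tangDeriv X w x (ζ x)) +
        inner ℝ (ν x) (tangDeriv X w x (tangDeriv X ν x (ζ x))) :=
    (((ct.comp (cζ.clm_comp cw)).sub ((ct.comp cζ).mul (ct.comp cw))).sub
      ((ct.comp cν).mul (hν1.continuous.inner (cw.clm_apply hζ.continuous)))).add
      (hν1.continuous.inner (cw.clm_apply (cν.clm_apply hζ.continuous)))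
  refine integral_tangDeriv_add_mul_eq_zero_of_local hX ha hR ?_ hψ hψc
  intro e he ψ hψ hψc hψe
  refine (integral_hypVolume_eq_chart hX1 he (continuous_tangDeriv_add_mul hX hψ ha hR) ?_).trans ?_
  · intro x hx
    have h : x ∉ tsupport ψ := fun h => hx (hψe h)
    simp [tangDeriv_eq_zero_of_notMem_tsupport h, image_eq_zero_of_notMem_tsupport h]
  -- Outside the chart image `e.symm` has no meaning; extension by zero is `C¹` because the support
  -- of `ψ` maps to a compact subset of the open target.
  set ψh : Euc n → ℝ := e.target.indicator (ψ ∘ e.symm) with hψh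
  have hKc : IsCompact (e '' tsupport ψ) :=
    hψc.isCompact.image_of_continuousOn (e.continuousOn.mono hψe)
  have hKe : e '' tsupport ψ ⊆ e.target := by
    rintro _ ⟨x, hx, rfl⟩
    exact e.map_source (hψe hx)
  have hsupp : tsupport ψh ⊆ e '' tsupport ψ := by
    refine closure_minimal (fun y hy => ?_) hKc.isClosed
    have hy1 : y ∈ e.target := by
      by_contra h
      exact hy (indicator_of_notMem h _)
    refine ⟨e.symm y, subset_tsupport _ ?_, e.right_inv hy1⟩
    rw [Function.mem_support, hψh, indicator_of_mem hy1] at hy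
    exact hy
  have hev : ∀ y ∈ e.target, ψh =ᶠ[𝓝 y] ψ ∘ e.symm := fun y hy => by
    filter_upwards [e.open_target.mem_nhds hy] with z hz
    exact indicator_of_mem hz _
  have hψhC : ContDiff ℝ 1 ψh := contDiff_of_forall_mem_tsupport fun y hy =>
    ((hψ.contDiffOn_comp_chart_symm he (by norm_cast)).contDiffAt
      (e.open_target.mem_nhds (hKe (hsupp hy)))).congr_of_eventuallyEq (hev y (hKe (hsupp hy)))
  have hψhc : HasCompactSupport ψh := hKc.of_isClosed_subset (isClosed_tsupport _) hsupp
  have hXd := hX.mdifferentiable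
  have hνd := hX.mdifferentiable_normal
  have hζd : MDifferentiable (𝓡 n) 𝓘(ℝ, Euc (n + 1)) ζ := hζ.mdifferentiable (by simp)
  have hwd : MDifferentiable (𝓡 n) 𝓘(ℝ, Euc (n + 1)) w := hw.mdifferentiable (by simp)
  have hψd : MDifferentiable (𝓡 n) 𝓘(ℝ, ℝ) ψ := hψ.mdifferentiable (by simp)
  have hmain := integral_commutator_chart e.open_target (finrank_euc_succ n)
    (hX.contMDiff.contDiffOn_comp_chart_symm he (by norm_cast) |>.of_le (by norm_num))
    (fun y hy => injective_fderiv_comp_chart_symm he hy (hXd _) (hX.injective _))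
    (hν1.contDiffOn_comp_chart_symm he (by norm_cast)) (fun y _ => hX.norm_normal _)
    (fun y hy a => by
      rw [fderiv_comp_chart_symm he hy (hXd _)]
      exact hX.orthogonal _ _)
    (hζ.contDiffOn_comp_chart_symm he (by norm_cast)) (fun y _ => hζν _)
    (hw.contDiffOn_comp_chart_symm he (by norm_cast)) hψhC hψhc (hsupp.trans hKe)
  rw [← setIntegral_eq_integral_of_forall_compl_eq_zero (s := e.target)] at hmain
  swap
  · intro y hy
    have h : y ∉ tsupport ψh := fun h => hy (hKe (hsupp h))
    have h2 : fderiv ℝ ψh y = 0 := by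
      rw [(notMem_tsupport_iff_eventuallyEq.mp h).fderiv_eq]; simp
    simp [h2, image_eq_zero_of_notMem_tsupport h]
  rw [← hmain]
  refine setIntegral_congr_fun e.open_target.measurableSet fun y hy => ?_
  have tD : ∀ {W : Type} [NormedAddCommGroup W] [NormedSpace ℝ W] {Y : M → W},
      MDifferentiable (𝓡 n) 𝓘(ℝ, W) Y → tangDeriv X Y (e.symm y) =
      fderiv ℝ (Y ∘ e.symm) y ∘L pinv (fderiv ℝ (X ∘ e.symm) y) := fun hY =>
    tangDeriv_eq_fderiv_comp_pinv he hy (hXd _) (hX.injective _) (hY _)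
  have hψy : ψh y = ψ (e.symm y) := indicator_of_mem hy _
  rw [tD hψd, tD hwd, tD hζd, tD hνd, (hev y hy).fderiv_eq, hψy]
  have t1 : ∀ (A B : Euc n →L[ℝ] Euc (n + 1)) (P : Euc (n + 1) →L[ℝ] Euc n),
      traceL (Euc (n + 1)) ((A ∘L P) ∘L (B ∘L P)) = traceL (Euc n) ((P ∘L A) ∘L (P ∘L B)) :=
    fun A B P => (traceL_comp_comm ((A ∘L P) ∘L B) P).symm
  rw [t1, ← traceL_comp_comm (fderiv ℝ (ζ ∘ e.symm) y),
    ← traceL_comp_comm (fderiv ℝ (w ∘ e.symm) y), ← traceL_comp_comm (fderiv ℝ (ν ∘ e.symm) y)]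
  simp only [ContinuousLinearMap.comp_apply, map_sub, map_smul, smul_eq_mul,
    ContinuousLinearMap.comp_assoc, Function.comp_apply]
  rw [mul_comm (traceL _ _) (fderiv ℝ (ψ ∘ e.symm) y _)]
  rfl

end WeakIdentity

/-! ### Differentiation of the area integrand -/

section AreaIntegrand

variable {E : Type*} [NormedAddCommGroup E] [InnerProductSpace ℝ E] [FiniteDimensional ℝ E]

lemma isInvertible_of_det_ne_zero {A : E →L[ℝ] E} (h : A.det ≠ 0) : A.IsInvertible :=
  ⟨A.toContinuousLinearEquivOfDetNeZero h, rfl⟩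

/-- The (not normalized) normal of the hypersurface `X + t f ν`, where `s` is the triple of `ν`,
`f dν` and `∇f`. -/
def tiltedNormal (t : ℝ) (s : E × (E →L[ℝ] E) × E) : E :=
  s.1 - t • (1 + t • s.2.1).inverse s.2.2

/-- The anisotropic area element of the hypersurface `X + t f ν`, where `s` is the triple of `ν`,
`f dν` and `∇f`. -/
def areaIntegrand (F : E → ℝ) (p : ℝ × (E × (E →L[ℝ] E) × E)) : ℝ :=
  (1 + p.1 • p.2.2.1).det * F (tiltedNormal p.1 p.2)

lemma contDiff_one_add_smul {k : WithTop ℕ∞} :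
    ContDiff ℝ k fun p : ℝ × (E × (E →L[ℝ] E) × E) => 1 + p.1 • p.2.2.1 :=
  contDiff_const.add (contDiff_fst.smul (contDiff_fst.comp (contDiff_snd.comp contDiff_snd)))

lemma contDiffAt_tiltedNormal {k : WithTop ℕ∞} {p : ℝ × (E × (E →L[ℝ] E) × E)}
    (hp : (1 + p.1 • p.2.2.1).det ≠ 0) :
    ContDiffAt ℝ k (fun p : ℝ × (E × (E →L[ℝ] E) × E) => tiltedNormal p.1 p.2) p := by
  have h1 : ContDiffAt ℝ k (fun p : ℝ × (E × (E →L[ℝ] E) × E) =>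
      (1 + p.1 • p.2.2.1).inverse) p :=
    ContDiffAt.comp (g := ContinuousLinearMap.inverse) p
      (isInvertible_of_det_ne_zero hp).contDiffAt_map_inverse contDiff_one_add_smul.contDiffAt
  exact (contDiff_fst.comp contDiff_snd).contDiffAt.sub (contDiffAt_fst.smul
    (h1.clm_apply (contDiff_snd.comp (contDiff_snd.comp contDiff_snd)).contDiffAt))

lemma contDiffAt_areaIntegrand {k : WithTop ℕ∞} {F : E → ℝ} {p : ℝ × (E × (E →L[ℝ] E) × E)}
    (hF : ContDiffOn ℝ k F {0}ᶜ) (hp : (1 + p.1 • p.2.2.1).det ≠ 0)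
    (hn : tiltedNormal p.1 p.2 ≠ 0) : ContDiffAt ℝ k (areaIntegrand F) p := by
  have h1 : ContDiffAt ℝ k F (tiltedNormal p.1 p.2) :=
    hF.contDiffAt (isOpen_compl_singleton.mem_nhds hn)
  exact (contDiff_det_clm.comp contDiff_one_add_smul).contDiffAt.mul
    (ContDiffAt.comp (g := F) p h1 (contDiffAt_tiltedNormal hp))

variable {B : E →L[ℝ] E} {ν w : E} {t : ℝ}

lemma one_add_smul_comp_inverse (h : (1 + t • B).det ≠ 0) (v : E) :
    (1 + t • B).inverse v + t • B ((1 + t • B).inverse v) = v :=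
  (isInvertible_of_det_ne_zero h).self_apply_inverse v

lemma inverse_comp_one_add_smul (h : (1 + t • B).det ≠ 0) (v : E) :
    (1 + t • B).inverse (v + t • B v) = v :=
  (isInvertible_of_det_ne_zero h).inverse_apply_self v

/-- Obtained by differentiating `(1 + t B) (1 + t B)⁻¹ = 1`. -/
lemma hasDerivAt_inverse_one_add_smul (h : (1 + t • B).det ≠ 0) :
    HasDerivAt (fun t : ℝ => (1 + t • B).inverse)
      (-((1 + t • B).inverse ∘L (B ∘L (1 + t • B).inverse))) t := by
  have hl : HasDerivAt (fun t : ℝ => 1 + t • B) B t := by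
    simpa using ((hasDerivAt_id t).smul_const B).const_add 1
  have h1 : HasDerivAt (fun t : ℝ => (1 + t • B).inverse)
      (fderiv ℝ ContinuousLinearMap.inverse (1 + t • B) B) t :=
    HasFDerivAt.comp_hasDerivAt (l := ContinuousLinearMap.inverse) t
      ((isInvertible_of_det_ne_zero h).contDiffAt_map_inverse (n := 1) |>.differentiableAt
        (by simp)).hasFDerivAt hl
  set R' := fderiv ℝ ContinuousLinearMap.inverse (1 + t • B) B with hR'
  have h2 := hl.clm_comp h1
  have hev : (fun t : ℝ => (1 + t • B) ∘L (1 + t • B).inverse) =ᶠ[𝓝 t] fun _ => 1 := by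
    have hc : ContinuousAt (fun t : ℝ => (1 + t • B).det) t :=
      ((contDiff_det_clm (k := 1)).continuous.comp
        (continuous_const.add (continuous_id.smul continuous_const))).continuousAt
    filter_upwards [hc.eventually_ne h] with s hs
    ext v
    exact one_add_smul_comp_inverse hs v
  have h3 := h2.unique ((hasDerivAt_const t (1 : E →L[ℝ] E)).congr_of_eventuallyEq hev)
  refine h1.congr_deriv ?_
  ext1 v
  have h4 : B ((1 + t • B).inverse v) + (R' v + t • B (R' v)) = 0 := by
    simpa using congrArg (fun l => l v) h3
  have h5 := inverse_comp_one_add_smul h (R' v)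
  rw [← h5, eq_neg_of_add_eq_zero_right h4]
  simp

/-- With `R = (1 + t B)⁻¹`, the relation `t B R = 1 - R` collapses the derivative of `t R` to `R²`.
-/
lemma hasDerivAt_tiltedNormal (h : (1 + t • B).det ≠ 0) :
    HasDerivAt (fun t : ℝ => tiltedNormal t (ν, B, w))
      (-(1 + t • B).inverse ((1 + t • B).inverse w)) t := by
  have h1 := ((hasDerivAt_id t).smul ((hasDerivAt_inverse_one_add_smul h).clm_apply
    (hasDerivAt_const t w))).const_sub ν
  refine h1.congr_deriv ?_
  have h2 := one_add_smul_comp_inverse h w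
  have h3 : t • B ((1 + t • B).inverse w) = w - (1 + t • B).inverse w := by
    rw [eq_sub_iff_add_eq, add_comm]; exact h2
  have h4 : t • (1 + t • B).inverse (B ((1 + t • B).inverse w)) =
      (1 + t • B).inverse w - (1 + t • B).inverse ((1 + t • B).inverse w) := by
    rw [← map_smul, h3, map_sub]
  simp [h4]

lemma hasDerivAt_det_one_add_smul' (h : (1 + t • B).det ≠ 0) :
    HasDerivAt (fun t : ℝ => (1 + t • B).det)
      ((1 + t • B).det * traceL E ((1 + t • B).inverse ∘L B)) t := by
  have hl : HasDerivAt (fun t : ℝ => 1 + t • B) B t := by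
    simpa using ((hasDerivAt_id t).smul_const B).const_add 1
  refine hasDerivAt_det_of_isUnit hl ?_
  ext v
  exact one_add_smul_comp_inverse h v

lemma inverse_one_add_zero_smul : (1 + (0 : ℝ) • B).inverse = 1 := by
  rw [zero_smul, add_zero]; exact ContinuousLinearMap.inverse_id

lemma det_one_add_zero_smul : (1 + (0 : ℝ) • B).det = 1 := by
  rw [zero_smul, add_zero, ContinuousLinearMap.det]; exact LinearMap.det_id

lemma tiltedNormal_zero (s : E × (E →L[ℝ] E) × E) : tiltedNormal 0 s = s.1 := by
  simp [tiltedNormal]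

/-- The derivative in the first variable. -/
def partialTime {S : Type*} [NormedAddCommGroup S] [NormedSpace ℝ S] (g : ℝ × S → ℝ)
    (p : ℝ × S) : ℝ := fderiv ℝ g p (1, 0)

lemma hasDerivAt_partialTime {S : Type*} [NormedAddCommGroup S] [NormedSpace ℝ S] {g : ℝ × S → ℝ}
    {t : ℝ} {s : S} (hg : DifferentiableAt ℝ g (t, s)) :
    HasDerivAt (fun t => g (t, s)) (partialTime g (t, s)) t :=
  hg.hasFDerivAt.comp_hasDerivAt t ((hasDerivAt_id t).prodMk (hasDerivAt_const t s))

lemma ContDiffAt.partialTime {S : Type*} [NormedAddCommGroup S] [NormedSpace ℝ S] {g : ℝ × S → ℝ}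
    {p : ℝ × S} {k : WithTop ℕ∞} (hg : ContDiffAt ℝ (k + 1) g p) :
    ContDiffAt ℝ k (partialTime g) p :=
  (hg.fderiv_right le_rfl).clm_apply contDiffAt_const

lemma eventually_det_ne_zero : ∀ᶠ t : ℝ in 𝓝 0, (1 + t • B).det ≠ 0 := by
  have hc : ContinuousAt (fun t : ℝ => (1 + t • B).det) 0 :=
    ((contDiff_det_clm (k := 1)).continuous.comp
      (continuous_const.add (continuous_id.smul continuous_const))).continuousAt
  exact hc.eventually_ne (by rw [det_one_add_zero_smul]; exact one_ne_zero)

lemma eventually_tiltedNormal_ne_zero (hν : ν ≠ 0) :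
    ∀ᶠ t : ℝ in 𝓝 0, tiltedNormal t (ν, B, w) ≠ 0 :=
  (hasDerivAt_tiltedNormal (by rw [det_one_add_zero_smul]; exact one_ne_zero)).continuousAt.eventually_ne
    (by rw [tiltedNormal_zero]; exact hν)

variable {F : E → ℝ}

lemma hasDerivAt_areaIntegrand (hF : ContDiffOn ℝ 1 F {0}ᶜ) (h : (1 + t • B).det ≠ 0)
    (hn : tiltedNormal t (ν, B, w) ≠ 0) :
    HasDerivAt (fun t => areaIntegrand F (t, (ν, B, w)))
      ((1 + t • B).det * traceL E ((1 + t • B).inverse ∘L B) * F (tiltedNormal t (ν, B, w)) +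
        (1 + t • B).det * fderiv ℝ F (tiltedNormal t (ν, B, w))
          (-(1 + t • B).inverse ((1 + t • B).inverse w))) t := by
  have h1 : HasFDerivAt F (fderiv ℝ F (tiltedNormal t (ν, B, w))) (tiltedNormal t (ν, B, w)) :=
    ((hF.contDiffAt (isOpen_compl_singleton.mem_nhds hn)).differentiableAt (by simp)).hasFDerivAt
  exact (hasDerivAt_det_one_add_smul' h).mul (h1.comp_hasDerivAt t (hasDerivAt_tiltedNormal h))

lemma partialTime_areaIntegrand_zero (hF : ContDiffOn ℝ 1 F {0}ᶜ) (hν : ν ≠ 0) :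
    partialTime (areaIntegrand F) (0, (ν, B, w)) = traceL E B * F ν - fderiv ℝ F ν w := by
  have h0 : (1 + (0 : ℝ) • B).det ≠ 0 := by rw [det_one_add_zero_smul]; exact one_ne_zero
  have hn : tiltedNormal 0 (ν, B, w) ≠ 0 := by rw [tiltedNormal_zero]; exact hν
  have h1 := hasDerivAt_areaIntegrand hF h0 hn
  have h2 := hasDerivAt_partialTime (t := 0) (s := (ν, B, w))
    ((contDiffAt_areaIntegrand (p := (0, (ν, B, w))) hF h0 hn).differentiableAt (by simp))
  rw [h2.unique h1, inverse_one_add_zero_smul, det_one_add_zero_smul, tiltedNormal_zero]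
  have : (1 : E →L[ℝ] E) ∘L B = B := ContinuousLinearMap.id_comp B
  rw [this]
  simp
  ring

lemma hasDerivAt_fderiv_apply {F : E → ℝ} {z : E} (hF : ContDiffAt ℝ 2 F z) {c v : ℝ → E}
    {c' v' : E} {t : ℝ} (hz : c t = z) (hc : HasDerivAt c c' t) (hv : HasDerivAt v v' t) :
    HasDerivAt (fun t => fderiv ℝ F (c t) (v t))
      (fderiv ℝ (fderiv ℝ F) z c' (v t) + fderiv ℝ F z v') t := by
  subst hz
  have h1 : HasFDerivAt (fderiv ℝ F) (fderiv ℝ (fderiv ℝ F) (c t)) (c t) :=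
    ((hF.fderiv_right (m := 1) (by norm_num)).differentiableAt (by simp)).hasFDerivAt
  have h2 : HasDerivAt (fun t => fderiv ℝ F (c t)) (fderiv ℝ (fderiv ℝ F) (c t) c') t :=
    h1.comp_hasDerivAt t hc
  exact h2.clm_apply hv

/-- The formula for the first derivative holds for all small `t` and is differentiated once more.
The first bracket is the second derivative of the determinant; the term in `B w` comes from the
derivative of `-R² w`, where `R = (1 + t B)⁻¹`. -/
lemma partialTime_partialTime_areaIntegrand_zero (hF : ContDiffOn ℝ 2 F {0}ᶜ) (hν : ν ≠ 0) :
    partialTime (partialTime (areaIntegrand F)) (0, (ν, B, w)) =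
      (traceL E B ^ 2 - traceL E (B ∘L B)) * F ν - 2 * traceL E B * fderiv ℝ F ν w +
        2 * fderiv ℝ F ν (B w) + fderiv ℝ (fderiv ℝ F) ν w w := by
  have hF1 : ContDiffOn ℝ 1 F {0}ᶜ := hF.of_le (by norm_num)
  have h0 : (1 + (0 : ℝ) • B).det ≠ 0 := by rw [det_one_add_zero_smul]; exact one_ne_zero
  have hn : tiltedNormal 0 (ν, B, w) ≠ 0 := by rw [tiltedNormal_zero]; exact hν
  have h2 := hasDerivAt_partialTime (t := 0) (s := (ν, B, w))
    ((contDiffAt_areaIntegrand (k := 1 + 1) (p := (0, (ν, B, w))) (by norm_num; exact hF) h0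
      hn).partialTime.differentiableAt (by simp))
  have hev : (fun t => partialTime (areaIntegrand F) (t, (ν, B, w))) =ᶠ[𝓝 0] fun t =>
      (1 + t • B).det * traceL E ((1 + t • B).inverse ∘L B) * F (tiltedNormal t (ν, B, w)) +
        (1 + t • B).det * fderiv ℝ F (tiltedNormal t (ν, B, w))
          (-(1 + t • B).inverse ((1 + t • B).inverse w)) := by
    filter_upwards [eventually_det_ne_zero (B := B), eventually_tiltedNormal_ne_zero (B := B)
      (w := w) hν] with t ht hnt
    exact (hasDerivAt_partialTime (t := t) (s := (ν, B, w))
      ((contDiffAt_areaIntegrand (p := (t, (ν, B, w))) hF1 ht hnt).differentiableAt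
        (by simp))).unique (hasDerivAt_areaIntegrand hF1 ht hnt)
  have i1 : ∀ B : E →L[ℝ] E, (1 : E →L[ℝ] E) ∘L B = B := ContinuousLinearMap.id_comp
  have i2 : ∀ B : E →L[ℝ] E, B ∘L (1 : E →L[ℝ] E) = B := ContinuousLinearMap.comp_id
  have hda : HasDerivAt (fun t : ℝ => (1 + t • B).det) (traceL E B) 0 :=
    (hasDerivAt_det_one_add_smul' h0).congr_deriv (by
      rw [inverse_one_add_zero_smul, det_one_add_zero_smul, i1, one_mul])
  have hdR : HasDerivAt (fun t : ℝ => (1 + t • B).inverse) (-B) 0 :=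
    (hasDerivAt_inverse_one_add_smul h0).congr_deriv (by
      rw [inverse_one_add_zero_smul, i1, i2])
  have hdn : HasDerivAt (fun t : ℝ => tiltedNormal t (ν, B, w)) (-w) 0 :=
    (hasDerivAt_tiltedNormal h0).congr_deriv (by rw [inverse_one_add_zero_smul]; rfl)
  have hn0 : tiltedNormal 0 (ν, B, w) = ν := tiltedNormal_zero _
  have hFν : ContDiffAt ℝ 2 F ν := hF.contDiffAt (isOpen_compl_singleton.mem_nhds hν)
  have hdF : HasFDerivAt F (fderiv ℝ F ν) (tiltedNormal 0 (ν, B, w)) := by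
    rw [hn0]; exact (hFν.differentiableAt (by simp)).hasFDerivAt
  have hdb : HasDerivAt (fun t : ℝ => F (tiltedNormal t (ν, B, w))) (fderiv ℝ F ν (-w)) 0 :=
    hdF.comp_hasDerivAt 0 hdn
  have hdtr : HasDerivAt (fun t : ℝ => traceL E ((1 + t • B).inverse ∘L B))
      (traceL E (-(B ∘L B))) 0 :=
    ((traceL E).hasFDerivAt.comp_hasDerivAt (0 : ℝ)
      (hdR.clm_comp (hasDerivAt_const 0 B))).congr_deriv (by simp)
  have hdRw : HasDerivAt (fun t : ℝ => (1 + t • B).inverse w) (-B w) 0 :=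
    (hdR.clm_apply (hasDerivAt_const 0 w)).congr_deriv (by simp)
  have hdRRw : HasDerivAt (fun t : ℝ => -(1 + t • B).inverse ((1 + t • B).inverse w))
      (B w + B w) 0 :=
    ((hdR.clm_apply hdRw).neg).congr_deriv (by
      rw [inverse_one_add_zero_smul]; simp)
  have hdDF : HasDerivAt (fun t : ℝ => fderiv ℝ F (tiltedNormal t (ν, B, w))
      (-(1 + t • B).inverse ((1 + t • B).inverse w)))
      (fderiv ℝ (fderiv ℝ F) ν w w + 2 * fderiv ℝ F ν (B w)) 0 :=
    (hasDerivAt_fderiv_apply hFν hn0 hdn hdRRw).congr_deriv (by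
      rw [inverse_one_add_zero_smul]; simp; ring)
  have h3 := ((hda.mul hdtr).mul hdb).add (hda.mul hdDF)
  rw [h2.unique (h3.congr_of_eventuallyEq hev), det_one_add_zero_smul, hn0,
    inverse_one_add_zero_smul, i1]
  simp only [Pi.mul_apply, det_one_add_zero_smul, inverse_one_add_zero_smul, i1, map_neg,
    one_apply_eq_self]
  ring

end AreaIntegrand

/-! ### Differentiation under the integral sign -/

section ParametricIntegral

variable {M S : Type*} [TopologicalSpace M] [T2Space M] [MeasurableSpace M] [BorelSpace M]
  [NormedAddCommGroup S] [NormedSpace ℝ S]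

/-- Compactness of `q '' K` gives one time interval on which `g` is `C¹` at all relevant points, and
a constant dominating the derivative. The conclusion holds near `0`, not only at `0`, so that it can
be iterated. -/
lemma eventually_hasDerivAt_setIntegral {μ : Measure M} [IsLocallyFiniteMeasure μ] {K : Set M}
    (hK : IsCompact K) {q : M → S} (hq : Continuous q) {g : ℝ × S → ℝ}
    (hg : ∀ x ∈ K, ContDiffAt ℝ 1 g (0, q x)) :
    ∀ᶠ t in 𝓝 (0 : ℝ), HasDerivAt (fun t => ∫ x in K, g (t, q x) ∂μ)
      (∫ x in K, partialTime g (t, q x) ∂μ) t := by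
  have hqK : IsCompact (q '' K) := hK.image hq
  have hev : ∀ᶠ t in 𝓝 (0 : ℝ), ∀ s ∈ q '' K, ContDiffAt ℝ 1 g (t, s) := by
    refine hqK.eventually_forall_of_forall_eventually ?_
    rintro _ ⟨x, hx, rfl⟩
    exact (hg x hx).eventually (by simp)
  obtain ⟨δ, hδ, hball⟩ := Metric.eventually_nhds_iff.mp hev
  have hC1 : ∀ t ∈ Icc (-(δ / 2)) (δ / 2), ∀ x ∈ K, ContDiffAt ℝ 1 g (t, q x) := by
    intro t ht x hx
    refine hball ?_ _ ⟨x, hx, rfl⟩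
    rw [Real.dist_eq, sub_zero]
    exact lt_of_le_of_lt (abs_le.mpr ht) (by linarith)
  have hp : ContinuousOn (partialTime g) (Icc (-(δ / 2)) (δ / 2) ×ˢ (q '' K)) := by
    rintro ⟨t, _⟩ ⟨ht, x, hx, rfl⟩
    exact ((hC1 t ht x hx).partialTime (k := 0)).continuousAt.continuousWithinAt
  obtain ⟨C, hC⟩ := (isCompact_Icc.prod hqK).exists_bound_of_continuousOn hp
  have hqc : ∀ t : ℝ, Continuous fun x => (t, q x) := fun t => continuous_const.prodMk hq
  have hgc : ∀ t ∈ Icc (-(δ / 2)) (δ / 2), ContinuousOn (fun x => g (t, q x)) K :=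
    fun t ht x hx => ContinuousAt.comp_continuousWithinAt (g := g)
      (hC1 t ht x hx).continuousAt (hqc t).continuousWithinAt
  have hpc : ∀ t ∈ Icc (-(δ / 2)) (δ / 2), ContinuousOn (fun x => partialTime g (t, q x)) K :=
    fun t ht x hx => ContinuousAt.comp_continuousWithinAt (g := partialTime g)
      ((hC1 t ht x hx).partialTime (k := 0)).continuousAt (hqc t).continuousWithinAt
  have hnb : ∀ t ∈ Ioo (-(δ / 2)) (δ / 2), Ioo (-(δ / 2)) (δ / 2) ∈ 𝓝 t :=
    fun t ht => isOpen_Ioo.mem_nhds ht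
  filter_upwards [hnb 0 ⟨by linarith, by linarith⟩] with t ht
  refine (hasDerivAt_integral_of_dominated_loc_of_deriv_le (bound := fun _ => C)
    (F' := fun t x => partialTime g (t, q x)) (hnb t ht) ?_ ?_ ?_ ?_ ?_ ?_).2
  · filter_upwards [hnb t ht] with s hs
    exact (hgc s (Ioo_subset_Icc_self hs)).aestronglyMeasurable hK.measurableSet
  · exact (hgc t (Ioo_subset_Icc_self ht)).integrableOn_compact hK
  · exact (hpc t (Ioo_subset_Icc_self ht)).aestronglyMeasurable hK.measurableSet
  · refine (ae_restrict_iff' hK.measurableSet).mpr (Eventually.of_forall fun x hx s hs => ?_)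
    exact hC (s, q x) ⟨Ioo_subset_Icc_self hs, x, hx, rfl⟩
  · exact (continuousOn_const (c := C)).integrableOn_compact hK
  · refine (ae_restrict_iff' hK.measurableSet).mpr (Eventually.of_forall fun x hx s hs => ?_)
    exact hasDerivAt_partialTime ((hC1 s (Ioo_subset_Icc_self hs) x hx).differentiableAt (by simp))

lemma deriv_deriv_setIntegral {μ : Measure M} [IsLocallyFiniteMeasure μ] {K : Set M}
    (hK : IsCompact K) {q : M → S} (hq : Continuous q) {g : ℝ × S → ℝ}
    (hg : ∀ x ∈ K, ContDiffAt ℝ 2 g (0, q x)) :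
    deriv (deriv fun t => ∫ x in K, g (t, q x) ∂μ) 0 =
      ∫ x in K, partialTime (partialTime g) (0, q x) ∂μ := by
  have h1 := eventually_hasDerivAt_setIntegral (μ := μ) hK hq
    fun x hx => (hg x hx).of_le (by norm_num : (1 : WithTop ℕ∞) ≤ 2)
  have h2 := eventually_hasDerivAt_setIntegral (μ := μ) hK hq
    fun x hx => ContDiffAt.partialTime (k := 1) (by norm_num; exact hg x hx)
  rw [← h2.self_of_nhds.deriv]
  refine EventuallyEq.deriv_eq ?_
  filter_upwards [h1] with t ht using ht.deriv

end ParametricIntegral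

/-! ### Normal variations -/

section TiltAlgebra

variable {E : Type*} [NormedAddCommGroup E] [InnerProductSpace ℝ E] [FiniteDimensional ℝ E]
  {B : E →L[ℝ] E} {ν w : E} {t : ℝ}

lemma inner_smul_inverse_normal (h : (1 + t • B).det ≠ 0)
    (hB : ∀ x y, inner ℝ (B x) y = inner ℝ x (B y)) (hBν : B ν = 0) (hw : inner ℝ w ν = 0) :
    inner ℝ (t • (1 + t • B).inverse w) ν = 0 := by
  have h1 := one_add_smul_comp_inverse h w
  have h2 : inner ℝ ((1 + t • B).inverse w) ν = 0 := by
    have h3 := congrArg (fun v => inner ℝ v ν) h1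
    simpa [inner_add_left, inner_smul_left, hB, hBν, hw] using h3
  rw [inner_smul_left, h2, mul_zero]

/-- The vector `z = t (1 + t B)⁻¹ w` is the one that writes the normal component `t ⟨w, a⟩` of the
deformed tangent vector as `⟨z, a + t B a⟩`, the form required by `normDet_tilt`. -/
lemma inner_smul_inverse_apply (h : (1 + t • B).det ≠ 0)
    (hB : ∀ x y, inner ℝ (B x) y = inner ℝ x (B y)) (a : E) :
    inner ℝ (t • (1 + t • B).inverse w) (a + t • B a) = t * inner ℝ w a := by
  conv_rhs => rw [← one_add_smul_comp_inverse h w]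
  simp [inner_add_left, inner_add_right, inner_smul_left, inner_smul_right, hB]
  ring

/-- Its component along `ν` is always `1`. -/
lemma tiltedNormal_ne_zero (h : (1 + t • B).det ≠ 0)
    (hB : ∀ x y, inner ℝ (B x) y = inner ℝ x (B y)) (hBν : B ν = 0) (hw : inner ℝ w ν = 0)
    (hν : ‖ν‖ = 1) : tiltedNormal t (ν, B, w) ≠ 0 := by
  intro h0
  have h1 : inner ℝ (tiltedNormal t (ν, B, w)) ν = 1 := by
    unfold tiltedNormal
    rw [inner_sub_left, inner_smul_inverse_normal h hB hBν hw, real_inner_self_eq_norm_sq, hν]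
    norm_num
  rw [h0, inner_zero_left] at h1
  exact zero_ne_one h1

end TiltAlgebra

section NormalVariation

variable {n : ℕ} {M : Type*} [TopologicalSpace M] [ChartedSpace (EuclideanSpace ℝ (Fin n)) M]
  [IsManifold (𝓡 n) ∞ M] {X ν : M → EuclideanSpace ℝ (Fin (n + 1))} {f : M → ℝ} {t : ℝ}

/-- The triple of `ν`, `f dν` and `∇f`. -/
def variationData (X ν : M → EuclideanSpace ℝ (Fin (n + 1))) (f : M → ℝ) (x : M) :
    Euc (n + 1) × (Euc (n + 1) →L[ℝ] Euc (n + 1)) × Euc (n + 1) :=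
  (ν x, f x • tangDeriv X ν x, hypGradient X f x)

/-- The variation of `X` with velocity `f ν`. -/
def normalVariation (X ν : M → EuclideanSpace ℝ (Fin (n + 1))) (f : M → ℝ) (t : ℝ) (x : M) :
    Euc (n + 1) := X x + (t * f x) • ν x

/-- The unit normal of the variation of `X` with velocity `f ν`. -/
def variationNormal (X ν : M → EuclideanSpace ℝ (Fin (n + 1))) (f : M → ℝ) (t : ℝ) (x : M) :
    Euc (n + 1) :=
  ‖tiltedNormal t (variationData X ν f x)‖⁻¹ • tiltedNormal t (variationData X ν f x)

lemma continuous_hypGradient (hX : IsTwoSidedImmersion X ν)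
    (hf : ContMDiff (𝓡 n) 𝓘(ℝ, ℝ) 1 f) : Continuous (hypGradient X f) :=
  (InnerProductSpace.toDual ℝ (Euc (n + 1))).symm.continuous.comp (continuous_tangDeriv hX hf)

lemma continuous_tangDeriv_normal (hX : IsTwoSidedImmersion X ν) : Continuous (tangDeriv X ν) :=
  continuous_tangDeriv hX (hX.contMDiff_normal.of_le (by norm_num))

lemma continuous_variationData (hX : IsTwoSidedImmersion X ν)
    (hf : ContMDiff (𝓡 n) 𝓘(ℝ, ℝ) 1 f) : Continuous (variationData X ν f) :=
  hX.contMDiff_normal.continuous.prodMk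
    ((hf.continuous.smul (continuous_tangDeriv_normal hX)).prodMk (continuous_hypGradient hX hf))

lemma inner_smul_tangDeriv_normal_comm (hX : IsTwoSidedImmersion X ν) (c : ℝ) (x : M)
    (a b : Euc (n + 1)) :
    inner ℝ ((c • tangDeriv X ν x) a) b = inner ℝ a ((c • tangDeriv X ν x) b) := by
  simp [inner_smul_left, inner_smul_right, hX.inner_tangDeriv_normal_comm]

lemma smul_tangDeriv_normal_apply (hX : IsTwoSidedImmersion X ν) (c : ℝ) (x : M) :
    (c • tangDeriv X ν x) (ν x) = 0 := by
  simp [hX.tangDeriv_normal_apply]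

lemma mdiff_normalVariation (hX : IsTwoSidedImmersion X ν)
    (hf : ContMDiff (𝓡 n) 𝓘(ℝ, ℝ) 1 f) (x : M) (a : Euc n) :
    mdiff (normalVariation X ν f t) x a =
      (differential X x a + t • (f x • tangDeriv X ν x) (differential X x a)) +
        (t * inner ℝ (hypGradient X f x) (differential X x a)) • ν x := by
  have hfd : MDifferentiable (𝓡 n) 𝓘(ℝ, ℝ) f := hf.mdifferentiable (by simp)
  have hc : MDifferentiable (𝓡 n) 𝓘(ℝ, ℝ) (fun _ : M => t) := mdifferentiable_const
  have hcf : MDifferentiable (𝓡 n) 𝓘(ℝ, ℝ) (fun x => t * f x) :=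
    (contMDiff_const.mul hf).mdifferentiable (n := 1) (by simp)
  have hs : MDifferentiable (𝓡 n) 𝓘(ℝ, Euc (n + 1)) (fun x => (t * f x) • ν x) :=
    ((contMDiff_const.mul hf).smul (hX.contMDiff_normal.of_le (by norm_num))).mdifferentiable
      (n := 1) (by simp)
  rw [← hX.tangDeriv_differential]
  change tangDeriv X (fun x => X x + (t * f x) • ν x) x _ = _
  rw [tangDeriv_add (hX.mdifferentiable x) (hs x), add_apply,
    tangDeriv_smul (hcf x) (hX.mdifferentiable_normal x), tangDeriv_mul (hc x) (hfd x),
    tangDeriv_const, hX.tangDeriv_self, real_inner_comm, hX.orthogonal, inner_hypGradient]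
  simp [smul_smul]
  abel

/-- The condition under which the normal variation at time `t` is an immersion. -/
def IsRegularTime (X ν : M → EuclideanSpace ℝ (Fin (n + 1))) (f : M → ℝ) (t : ℝ) : Prop :=
  ∀ x, 0 < (1 + t • f x • tangDeriv X ν x).det

/-- Uniform in `x`: on the compact support of `f` by continuity from the value `1` at `t = 0`, and
elsewhere the determinant equals `1`. -/
lemma eventually_isRegularTime (hX : IsTwoSidedImmersion X ν)
    (hf : ContMDiff (𝓡 n) 𝓘(ℝ, ℝ) 1 f) (hfc : HasCompactSupport f) :
    ∀ᶠ t in 𝓝 (0 : ℝ), IsRegularTime X ν f t := by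
  have hc : Continuous fun p : ℝ × M => (1 + p.1 • f p.2 • tangDeriv X ν p.2).det :=
    (contDiff_det_clm (k := 0)).continuous.comp (continuous_const.add (continuous_fst.smul
      ((hf.continuous.comp continuous_snd).smul
        ((continuous_tangDeriv_normal hX).comp continuous_snd))))
  have h1 : ∀ᶠ t in 𝓝 (0 : ℝ), ∀ x ∈ tsupport f, 0 < (1 + t • f x • tangDeriv X ν x).det := by
    refine hfc.isCompact.eventually_forall_of_forall_eventually fun x _ => ?_
    refine continuousAt_const.eventually_lt hc.continuousAt ?_
    rw [det_one_add_zero_smul]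
    exact one_pos
  filter_upwards [h1] with t ht x
  by_cases hx : x ∈ tsupport f
  · exact ht x hx
  · have h2 := det_one_add_zero_smul (B := tangDeriv X ν x)
    rw [image_eq_zero_of_notMem_tsupport hx, zero_smul, smul_zero]
    rw [zero_smul] at h2
    rw [h2]
    exact one_pos

lemma tiltedNormal_variationData_ne_zero (hX : IsTwoSidedImmersion X ν)
    (ht : IsRegularTime X ν f t) (x : M) : tiltedNormal t (variationData X ν f x) ≠ 0 :=
  tiltedNormal_ne_zero (ht x).ne' (inner_smul_tangDeriv_normal_comm hX _ x)
    (smul_tangDeriv_normal_apply hX _ x) (hX.inner_hypGradient_normal f x) (hX.norm_normal x)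

lemma inner_mdiff_normalVariation (hX : IsTwoSidedImmersion X ν)
    (hf : ContMDiff (𝓡 n) 𝓘(ℝ, ℝ) 1 f) (ht : IsRegularTime X ν f t) (x : M) (a : Euc n) :
    inner ℝ (mdiff (normalVariation X ν f t) x a) (tiltedNormal t (variationData X ν f x)) = 0 := by
  have h1 := inner_smul_inverse_normal (ht x).ne' (inner_smul_tangDeriv_normal_comm hX _ x)
    (smul_tangDeriv_normal_apply hX _ x) (hX.inner_hypGradient_normal f x)
  have h2 := inner_smul_inverse_apply (w := hypGradient X f x) (ht x).ne'
    (inner_smul_tangDeriv_normal_comm hX _ x) (differential X x a)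
  have h3 : inner ℝ ((f x • tangDeriv X ν x) (differential X x a)) (ν x) = 0 := by
    rw [inner_smul_tangDeriv_normal_comm hX, smul_tangDeriv_normal_apply hX, inner_zero_right]
  rw [mdiff_normalVariation hX hf, inner_add_left, inner_smul_left]
  unfold tiltedNormal variationData
  dsimp only
  rw [inner_sub_right, inner_sub_right, real_inner_comm (t • _) (differential X x a + _), h2,
    real_inner_comm (t • _) (ν x), h1, inner_add_left, hX.orthogonal, inner_smul_left, h3,
    real_inner_self_eq_norm_sq, hX.norm_normal]
  simp

lemma injective_mdiff_normalVariation (hX : IsTwoSidedImmersion X ν)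
    (hf : ContMDiff (𝓡 n) 𝓘(ℝ, ℝ) 1 f) (ht : IsRegularTime X ν f t) (x : M) :
    Function.Injective (differential (normalVariation X ν f t) x) := by
  rw [injective_iff_map_eq_zero]
  intro a ha
  have h1 : mdiff (normalVariation X ν f t) x a = 0 := ha
  rw [mdiff_normalVariation hX hf] at h1
  set L := differential X x a with hL
  set B := f x • tangDeriv X ν x with hB
  have hLν : inner ℝ L (ν x) = 0 := hX.orthogonal x a
  have hBν : inner ℝ (B L) (ν x) = 0 := by
    rw [inner_smul_tangDeriv_normal_comm hX, smul_tangDeriv_normal_apply hX, inner_zero_right]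
  have h2 := congrArg (fun v => inner ℝ v (ν x)) h1
  simp only [inner_add_left, inner_smul_left, hLν, hBν, real_inner_self_eq_norm_sq,
    hX.norm_normal, inner_zero_left] at h2
  have h3 : t * inner ℝ (hypGradient X f x) L = 0 := by simpa using h2
  rw [h3, zero_smul, add_zero] at h1
  have h4 := inverse_comp_one_add_smul (ht x).ne' L
  rw [h1, map_zero] at h4
  exact (injective_iff_map_eq_zero _).mp (hX.injective x) a h4.symm

/-- An instance of `normDet_tilt` in coordinates: the tangential perturbation is `t f dν`, and the
tilt comes from the normal component `t df`. -/
lemma chartDensity_normalVariation (hX : IsTwoSidedImmersion X ν)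
    (hf : ContMDiff (𝓡 n) 𝓘(ℝ, ℝ) 1 f) (ht : IsRegularTime X ν f t)
    {e : OpenPartialHomeomorph M (Euc n)} (he : e ∈ atlas (Euc n) M) {y : Euc n}
    (hy : y ∈ e.target) :
    chartDensity (normalVariation X ν f t) e y =
      ((1 + t • f (e.symm y) • tangDeriv X ν (e.symm y)).det *
        ‖tiltedNormal t (variationData X ν f (e.symm y))‖) * chartDensity X e y := by
  set x := e.symm y with hx
  have hΦ : MDifferentiable (𝓡 n) 𝓘(ℝ, Euc (n + 1)) (normalVariation X ν f t) :=
    ((hX.contMDiff.of_le (by norm_num)).add ((contMDiff_const.mul hf).smul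
      (hX.contMDiff_normal.of_le (by norm_num)))).mdifferentiable (n := 1) (by simp)
  have hfX := fderiv_comp_chart_symm he hy (hX.mdifferentiable x)
  have hfν := fderiv_comp_chart_symm he hy (hX.mdifferentiable_normal x)
  have hfΦ := fderiv_comp_chart_symm he hy (hΦ x)
  have hsymm := inner_smul_tangDeriv_normal_comm hX (f x) x
  have hnu := smul_tangDeriv_normal_apply hX (f x) x
  have hD : ∀ v, (t • f x • fderiv ℝ (ν ∘ e.symm) y) v =
      t • (f x • tangDeriv X ν x) (fderiv ℝ (X ∘ e.symm) y v) := by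
    intro v
    rw [hfX, hfν]
    change t • f x • mdiff ν x (chartSymmDeriv he hy v) =
      t • f x • tangDeriv X ν x (differential X x (chartSymmDeriv he hy v))
    rw [hX.tangDeriv_differential]
  have hDP : (t • f x • fderiv ℝ (ν ∘ e.symm) y) ∘L pinv (fderiv ℝ (X ∘ e.symm) y) =
      t • f x • tangDeriv X ν x := by
    rw [tangDeriv_eq_fderiv_comp_pinv he hy (hX.mdifferentiable _) (hX.injective _)
      (hX.mdifferentiable_normal _), ContinuousLinearMap.smul_comp, ContinuousLinearMap.smul_comp]
  have h := normDet_tilt (L := fderiv ℝ (X ∘ e.symm) y)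
    (L' := fderiv ℝ (normalVariation X ν f t ∘ e.symm) y) (ν := ν x)
    (D := t • f x • fderiv ℝ (ν ∘ e.symm) y)
    (z := t • (1 + t • f x • tangDeriv X ν x).inverse (hypGradient X f x))
    (finrank_euc_succ n)
    (injective_fderiv_comp_chart_symm he hy (hX.mdifferentiable _) (hX.injective _))
    (fun v => by rw [hfX]; exact hX.orthogonal _ _) (hX.norm_normal x)
    (fun v => by rw [hD, inner_smul_left, hsymm, hnu, inner_zero_right, mul_zero])
    (inner_smul_inverse_normal (ht x).ne' hsymm hnu (hX.inner_hypGradient_normal f x))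
    (fun v => by
      rw [hD, inner_smul_inverse_apply (ht x).ne' hsymm, hfΦ, hfX]
      exact mdiff_normalVariation hX hf x _)
  rw [hDP, abs_of_pos (ht x)] at h
  exact h

lemma normal_ne_zero (hX : IsTwoSidedImmersion X ν) (x : M) : ν x ≠ 0 :=
  norm_ne_zero_iff.mp (by rw [hX.norm_normal]; exact one_ne_zero)

variable [T2Space M] [SigmaCompactSpace M] [MeasurableSpace M] [BorelSpace M]

lemma contMDiff_normalVariation (hX : IsTwoSidedImmersion X ν)
    (hf : ContMDiff (𝓡 n) 𝓘(ℝ, ℝ) 1 f) :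
    ContMDiff (𝓡 n) 𝓘(ℝ, Euc (n + 1)) 1 (normalVariation X ν f t) :=
  (hX.contMDiff.of_le (by norm_num)).add ((contMDiff_const.mul hf).smul
    (hX.contMDiff_normal.of_le (by norm_num)))

lemma continuous_tiltedNormal_variationData (hX : IsTwoSidedImmersion X ν)
    (hf : ContMDiff (𝓡 n) 𝓘(ℝ, ℝ) 1 f) (ht : IsRegularTime X ν f t) :
    Continuous fun x => tiltedNormal t (variationData X ν f x) :=
  continuous_iff_continuousAt.mpr fun x => ContinuousAt.comp (f := fun x => (t, variationData X ν f x))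
    (g := fun p : ℝ × (Euc (n + 1) × (Euc (n + 1) →L[ℝ] Euc (n + 1)) × Euc (n + 1)) =>
      tiltedNormal p.1 p.2)
    (contDiffAt_tiltedNormal (k := 0) (ht x).ne').continuousAt
    (continuous_const.prodMk (continuous_variationData hX hf)).continuousAt

/-- The length of the unnormalized normal appears once in the Jacobian and once, inverted, in the
unit normal; homogeneity of `F` cancels the two. -/
lemma anisotropicArea_normalVariation {F : Euc (n + 1) → ℝ} (hF : IsEllipticIntegrand F)
    (hX : IsTwoSidedImmersion X ν) (hf : ContMDiff (𝓡 n) 𝓘(ℝ, ℝ) 1 f)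
    (ht : IsRegularTime X ν f t) {K : Set M} (hK : MeasurableSet K) :
    anisotropicArea F (normalVariation X ν f t) (variationNormal X ν f t) K =
      ∫ x in K, areaIntegrand F (t, variationData X ν f x) ∂(hypVolume X) := by
  have hJ : Continuous fun x => (1 + t • f x • tangDeriv X ν x).det *
      ‖tiltedNormal t (variationData X ν f x)‖ :=
    ((contDiff_det_clm (k := 0)).continuous.comp (continuous_const.add
      ((hf.continuous.smul (continuous_tangDeriv_normal hX)).const_smul t))).mul
      (continuous_tiltedNormal_variationData hX hf ht).norm
  have hJ0 : ∀ x, 0 ≤ (1 + t • f x • tangDeriv X ν x).det *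
      ‖tiltedNormal t (variationData X ν f x)‖ := fun x =>
    mul_nonneg (ht x).le (norm_nonneg _)
  unfold anisotropicArea
  rw [hypVolume_eq_withDensity (hX.contMDiff.of_le (by norm_num)) (contMDiff_normalVariation hX hf)
    hJ hJ0 (fun e he y hy => chartDensity_normalVariation hX hf ht he hy),
    setIntegral_withDensity_eq_setIntegral_toReal_smul hJ.measurable.ennreal_ofReal (by simp) _ hK]
  refine integral_congr_ae (Eventually.of_forall fun x => ?_)
  have hn := tiltedNormal_variationData_ne_zero hX ht x
  have hn0 := norm_pos_iff.mpr hn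
  dsimp only
  rw [ENNReal.toReal_ofReal (hJ0 x), smul_eq_mul, variationNormal,
    hF.homogeneous _ (inv_pos.mpr hn0) _ hn]
  unfold areaIntegrand
  dsimp only
  field_simp
  exact mul_comm _ _

/-- The variation is affine in `t`, with velocity `f ν` and zero acceleration, so `f` of class `C¹`
is enough. -/
lemma isCompactVariation_normalVariation (hX : IsTwoSidedImmersion X ν)
    (hf : ContMDiff (𝓡 n) 𝓘(ℝ, ℝ) 1 f) (hfc : HasCompactSupport f) {δ : ℝ} (hδ : 0 < δ)
    (ht : ∀ t ∈ Ioo (-δ) δ, IsRegularTime X ν f t) :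
    IsCompactVariation X ν (tsupport f) δ (normalVariation X ν f) (variationNormal X ν f) where
  isCompact := hfc
  pos := hδ
  map_zero := by ext1 x; simp [normalVariation]
  normal_zero := by
    ext1 x
    simp [variationNormal, tiltedNormal_zero, variationData, hX.norm_normal]
  eq_outside t _ x hx := by simp [normalVariation, image_eq_zero_of_notMem_tsupport hx]
  regular := by
    have hX1 : ContMDiff (𝓡 n) 𝓘(ℝ, Euc (n + 1)) 1 X := hX.contMDiff.of_le (by norm_num)
    have hν1 : ContMDiff (𝓡 n) 𝓘(ℝ, Euc (n + 1)) 1 ν := hX.contMDiff_normal.of_le (by norm_num)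
    refine ⟨fun _ x => f x • ν x, fun _ _ => 0, fun t _ x => ?_, fun t _ x => hasDerivAt_const _ _,
      ?_, ?_, contMDiffOn_const⟩
    · have h := (((hasDerivAt_id t).mul_const (f x)).smul_const (ν x)).const_add (X x)
      exact h.congr_deriv (by rw [one_mul])
    · exact ((hX1.comp contMDiff_snd).add ((contMDiff_fst.mul (hf.comp contMDiff_snd)).smul
        (hν1.comp contMDiff_snd))).contMDiffOn
    · exact ((hf.comp contMDiff_snd).smul (hν1.comp contMDiff_snd)).contMDiffOn
  injective t htδ x := injective_mdiff_normalVariation hX hf (ht t htδ) x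
  continuousOn_normal := by
    have h1 : ContinuousOn (fun p : ℝ × M => tiltedNormal p.1 (variationData X ν f p.2))
        (Ioo (-δ) δ ×ˢ univ) := fun p hp =>
      (ContinuousAt.comp (f := fun p : ℝ × M => (p.1, variationData X ν f p.2))
        (g := fun p : ℝ × (Euc (n + 1) × (Euc (n + 1) →L[ℝ] Euc (n + 1)) × Euc (n + 1)) =>
          tiltedNormal p.1 p.2)
        (contDiffAt_tiltedNormal (k := 0) (ht p.1 hp.1 p.2).ne').continuousAt
        (continuous_fst.prodMk
          ((continuous_variationData hX hf).comp continuous_snd)).continuousAt).continuousWithinAt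
    exact (h1.norm.inv₀ fun p hp => (norm_pos_iff.mpr
      (tiltedNormal_variationData_ne_zero hX (ht p.1 hp.1) p.2)).ne').smul h1
  norm_normal t htδ x := by
    have h := norm_pos_iff.mpr (tiltedNormal_variationData_ne_zero hX (ht t htδ) x)
    rw [variationNormal, norm_smul, norm_inv, norm_norm, inv_mul_cancel₀ h.ne']
  orthogonal t htδ x v := by
    rw [variationNormal, inner_smul_right]
    exact mul_eq_zero_of_right _ (inner_mdiff_normalVariation hX hf (ht t htδ) x v)

lemma contDiffAt_areaIntegrand_variationData {F : Euc (n + 1) → ℝ} (hF : IsEllipticIntegrand F)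
    (hX : IsTwoSidedImmersion X ν) (x : M) :
    ContDiffAt ℝ 2 (areaIntegrand F) (0, variationData X ν f x) := by
  refine contDiffAt_areaIntegrand (hF.contDiffOn.of_le (by norm_num)) ?_ ?_
  · rw [det_one_add_zero_smul]; exact one_ne_zero
  · rw [tiltedNormal_zero]
    exact norm_ne_zero_iff.mp (by rw [variationData, hX.norm_normal]; exact one_ne_zero)

lemma exists_regular_interval (hX : IsTwoSidedImmersion X ν)
    (hf : ContMDiff (𝓡 n) 𝓘(ℝ, ℝ) 1 f) (hfc : HasCompactSupport f) :
    ∃ δ > 0, ∀ t ∈ Ioo (-δ) δ, IsRegularTime X ν f t := by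
  obtain ⟨δ, hδ, h⟩ := Metric.eventually_nhds_iff.mp (eventually_isRegularTime hX hf hfc)
  exact ⟨δ, hδ, fun t ht => h (by rw [Real.dist_eq, sub_zero]; exact abs_lt.mpr ht)⟩

lemma anisotropicArea_eventuallyEq {F : Euc (n + 1) → ℝ} (hF : IsEllipticIntegrand F)
    (hX : IsTwoSidedImmersion X ν) (hf : ContMDiff (𝓡 n) 𝓘(ℝ, ℝ) 1 f)
    (hfc : HasCompactSupport f) :
    (fun t => anisotropicArea F (normalVariation X ν f t) (variationNormal X ν f t) (tsupport f))
      =ᶠ[𝓝 0] fun t => ∫ x in tsupport f, areaIntegrand F (t, variationData X ν f x)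
        ∂(hypVolume X) := by
  filter_upwards [eventually_isRegularTime hX hf hfc] with t ht
  exact anisotropicArea_normalVariation hF hX hf ht (isClosed_tsupport f).measurableSet

/-- The first variation formula for normal variations. -/
lemma setIntegral_first_variation_eq_zero {F : Euc (n + 1) → ℝ} (hF : IsEllipticIntegrand F)
    (hX : IsTwoSidedImmersion X ν) (hmin : IsFMinimal F X ν)
    (hf : ContMDiff (𝓡 n) 𝓘(ℝ, ℝ) 1 f) (hfc : HasCompactSupport f) :
    ∫ x in tsupport f, (f x * traceL _ (tangDeriv X ν x) * F (ν x) -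
      fderiv ℝ F (ν x) (hypGradient X f x)) ∂(hypVolume X) = 0 := by
  have := isLocallyFiniteMeasure_hypVolume (hX.contMDiff.of_le (by norm_num))
  obtain ⟨δ, hδ, hreg⟩ := exists_regular_interval hX hf hfc
  have h1 := hmin _ _ _ _ (isCompactVariation_normalVariation hX hf hfc hδ hreg)
  have h2 := (eventually_hasDerivAt_setIntegral (μ := hypVolume X) hfc.isCompact
    (continuous_variationData hX hf) (g := areaIntegrand F) fun x _ =>
      (contDiffAt_areaIntegrand_variationData hF hX x).of_le (by norm_num)).self_of_nhds
  have h3 := (h2.congr_of_eventuallyEq (anisotropicArea_eventuallyEq hF hX hf hfc)).unique h1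
  rw [← h3]
  refine integral_congr_ae (Eventually.of_forall fun x => ?_)
  dsimp only
  rw [variationData, partialTime_areaIntegrand_zero (hF.contDiffOn.of_le (by norm_num))
    (normal_ne_zero hX x), map_smul, smul_eq_mul]

/-- The second variation formula for normal variations. -/
lemma setIntegral_second_variation_nonneg {F : Euc (n + 1) → ℝ} (hF : IsEllipticIntegrand F)
    (hX : IsTwoSidedImmersion X ν) (hst : IsStableFMinimal F X ν)
    (hf : ContMDiff (𝓡 n) 𝓘(ℝ, ℝ) 1 f) (hfc : HasCompactSupport f) :
    0 ≤ ∫ x in tsupport f,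
      (f x ^ 2 * (traceL _ (tangDeriv X ν x) ^ 2 -
          traceL _ (tangDeriv X ν x ∘L tangDeriv X ν x)) * F (ν x) -
        2 * f x * traceL _ (tangDeriv X ν x) * fderiv ℝ F (ν x) (hypGradient X f x) +
        2 * f x * fderiv ℝ F (ν x) (tangDeriv X ν x (hypGradient X f x)) +
        fderiv ℝ (fderiv ℝ F) (ν x) (hypGradient X f x) (hypGradient X f x)) ∂(hypVolume X) := by
  have := isLocallyFiniteMeasure_hypVolume (hX.contMDiff.of_le (by norm_num))
  obtain ⟨δ, hδ, hreg⟩ := exists_regular_interval hX hf hfc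
  have h1 := hst.2 _ _ _ _ (isCompactVariation_normalVariation hX hf hfc hδ hreg)
  rw [(anisotropicArea_eventuallyEq hF hX hf hfc).deriv.deriv_eq,
    deriv_deriv_setIntegral (μ := hypVolume X) hfc.isCompact
    (continuous_variationData hX hf) (g := areaIntegrand F) fun x _ =>
      contDiffAt_areaIntegrand_variationData hF hX x] at h1
  refine h1.trans_eq (integral_congr_ae (Eventually.of_forall fun x => ?_))
  dsimp only
  rw [variationData, partialTime_partialTime_areaIntegrand_zero
    (hF.contDiffOn.of_le (by norm_num)) (normal_ne_zero hX x)]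
  simp only [map_smul, smul_eq_mul, ContinuousLinearMap.comp_smul, ContinuousLinearMap.smul_comp,
    smul_apply]
  ring

end NormalVariation

/-! ### The gradient of an elliptic integrand -/

section Integrand

variable {m : ℕ} {F : EuclideanSpace ℝ (Fin m) → ℝ} {z : EuclideanSpace ℝ (Fin m)}

/-- The Riesz isomorphism from functionals to vectors, as a continuous linear map. -/
def rieszL (m : ℕ) : (Euc m →L[ℝ] ℝ) →L[ℝ] Euc m :=
  LinearMap.toContinuousLinearMap
    { toFun := fun φ => (InnerProductSpace.toDual ℝ (Euc m)).symm φ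
      map_add' := by intro a b; simp
      map_smul' := by intro c a; simp }

lemma inner_rieszL (φ : Euc m →L[ℝ] ℝ) (v : Euc m) : inner ℝ (rieszL m φ) v = φ v :=
  InnerProductSpace.toDual_symm_apply

/-- The gradient of the integrand. -/
def gradVec (F : EuclideanSpace ℝ (Fin m) → ℝ) (z : EuclideanSpace ℝ (Fin m)) : Euc m :=
  rieszL m (fderiv ℝ F z)

/-- The Hessian of the integrand as an endomorphism. -/
def hessOp (F : EuclideanSpace ℝ (Fin m) → ℝ) (z : EuclideanSpace ℝ (Fin m)) : Euc m →L[ℝ] Euc m :=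
  rieszL m ∘L fderiv ℝ (fderiv ℝ F) z

lemma inner_gradVec (v : Euc m) : inner ℝ (gradVec F z) v = fderiv ℝ F z v := inner_rieszL _ _

lemma inner_hessOp (v w : Euc m) : inner ℝ (hessOp F z v) w = fderiv ℝ (fderiv ℝ F) z v w :=
  inner_rieszL _ _

namespace IsEllipticIntegrand

variable (hF : IsEllipticIntegrand F)
include hF

lemma contDiffAt (hz : z ≠ 0) : ContDiffAt ℝ 3 F z :=
  hF.contDiffOn.contDiffAt (isOpen_compl_singleton.mem_nhds hz)

lemma hasFDerivAt (hz : z ≠ 0) : HasFDerivAt F (fderiv ℝ F z) z :=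
  ((hF.contDiffAt hz).differentiableAt (by simp)).hasFDerivAt

lemma hasFDerivAt_fderiv (hz : z ≠ 0) :
    HasFDerivAt (fderiv ℝ F) (fderiv ℝ (fderiv ℝ F) z) z :=
  (((hF.contDiffAt hz).fderiv_right (m := 2) (by norm_num)).differentiableAt (by simp)).hasFDerivAt

/-- Euler's identity. -/
lemma fderiv_apply_self (hz : z ≠ 0) : fderiv ℝ F z z = F z := by
  have h1 : HasDerivAt (fun t : ℝ => t • z) z 1 := by
    simpa using (hasDerivAt_id (1 : ℝ)).smul_const z
  have h2 : HasFDerivAt F (fderiv ℝ F z) ((1 : ℝ) • z) := by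
    rw [one_smul]; exact hF.hasFDerivAt hz
  have h3 := h2.comp_hasDerivAt (1 : ℝ) h1
  have h4 : HasDerivAt (fun t : ℝ => t * F z) (F z) 1 := by
    simpa using (hasDerivAt_id (1 : ℝ)).mul_const (F z)
  refine h3.unique (h4.congr_of_eventuallyEq ?_)
  filter_upwards [lt_mem_nhds (zero_lt_one (α := ℝ))] with t ht
  exact hF.homogeneous t ht z hz

lemma hasFDerivAt_gradVec (hz : z ≠ 0) : HasFDerivAt (gradVec F) (hessOp F z) z :=
  (rieszL m).hasFDerivAt.comp z (hF.hasFDerivAt_fderiv hz)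

lemma contDiffAt_gradVec (hz : z ≠ 0) : ContDiffAt ℝ 2 (gradVec F) z :=
  (rieszL m).contDiff.contDiffAt.comp z ((hF.contDiffAt hz).fderiv_right (by norm_num))

lemma continuousAt_hessOp (hz : z ≠ 0) : ContinuousAt (hessOp F) z := by
  have h1 : ContDiffAt ℝ 1 (fderiv ℝ (fderiv ℝ F)) z :=
    ((hF.contDiffAt hz).fderiv_right (m := 2) (by norm_num)).fderiv_right (by norm_num)
  exact continuousAt_const.clm_comp h1.continuousAt

end IsEllipticIntegrand

/-- The pinching constant is nonnegative in dimension at least two. -/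
lemma IsPinched.nonneg {ε : ℝ} (hε : IsPinched F ε) (hm : 2 ≤ m) : 0 ≤ ε := by
  have h01 : (⟨1, by omega⟩ : Fin m) ≠ ⟨0, by omega⟩ := by simp
  have h := hε (EuclideanSpace.single ⟨0, by omega⟩ 1) (by simp)
    (EuclideanSpace.single ⟨1, by omega⟩ 1) (by simp [EuclideanSpace.inner_single_left])
  have h1 := h.1.trans h.2
  simp at h1
  exact h1

end Integrand

/-! ### The stability inequality -/

section Stability

variable {n : ℕ} {M : Type*} [TopologicalSpace M] [ChartedSpace (EuclideanSpace ℝ (Fin n)) M]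
  [IsManifold (𝓡 n) ∞ M] {X ν : M → EuclideanSpace ℝ (Fin (n + 1))} {f : M → ℝ}
  {F : EuclideanSpace ℝ (Fin (n + 1)) → ℝ}

/-- The tangential part of the gradient of the integrand along the Gauss map. -/
def cahnHoffman (F : EuclideanSpace ℝ (Fin (n + 1)) → ℝ) (ν : M → EuclideanSpace ℝ (Fin (n + 1)))
    (x : M) : Euc (n + 1) := gradVec F (ν x) - F (ν x) • ν x

lemma contMDiff_comp_normal {W : Type*} [NormedAddCommGroup W] [NormedSpace ℝ W]
    (hX : IsTwoSidedImmersion X ν) {G : Euc (n + 1) → W}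
    (hG : ∀ x, ContDiffAt ℝ 1 G (ν x)) : ContMDiff (𝓡 n) 𝓘(ℝ, W) 1 fun x => G (ν x) := fun x =>
  ContMDiffAt.comp (g := G) x (hG x).contMDiffAt
    (hX.contMDiff_normal.contMDiffAt.of_le (by norm_num))

lemma contMDiff_gradVec_normal (hF : IsEllipticIntegrand F) (hX : IsTwoSidedImmersion X ν) :
    ContMDiff (𝓡 n) 𝓘(ℝ, Euc (n + 1)) 1 fun x => gradVec F (ν x) :=
  contMDiff_comp_normal hX fun x =>
    (hF.contDiffAt_gradVec (normal_ne_zero hX x)).of_le (by norm_num)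

lemma contMDiff_integrand_normal (hF : IsEllipticIntegrand F) (hX : IsTwoSidedImmersion X ν) :
    ContMDiff (𝓡 n) 𝓘(ℝ, ℝ) 1 fun x => F (ν x) :=
  contMDiff_comp_normal hX fun x =>
    (hF.contDiffAt (normal_ne_zero hX x)).of_le (by norm_num)

lemma contMDiff_cahnHoffman (hF : IsEllipticIntegrand F) (hX : IsTwoSidedImmersion X ν) :
    ContMDiff (𝓡 n) 𝓘(ℝ, Euc (n + 1)) 1 (cahnHoffman F ν) :=
  (contMDiff_gradVec_normal hF hX).sub ((contMDiff_integrand_normal hF hX).smul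
    (hX.contMDiff_normal.of_le (by norm_num)))

/-- By Euler's identity the normal component of `∇F(ν)` is `F(ν)`. -/
lemma inner_normal_cahnHoffman (hF : IsEllipticIntegrand F) (hX : IsTwoSidedImmersion X ν)
    (x : M) : inner ℝ (ν x) (cahnHoffman F ν x) = 0 := by
  rw [real_inner_comm, cahnHoffman, inner_sub_left, inner_gradVec,
    hF.fderiv_apply_self (normal_ne_zero hX x), inner_smul_left, real_inner_self_eq_norm_sq,
    hX.norm_normal]
  simp

lemma inner_cahnHoffman {v : Euc (n + 1)} {x : M} (hv : inner ℝ v (ν x) = 0) :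
    inner ℝ (cahnHoffman F ν x) v = fderiv ℝ F (ν x) v := by
  rw [cahnHoffman, inner_sub_left, inner_gradVec, inner_smul_left, real_inner_comm, hv]
  simp

lemma tangDeriv_cahnHoffman (hF : IsEllipticIntegrand F) (hX : IsTwoSidedImmersion X ν) (x : M) :
    tangDeriv X (cahnHoffman F ν) x = hessOp F (ν x) ∘L tangDeriv X ν x -
      (fderiv ℝ F (ν x) ∘L tangDeriv X ν x).smulRight (ν x) - F (ν x) • tangDeriv X ν x := by
  have hν := hX.mdifferentiable_normal x
  have hz := normal_ne_zero hX x
  have h1 : tangDeriv X (fun x => gradVec F (ν x)) x = hessOp F (ν x) ∘L tangDeriv X ν x := by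
    rw [tangDeriv_comp (hF.hasFDerivAt_gradVec hz).differentiableAt hν,
      (hF.hasFDerivAt_gradVec hz).fderiv]
  have h2 : tangDeriv X (fun x => F (ν x)) x = fderiv ℝ F (ν x) ∘L tangDeriv X ν x :=
    tangDeriv_comp (hF.hasFDerivAt hz).differentiableAt hν
  have hg : MDifferentiable (𝓡 n) 𝓘(ℝ, Euc (n + 1)) fun x => gradVec F (ν x) :=
    (contMDiff_gradVec_normal hF hX).mdifferentiable (by simp)
  have hf : MDifferentiable (𝓡 n) 𝓘(ℝ, ℝ) fun x => F (ν x) :=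
    (contMDiff_integrand_normal hF hX).mdifferentiable (by simp)
  have hZ : MDifferentiable (𝓡 n) 𝓘(ℝ, Euc (n + 1)) (cahnHoffman F ν) :=
    (contMDiff_cahnHoffman hF hX).mdifferentiable (by simp)
  have hs : MDifferentiable (𝓡 n) 𝓘(ℝ, Euc (n + 1)) fun x => F (ν x) • ν x :=
    ((contMDiff_integrand_normal hF hX).smul
      (hX.contMDiff_normal.of_le (by norm_num))).mdifferentiable (n := 1) (by simp)
  have h3 : tangDeriv X (fun x => cahnHoffman F ν x + F (ν x) • ν x) x =
      tangDeriv X (cahnHoffman F ν) x + tangDeriv X (fun x => F (ν x) • ν x) x :=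
    tangDeriv_add (hZ x) (hs x)
  have h4 : (fun x => cahnHoffman F ν x + F (ν x) • ν x) = fun x => gradVec F (ν x) := by
    ext1 x; simp [cahnHoffman]
  rw [h4, h1] at h3
  ext1 v
  have h5 := tangDeriv_smul (X := X) (hf x) hν v
  rw [h2] at h5
  rw [eq_sub_of_add_eq h3.symm]
  simp only [sub_apply, h5]
  simp [sub_sub]

/-- The rank one term with values in `ℝ ν` has no trace, as the shape operator kills `ν`. -/
lemma traceL_tangDeriv_cahnHoffman (hF : IsEllipticIntegrand F) (hX : IsTwoSidedImmersion X ν)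
    (x : M) : traceL _ (tangDeriv X (cahnHoffman F ν) x) =
      traceL _ (hessOp F (ν x) ∘L tangDeriv X ν x) - F (ν x) * traceL _ (tangDeriv X ν x) := by
  rw [tangDeriv_cahnHoffman hF hX, map_sub, map_sub, map_smul, traceL_smulRight,
    ContinuousLinearMap.comp_apply, hX.tangDeriv_normal_apply]
  simp

lemma traceL_tangDeriv_cahnHoffman_comp (hF : IsEllipticIntegrand F)
    (hX : IsTwoSidedImmersion X ν) (x : M) :
    traceL _ (tangDeriv X (cahnHoffman F ν) x ∘L tangDeriv X ν x) =
      traceL _ (hessOp F (ν x) ∘L (tangDeriv X ν x ∘L tangDeriv X ν x)) -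
        F (ν x) * traceL _ (tangDeriv X ν x ∘L tangDeriv X ν x) := by
  have h1 : ((fderiv ℝ F (ν x) ∘L tangDeriv X ν x).smulRight (ν x)) ∘L tangDeriv X ν x =
      ((fderiv ℝ F (ν x) ∘L tangDeriv X ν x) ∘L tangDeriv X ν x).smulRight (ν x) := rfl
  rw [tangDeriv_cahnHoffman hF hX, ContinuousLinearMap.sub_comp, ContinuousLinearMap.sub_comp,
    ContinuousLinearMap.smul_comp, h1, map_sub, map_sub, map_smul, traceL_smulRight,
    ContinuousLinearMap.comp_apply _ (tangDeriv X ν x) (ν x), hX.tangDeriv_normal_apply, map_zero,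
    ContinuousLinearMap.comp_assoc, sub_zero, smul_eq_mul]

lemma hypGradient_eq_zero_of_notMem_tsupport {x : M} (hx : x ∉ tsupport f) :
    hypGradient X f x = 0 := by
  rw [hypGradient_eq_toDual_symm, tangDeriv_eq_zero_of_notMem_tsupport hx, map_zero]

lemma tangDeriv_hypGradient_cahnHoffman (hX : IsTwoSidedImmersion X ν) (x : M) :
    tangDeriv X f x (cahnHoffman F ν x) = fderiv ℝ F (ν x) (hypGradient X f x) := by
  rw [← inner_hypGradient, real_inner_comm, inner_cahnHoffman (hX.inner_hypGradient_normal f x)]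

variable [T2Space M] [SigmaCompactSpace M] [MeasurableSpace M] [BorelSpace M]

/-- The divergence theorem for tangential fields. -/
lemma integral_divergence_eq_zero (hn : 2 ≤ n) (hX : IsTwoSidedImmersion X ν)
    {ζ : M → Euc (n + 1)} (hζ : ContMDiff (𝓡 n) 𝓘(ℝ, Euc (n + 1)) 1 ζ)
    (hζν : ∀ x, inner ℝ (ν x) (ζ x) = 0)
    (hf : ContMDiff (𝓡 n) 𝓘(ℝ, ℝ) 1 f) (hfc : HasCompactSupport f) :
    ∫ x, (tangDeriv X f x (ζ x) + f x * traceL _ (tangDeriv X ζ x)) ∂(hypVolume X) = 0 := by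
  -- With `w = X` the operator `Dw` is the tangential projection, of trace `n`, and the commutator
  -- identity becomes `1 - n` times the divergence theorem. This is where `n ≠ 1` enters.
  have h := integral_commutator hX hζ hζν (hX.contMDiff.of_le (by norm_num)) hf hfc
  have hXX : ∀ x, tangDeriv X X x = ContinuousLinearMap.id ℝ _ -
      (innerSL ℝ (ν x)).smulRight (ν x) := by
    intro x
    ext1 v
    rw [hX.tangDeriv_self]
    rfl
  have htr : ∀ x, traceL _ (tangDeriv X X x) = n := by
    intro x
    rw [hXX, map_sub, traceL_id, traceL_smulRight, innerSL_apply_apply, real_inner_self_eq_norm_sq,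
      hX.norm_normal]
    simp
  have hcomp : ∀ x, tangDeriv X ζ x ∘L tangDeriv X X x = tangDeriv X ζ x := by
    intro x
    ext1 v
    rw [ContinuousLinearMap.comp_apply, hX.tangDeriv_self, map_sub, map_smul,
      hX.tangDeriv_normal_apply, smul_zero, sub_zero]
  have hself : ∀ x v, inner ℝ (ν x) (tangDeriv X X x v) = 0 := by
    intro x v
    rw [hX.tangDeriv_self, inner_sub_right, inner_smul_right, real_inner_self_eq_norm_sq,
      hX.norm_normal]
    simp
  have hζ' : ∀ x, tangDeriv X X x (ζ x) = ζ x := by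
    intro x
    rw [hX.tangDeriv_self, hζν, zero_smul, sub_zero]
  have h2 : ∀ x, (tangDeriv X f x (tangDeriv X X x (ζ x) - traceL _ (tangDeriv X X x) • ζ x) +
      f x * (traceL _ (tangDeriv X ζ x ∘L tangDeriv X X x) -
        traceL _ (tangDeriv X ζ x) * traceL _ (tangDeriv X X x) -
        traceL _ (tangDeriv X ν x) * inner ℝ (ν x) (tangDeriv X X x (ζ x)) +
        inner ℝ (ν x) (tangDeriv X X x (tangDeriv X ν x (ζ x))))) =
      (1 - (n : ℝ)) * (tangDeriv X f x (ζ x) + f x * traceL _ (tangDeriv X ζ x)) := by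
    intro x
    rw [hcomp, hself, hself, htr, hζ', map_sub, map_smul, smul_eq_mul]
    ring
  simp only [h2] at h
  rw [integral_const_mul] at h
  have hn' : (2 : ℝ) ≤ n := by exact_mod_cast hn
  exact (mul_eq_zero.mp h).resolve_left (by linarith)

lemma continuous_hessOp_normal (hF : IsEllipticIntegrand F) (hX : IsTwoSidedImmersion X ν) :
    Continuous fun x => hessOp F (ν x) :=
  continuous_iff_continuousAt.mpr fun x => ContinuousAt.comp (g := hessOp F)
    (hF.continuousAt_hessOp (normal_ne_zero hX x)) hX.contMDiff_normal.continuous.continuousAt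

/-- The anisotropic mean curvature of an `F`-minimal hypersurface vanishes. -/
lemma ae_traceL_hessOp_eq_zero (hn : 2 ≤ n) (hF : IsEllipticIntegrand F)
    (hX : IsTwoSidedImmersion X ν) (hmin : IsFMinimal F X ν) :
    ∀ᵐ x ∂(hypVolume X), traceL _ (hessOp F (ν x) ∘L tangDeriv X ν x) = 0 := by
  have := isLocallyFiniteMeasure_hypVolume (hX.contMDiff.of_le (by norm_num))
  have hc : Continuous fun x => traceL _ (hessOp F (ν x) ∘L tangDeriv X ν x) :=
    (traceL _).continuous.comp ((continuous_hessOp_normal hF hX).clm_comp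
      (continuous_tangDeriv_normal hX))
  -- The fundamental lemma of the calculus of variations, with smooth test functions as normal
  -- velocities.
  refine ae_eq_zero_of_integral_contMDiff_smul_eq_zero (𝓡 n) hc.locallyIntegrable fun f hf hfc => ?_
  have hf1 : ContMDiff (𝓡 n) 𝓘(ℝ, ℝ) 1 f := hf.of_le (by norm_cast)
  have h1 := setIntegral_first_variation_eq_zero hF hX hmin hf1 hfc
  rw [setIntegral_eq_integral_of_forall_compl_eq_zero] at h1
  swap
  · intro x hx
    rw [hypGradient_eq_zero_of_notMem_tsupport hx, image_eq_zero_of_notMem_tsupport hx]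
    simp
  have h2 := integral_divergence_eq_zero hn hX (contMDiff_cahnHoffman hF hX)
    (inner_normal_cahnHoffman hF hX) hf1 hfc
  have hZ := contMDiff_cahnHoffman hF hX
  have hint2 : Integrable (fun x => tangDeriv X f x (cahnHoffman F ν x) +
      f x * traceL _ (tangDeriv X (cahnHoffman F ν) x)) (hypVolume X) :=
    integrable_hypVolume_of_continuous (hX.contMDiff.of_le (by norm_num))
      (continuous_tangDeriv_add_mul hX hf1 hZ.continuous
        ((traceL _).continuous.comp (continuous_tangDeriv hX hZ)))
      (hasCompactSupport_tangDeriv_add_mul hfc _ _)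
  have hcont : Continuous fun x => f x • traceL _ (hessOp F (ν x) ∘L tangDeriv X ν x) :=
    hf.continuous.smul hc
  have hint : Integrable (fun x => f x • traceL _ (hessOp F (ν x) ∘L tangDeriv X ν x))
      (hypVolume X) :=
    integrable_hypVolume_of_continuous (hX.contMDiff.of_le (by norm_num)) hcont
      hfc.smul_right
  -- With `Z` the Cahn-Hoffman field, `div Z = tr (Q S) - F(ν) H`, so the first variation integrand
  -- is `f tr (Q S)` minus the divergence of `f Z`.
  have heq : ∀ x, f x * traceL _ (tangDeriv X ν x) * F (ν x) -
      fderiv ℝ F (ν x) (hypGradient X f x) =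
      f x • traceL _ (hessOp F (ν x) ∘L tangDeriv X ν x) -
      (tangDeriv X f x (cahnHoffman F ν x) +
        f x * traceL _ (tangDeriv X (cahnHoffman F ν) x)) := by
    intro x
    rw [tangDeriv_hypGradient_cahnHoffman hX, traceL_tangDeriv_cahnHoffman hF hX, smul_eq_mul]
    ring
  simp only [heq] at h1
  rw [integral_sub hint hint2, h2, sub_zero] at h1
  exact h1

lemma integrable_of_continuous_of_tsupport (hX : IsTwoSidedImmersion X ν)
    (hfc : HasCompactSupport f) {h : M → ℝ} (hh : Continuous h) (h0 : ∀ x ∉ tsupport f, h x = 0) :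
    Integrable h (hypVolume X) :=
  integrable_hypVolume_of_continuous (hX.contMDiff.of_le (by norm_num)) hh
    (hfc.of_isClosed_subset (isClosed_tsupport _) (closure_minimal (fun x hx => by
      by_contra hxf; exact hx (h0 x hxf)) (isClosed_tsupport _)))

lemma integrable_second_variation (hF : IsEllipticIntegrand F) (hX : IsTwoSidedImmersion X ν)
    (hf : ContMDiff (𝓡 n) 𝓘(ℝ, ℝ) 1 f) (hfc : HasCompactSupport f) :
    Integrable (fun x => fderiv ℝ (fderiv ℝ F) (ν x) (hypGradient X f x)
      (hypGradient X f x) -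
      f x ^ 2 * traceL _ (hessOp F (ν x) ∘L (tangDeriv X ν x ∘L tangDeriv X ν x)) +
      f x ^ 2 * traceL _ (tangDeriv X ν x) *
        traceL _ (hessOp F (ν x) ∘L tangDeriv X ν x)) (hypVolume X) := by
  have cA := continuous_tangDeriv_normal hX
  have ct := (traceL (Euc (n + 1))).continuous
  have cQ := continuous_hessOp_normal hF hX
  have cg := continuous_hypGradient hX hf
  have c3 : Continuous fun x => fderiv ℝ (fderiv ℝ F) (ν x) (hypGradient X f x)
      (hypGradient X f x) := by
    simp only [← inner_hessOp]
    exact (cQ.clm_apply cg).inner cg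
  refine integrable_of_continuous_of_tsupport hX hfc ?_ fun x hx => ?_
  · exact (c3.sub ((hf.continuous.pow 2).mul (ct.comp (cQ.clm_comp (cA.clm_comp cA))))).add
      (((hf.continuous.pow 2).mul (ct.comp cA)).mul (ct.comp (cQ.clm_comp cA)))
  · rw [hypGradient_eq_zero_of_notMem_tsupport hx, image_eq_zero_of_notMem_tsupport hx]
    simp

/-- The raw second variation still contains `F` and `DF`. They are removed by subtracting the
commutator identity for `ζ = Z` (the Cahn-Hoffman field), `w = ν` and `ψ = f²`, which leaves only
terms in `D²F`. -/
lemma second_variation_nonneg (hF : IsEllipticIntegrand F)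
    (hX : IsTwoSidedImmersion X ν) (hst : IsStableFMinimal F X ν)
    (hf : ContMDiff (𝓡 n) 𝓘(ℝ, ℝ) 1 f) (hfc : HasCompactSupport f) :
    0 ≤ ∫ x, (fderiv ℝ (fderiv ℝ F) (ν x) (hypGradient X f x) (hypGradient X f x) -
      f x ^ 2 * traceL _ (hessOp F (ν x) ∘L (tangDeriv X ν x ∘L tangDeriv X ν x)) +
      f x ^ 2 * traceL _ (tangDeriv X ν x) *
        traceL _ (hessOp F (ν x) ∘L tangDeriv X ν x)) ∂(hypVolume X) := by
  have h1 := setIntegral_second_variation_nonneg hF hX hst hf hfc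
  rw [setIntegral_eq_integral_of_forall_compl_eq_zero] at h1
  swap
  · intro x hx
    rw [hypGradient_eq_zero_of_notMem_tsupport hx, image_eq_zero_of_notMem_tsupport hx]
    simp
  have hZ := contMDiff_cahnHoffman hF hX
  have hν1 : ContMDiff (𝓡 n) 𝓘(ℝ, Euc (n + 1)) 1 ν := hX.contMDiff_normal.of_le (by norm_num)
  have hff : ContMDiff (𝓡 n) 𝓘(ℝ, ℝ) 1 fun x => f x * f x := hf.mul hf
  have hffc : HasCompactSupport fun x => f x * f x := hfc.mul_left
  have h2 := integral_commutator hX hZ (inner_normal_cahnHoffman hF hX) hν1 hff hffc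
  have hfd : MDifferentiable (𝓡 n) 𝓘(ℝ, ℝ) f := hf.mdifferentiable (by simp)
  have cA := continuous_tangDeriv_normal hX
  have ct := (traceL (Euc (n + 1))).continuous
  have hint := integrable_second_variation hF hX hf hfc
  have key : ∀ x, (f x ^ 2 * (traceL _ (tangDeriv X ν x) ^ 2 -
          traceL _ (tangDeriv X ν x ∘L tangDeriv X ν x)) * F (ν x) -
        2 * f x * traceL _ (tangDeriv X ν x) * fderiv ℝ F (ν x) (hypGradient X f x) +
        2 * f x * fderiv ℝ F (ν x) (tangDeriv X ν x (hypGradient X f x)) +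
        fderiv ℝ (fderiv ℝ F) (ν x) (hypGradient X f x) (hypGradient X f x)) =
      (fderiv ℝ (fderiv ℝ F) (ν x) (hypGradient X f x) (hypGradient X f x) -
        f x ^ 2 * traceL _ (hessOp F (ν x) ∘L (tangDeriv X ν x ∘L tangDeriv X ν x)) +
        f x ^ 2 * traceL _ (tangDeriv X ν x) *
          traceL _ (hessOp F (ν x) ∘L tangDeriv X ν x)) +
      (tangDeriv X (fun x => f x * f x) x (tangDeriv X ν x (cahnHoffman F ν x) -
          traceL _ (tangDeriv X ν x) • cahnHoffman F ν x) +
        f x * f x * (traceL _ (tangDeriv X (cahnHoffman F ν) x ∘L tangDeriv X ν x) -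
          traceL _ (tangDeriv X (cahnHoffman F ν) x) * traceL _ (tangDeriv X ν x) -
          traceL _ (tangDeriv X ν x) * inner ℝ (ν x) (tangDeriv X ν x (cahnHoffman F ν x)) +
          inner ℝ (ν x) (tangDeriv X ν x (tangDeriv X ν x (cahnHoffman F ν x))))) := by
    intro x
    have e1 : tangDeriv X f x (tangDeriv X ν x (cahnHoffman F ν x)) =
        fderiv ℝ F (ν x) (tangDeriv X ν x (hypGradient X f x)) := by
      rw [← inner_hypGradient, ← hX.inner_tangDeriv_normal_comm, real_inner_comm,
        inner_cahnHoffman (hX.inner_tangDeriv_normal x _)]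
    have e2 := tangDeriv_hypGradient_cahnHoffman (f := f) (F := F) hX x
    have e3 : ∀ v, inner ℝ (ν x) (tangDeriv X ν x v) = 0 := fun v => by
      rw [real_inner_comm, hX.inner_tangDeriv_normal]
    rw [traceL_tangDeriv_cahnHoffman_comp hF hX, traceL_tangDeriv_cahnHoffman hF hX, e3, e3,
      tangDeriv_mul (hfd x) (hfd x), map_sub, map_smul, e1, e2, smul_eq_mul]
    ring
  have cZ := continuous_tangDeriv hX hZ
  have hint2 := integrable_hypVolume_of_continuous (hX.contMDiff.of_le (by norm_num))
    (continuous_tangDeriv_add_mul hX hff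
      (a := fun x => tangDeriv X ν x (cahnHoffman F ν x) -
          traceL _ (tangDeriv X ν x) • cahnHoffman F ν x)
      (R := fun x => traceL _ (tangDeriv X (cahnHoffman F ν) x ∘L tangDeriv X ν x) -
          traceL _ (tangDeriv X (cahnHoffman F ν) x) * traceL _ (tangDeriv X ν x) -
          traceL _ (tangDeriv X ν x) * inner ℝ (ν x) (tangDeriv X ν x (cahnHoffman F ν x)) +
          inner ℝ (ν x) (tangDeriv X ν x (tangDeriv X ν x (cahnHoffman F ν x))))
      ((cA.clm_apply hZ.continuous).sub ((ct.comp cA).smul hZ.continuous))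
      ((((ct.comp (cZ.clm_comp cA)).sub ((ct.comp cZ).mul (ct.comp cA))).sub
      ((ct.comp cA).mul (hν1.continuous.inner (cA.clm_apply hZ.continuous)))).add
      (hν1.continuous.inner (cA.clm_apply (cA.clm_apply hZ.continuous)))))
      (hasCompactSupport_tangDeriv_add_mul hffc _ _)
  simp only [key] at h1
  rw [integral_add hint hint2, h2, add_zero] at h1
  exact h1

/-- The stability inequality for a pinched integrand. -/
theorem integral_sq_mul_secondFormNormSq_le (hn : 2 ≤ n) (hF : IsEllipticIntegrand F) {ε : ℝ}
    (hε : IsPinched F ε) (hX : IsTwoSidedImmersion X ν) (hst : IsStableFMinimal F X ν)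
    (hf : ContMDiff (𝓡 n) 𝓘(ℝ, ℝ) 1 f) (hfc : HasCompactSupport f) :
    ∫ x, f x ^ 2 * traceL _ (tangDeriv X ν x ∘L tangDeriv X ν x) ∂(hypVolume X) ≤
      (1 + ε) * ∫ x, ‖hypGradient X f x‖ ^ 2 ∂(hypVolume X) := by
  have h1 := second_variation_nonneg hF hX hst hf hfc
  have cA := continuous_tangDeriv_normal hX
  have ct := (traceL (Euc (n + 1))).continuous
  have cg := continuous_hypGradient hX hf
  have hint1 : Integrable (fun x => f x ^ 2 * traceL _ (tangDeriv X ν x ∘L tangDeriv X ν x))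
      (hypVolume X) := integrable_of_continuous_of_tsupport hX hfc
    ((hf.continuous.pow 2).mul (ct.comp (cA.clm_comp cA))) fun x hx => by
      rw [image_eq_zero_of_notMem_tsupport hx]; simp
  have hint2 : Integrable (fun x => ‖hypGradient X f x‖ ^ 2) (hypVolume X) :=
    integrable_of_continuous_of_tsupport hX hfc (cg.norm.pow 2) fun x hx => by
      rw [hypGradient_eq_zero_of_notMem_tsupport hx]; simp
  rw [← integral_const_mul, ← sub_nonneg, ← integral_sub (hint2.const_mul _) hint1]
  have h2 := ae_traceL_hessOp_eq_zero hn hF hX hst.1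
  have hint := integrable_second_variation hF hX hf hfc
  refine h1.trans (integral_mono_ae hint ((hint2.const_mul _).sub hint1) ?_)
  filter_upwards [h2] with x hx
  have h3 := (hε (ν x) (hX.norm_normal x) _ (hX.inner_hypGradient_normal f x)).2
  -- The lower pinching bound serves the curvature term, the upper one (`h3`) the gradient term; the
  -- remaining term `f² H tr (Q S)` vanishes by minimality.
  have h4 := traceL_sq_le_of_pinched (n := n) (by simp) (Q := hessOp F (ν x))
    (hX.inner_tangDeriv_normal_comm x) (hX.tangDeriv_normal_apply ν x) (hX.norm_normal x)
    fun ξ hξ => by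
      rw [real_inner_comm, inner_hessOp]
      exact (hε (ν x) (hX.norm_normal x) ξ hξ).1
  have h5 := mul_le_mul_of_nonneg_left h4 (sq_nonneg (f x))
  simp only [hx, mul_zero, add_zero]
  linarith

end Stability

/-! ### Harmonic functions -/

section Harmonic

variable {n : ℕ} {M : Type*} [TopologicalSpace M] [ChartedSpace (EuclideanSpace ℝ (Fin n)) M]
  [IsManifold (𝓡 n) ∞ M] {X ν : M → EuclideanSpace ℝ (Fin (n + 1))} {u : M → ℝ}

lemma contMDiff_hypGradient (hX : IsTwoSidedImmersion X ν)
    (hu : ContMDiff (𝓡 n) 𝓘(ℝ, ℝ) 2 u) :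
    ContMDiff (𝓡 n) 𝓘(ℝ, Euc (n + 1)) 1 (hypGradient X u) :=
  (rieszL (n + 1)).contMDiff.comp (ContMDiff.tangDeriv (m := 1) (by norm_cast)
    (hX.contMDiff.of_le (by norm_num)) hX.injective (hu.of_le (by norm_num)))

lemma mdifferentiable_hypGradient (hX : IsTwoSidedImmersion X ν)
    (hu : ContMDiff (𝓡 n) 𝓘(ℝ, ℝ) 2 u) :
    MDifferentiable (𝓡 n) 𝓘(ℝ, Euc (n + 1)) (hypGradient X u) :=
  (contMDiff_hypGradient hX hu).mdifferentiable (by simp)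

lemma inner_tangDeriv_hypGradient_comm (hX : IsTwoSidedImmersion X ν)
    (hu : ContMDiff (𝓡 n) 𝓘(ℝ, ℝ) 2 u) (x : M) {a b : Euc (n + 1)} (ha : inner ℝ a (ν x) = 0)
    (hb : inner ℝ b (ν x) = 0) :
    inner ℝ (tangDeriv X (hypGradient X u) x a) b =
      inner ℝ (tangDeriv X (hypGradient X u) x b) a :=
  hX.inner_tangDeriv_comm_of_exact' (contMDiff_hypGradient hX hu) hu
    (fun x w => by rw [hX.inner_hypGradient_normal, zero_mul, sub_zero, inner_hypGradient]) x ha hb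

/-- The Hessian of `u`, extended by zero to the normal direction. -/
def hypHessian (X ν : M → EuclideanSpace ℝ (Fin (n + 1))) (u : M → ℝ) (x : M) :
    Euc (n + 1) →L[ℝ] Euc (n + 1) :=
  tangDeriv X (hypGradient X u) x -
    (innerSL ℝ (ν x) ∘L tangDeriv X (hypGradient X u) x).smulRight (ν x)

lemma hypHessian_apply (x : M) (a : Euc (n + 1)) :
    hypHessian X ν u x a = tangDeriv X (hypGradient X u) x a -
      (inner ℝ (ν x) (tangDeriv X (hypGradient X u) x a) : ℝ) • ν x := rfl

lemma hypHessian_normal (hX : IsTwoSidedImmersion X ν) (x : M) :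
    hypHessian X ν u x (ν x) = 0 := by
  rw [hypHessian_apply, hX.tangDeriv_normal_apply]; simp

lemma inner_hypHessian_normal (hX : IsTwoSidedImmersion X ν) (x : M) (a : Euc (n + 1)) :
    inner ℝ (hypHessian X ν u x a) (ν x) = 0 := by
  rw [hypHessian_apply, inner_sub_left, inner_smul_left, real_inner_self_eq_norm_sq,
    hX.norm_normal, real_inner_comm]
  simp

lemma inner_hypHessian_of_tangent {x : M} (a : Euc (n + 1)) {b : Euc (n + 1)}
    (hb : inner ℝ b (ν x) = 0) :
    inner ℝ (hypHessian X ν u x a) b = inner ℝ (tangDeriv X (hypGradient X u) x a) b := by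
  rw [hypHessian_apply, inner_sub_left, inner_smul_left, real_inner_comm b (ν x), hb]
  simp

lemma inner_tangentPart_normal (hX : IsTwoSidedImmersion X ν) (x : M) (a : Euc (n + 1)) :
    inner ℝ (a - (inner ℝ (ν x) a : ℝ) • ν x) (ν x) = 0 := by
  rw [inner_sub_left, inner_smul_left, real_inner_self_eq_norm_sq, hX.norm_normal, real_inner_comm]
  simp

lemma inner_hypHessian_comm (hX : IsTwoSidedImmersion X ν)
    (hu : ContMDiff (𝓡 n) 𝓘(ℝ, ℝ) 2 u) (x : M) (a b : Euc (n + 1)) :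
    inner ℝ (hypHessian X ν u x a) b = inner ℝ a (hypHessian X ν u x b) := by
  have h1 : ∀ a b : Euc (n + 1), inner ℝ (hypHessian X ν u x a) b =
      inner ℝ (tangDeriv X (hypGradient X u) x (a - (inner ℝ (ν x) a : ℝ) • ν x))
        (b - (inner ℝ (ν x) b : ℝ) • ν x) := by
    intro a b
    rw [map_sub, map_smul, hX.tangDeriv_normal_apply, smul_zero, sub_zero,
      ← inner_hypHessian_of_tangent (ν := ν) a (inner_tangentPart_normal hX x b), inner_sub_right,
      inner_smul_right, inner_hypHessian_normal hX, mul_zero, sub_zero]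
  rw [h1, real_inner_comm, real_inner_comm _ a, h1, real_inner_comm,
    inner_tangDeriv_hypGradient_comm hX hu x (inner_tangentPart_normal hX x a)
      (inner_tangentPart_normal hX x b)]

lemma traceL_hypHessian (hX : IsTwoSidedImmersion X ν) (x : M) :
    traceL _ (hypHessian X ν u x) = traceL _ (tangDeriv X (hypGradient X u) x) := by
  rw [hypHessian, map_sub, traceL_smulRight, ContinuousLinearMap.comp_apply,
    hX.tangDeriv_normal_apply, map_zero, sub_zero]

/-- The ambient derivative of `∇u` also has a normal component, but since it kills `ν` that
component does not affect the trace of the square. -/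
lemma traceL_hypHessian_comp_self (hX : IsTwoSidedImmersion X ν) (x : M) :
    traceL _ (hypHessian X ν u x ∘L hypHessian X ν u x) =
      traceL _ (tangDeriv X (hypGradient X u) x ∘L tangDeriv X (hypGradient X u) x) := by
  set D := tangDeriv X (hypGradient X u) x with hD
  have hDν : D (ν x) = 0 := hX.tangDeriv_normal_apply _ x
  have h1 : hypHessian X ν u x ∘L hypHessian X ν u x =
      D ∘L D - ((innerSL ℝ (ν x) ∘L D) ∘L D).smulRight (ν x) := by
    ext1 a
    simp only [ContinuousLinearMap.comp_apply, hypHessian_apply, map_sub, map_smul, ← hD, hDν,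
      sub_apply, ContinuousLinearMap.smulRight_apply, innerSL_apply_apply]
    simp
  rw [h1, map_sub, traceL_smulRight, ContinuousLinearMap.comp_apply, hDν, map_zero, sub_zero]

lemma IsHarmonicOn.traceL_eq_zero (hu : IsHarmonicOn X u) (x : M) :
    traceL _ (tangDeriv X (hypGradient X u) x) = 0 := by
  rw [← hypDivergence_eq_traceL]
  exact hu.laplacian_eq_zero x

/-- The refined Kato inequality for harmonic functions. -/
lemma norm_hypHessian_apply_sq_le (hn : 2 ≤ n) (hX : IsTwoSidedImmersion X ν)
    (hu : IsHarmonicOn X u) (x : M) (e : Euc (n + 1)) :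
    n * ‖hypHessian X ν u x e‖ ^ 2 ≤ (n - 1) * traceL _ (tangDeriv X (hypGradient X u) x ∘L
      tangDeriv X (hypGradient X u) x) * ‖e‖ ^ 2 := by
  rw [← traceL_hypHessian_comp_self hX]
  exact norm_apply_sq_le_of_traceless (by omega) (by simp)
    (inner_hypHessian_comm hX hu.contMDiff x) (hypHessian_normal hX x) (hX.norm_normal x)
    (by rw [traceL_hypHessian hX, hu.traceL_eq_zero]) e

/-- Differentiate `⟨∇u, ν⟩ = 0`. This turns the normal terms of the commutator identity into
curvature. -/
lemma inner_normal_tangDeriv_hypGradient (hX : IsTwoSidedImmersion X ν)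
    (hu : ContMDiff (𝓡 n) 𝓘(ℝ, ℝ) 2 u) (x : M) (a : Euc (n + 1)) :
    inner ℝ (ν x) (tangDeriv X (hypGradient X u) x a) =
      -inner ℝ (tangDeriv X ν x a) (hypGradient X u x) := by
  have h := tangDeriv_inner (X := X) (mdifferentiable_hypGradient hX hu x)
    (hX.mdifferentiable_normal x) a
  have h1 : (fun x => inner ℝ (hypGradient X u x) (ν x)) = fun _ : M => (0 : ℝ) := by
    ext x; exact hX.inner_hypGradient_normal u x
  rw [h1, tangDeriv_const, zero_apply, real_inner_comm, real_inner_comm (tangDeriv X ν x a)] at h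
  linarith

lemma tangDeriv_sqrt_norm_sq_add (hX : IsTwoSidedImmersion X ν)
    (hu : ContMDiff (𝓡 n) 𝓘(ℝ, ℝ) 2 u) {δ : ℝ} {x : M}
    (hpos : 0 < ‖hypGradient X u x‖ ^ 2 + δ) (a : Euc (n + 1)) :
    tangDeriv X (fun x => Real.sqrt (‖hypGradient X u x‖ ^ 2 + δ)) x a =
      inner ℝ (hypHessian X ν u x (hypGradient X u x)) a /
        Real.sqrt (‖hypGradient X u x‖ ^ 2 + δ) := by
  have hv := mdifferentiable_hypGradient hX hu
  have hvC := contMDiff_hypGradient hX hu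
  have hi : ContMDiff (𝓡 n) 𝓘(ℝ, ℝ) 1
      fun x => (innerSL ℝ (hypGradient X u x)) (hypGradient X u x) :=
    ((innerSL ℝ).contMDiff.comp hvC).clm_apply hvC
  have hid : MDifferentiable (𝓡 n) 𝓘(ℝ, ℝ)
      fun x => inner ℝ (hypGradient X u x) (hypGradient X u x) := hi.mdifferentiable (by simp)
  have hc : MDifferentiable (𝓡 n) 𝓘(ℝ, ℝ) (fun _ : M => δ) := mdifferentiable_const
  simp only [← real_inner_self_eq_norm_sq] at hpos ⊢
  have h1 := (Real.hasDerivAt_sqrt hpos.ne').hasFDerivAt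
  have h2 := tangDeriv_comp (X := X) (Y := fun x => inner ℝ (hypGradient X u x)
    (hypGradient X u x) + δ) (x := x) h1.differentiableAt ((hid x).add (hc x))
  have h3 : inner ℝ (tangDeriv X (hypGradient X u) x a) (hypGradient X u x) =
      inner ℝ (hypHessian X ν u x (hypGradient X u x)) a := by
    rw [← inner_hypHessian_of_tangent (ν := ν) a (hX.inner_hypGradient_normal u x),
      inner_hypHessian_comm hX hu, real_inner_comm]
  rw [h2, ContinuousLinearMap.comp_apply, tangDeriv_add (hid x) (hc x), tangDeriv_const, add_zero,
    tangDeriv_inner (hv x) (hv x), h1.fderiv,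
    real_inner_comm (tangDeriv X (hypGradient X u) x a) (hypGradient X u x), h3]
  simp
  field_simp
  ring

/-- A zero of a nonnegative function is a minimum; if the function is not differentiable there, the
differential is zero by convention. -/
lemma mdiff_eq_zero_of_nonneg {g : M → ℝ} (hg : ∀ x, 0 ≤ g x) {x : M} (hx : g x = 0) :
    mdiff (n := n) g x = 0 := by
  by_cases hd : MDifferentiableAt (𝓡 n) 𝓘(ℝ, ℝ) g x
  · obtain ⟨e, he, y, hy, rfl⟩ := exists_chart_symm_eq (n := n) x
    have h1 := hasFDerivAt_comp_chart_symm he hy hd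
    have hmin : IsLocalMin (g ∘ e.symm) y :=
      Eventually.of_forall fun z => by
        change g (e.symm y) ≤ g (e.symm z)
        rw [hx]; exact hg _
    have h2 := hmin.hasFDerivAt_eq_zero h1
    ext1 v
    obtain ⟨w, rfl⟩ := (chartSymmDeriv he hy).surjective v
    exact congrArg (fun l => l w) h2
  · exact mfderiv_zero_of_not_mdifferentiableAt hd

/-- At zeros of `∇u` the left side vanishes by `mdiff_eq_zero_of_nonneg` and the right side by
division by zero; elsewhere `∇|∇u| = D²u(∇u) / |∇u|`. -/
lemma norm_hypGradient_norm_sq (hX : IsTwoSidedImmersion X ν)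
    (hu : ContMDiff (𝓡 n) 𝓘(ℝ, ℝ) 2 u) (x : M) :
    ‖hypGradient X (fun y => ‖hypGradient X u y‖) x‖ ^ 2 =
      ‖hypHessian X ν u x (hypGradient X u x)‖ ^ 2 / ‖hypGradient X u x‖ ^ 2 := by
  by_cases hx : ‖hypGradient X u x‖ = 0
  · have h1 : tangDeriv X (fun y => ‖hypGradient X u y‖) x = 0 := by
      unfold tangDeriv
      rw [mdiff_eq_zero_of_nonneg (fun y => norm_nonneg _) hx, ContinuousLinearMap.zero_comp]
    rw [hypGradient_eq_toDual_symm _ x, h1, hx, map_zero]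
    simp
  · have h0 : 0 < ‖hypGradient X u x‖ := lt_of_le_of_ne (norm_nonneg _) (Ne.symm hx)
    have h1 : (fun y => ‖hypGradient X u y‖) =
        fun y => Real.sqrt (‖hypGradient X u y‖ ^ 2 + 0) := by
      ext y; rw [add_zero, Real.sqrt_sq (norm_nonneg _)]
    have h2 : hypGradient X (fun y => ‖hypGradient X u y‖) x =
        ‖hypGradient X u x‖⁻¹ • hypHessian X ν u x (hypGradient X u x) := by
      refine ext_inner_right ℝ fun a => ?_
      rw [inner_hypGradient, h1, tangDeriv_sqrt_norm_sq_add hX hu (by positivity), add_zero,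
        Real.sqrt_sq (norm_nonneg _), inner_smul_left]
      simp [div_eq_inv_mul]
    rw [h2, norm_smul, norm_inv, norm_norm, mul_pow, inv_pow, div_eq_inv_mul]

lemma contMDiff_sqrt_norm_sq_add (hX : IsTwoSidedImmersion X ν)
    (hu : ContMDiff (𝓡 n) 𝓘(ℝ, ℝ) 2 u) {δ : ℝ} (hδ : 0 < δ) :
    ContMDiff (𝓡 n) 𝓘(ℝ, ℝ) 1 fun x => Real.sqrt (‖hypGradient X u x‖ ^ 2 + δ) := by
  have h : ContDiff ℝ 1 fun w : Euc (n + 1) => Real.sqrt (‖w‖ ^ 2 + δ) :=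
    ((contDiff_norm_sq ℝ).add contDiff_const).sqrt fun w => by positivity
  exact h.contMDiff.comp (contMDiff_hypGradient hX hu)

lemma hypGradient_mul_sqrt (hX : IsTwoSidedImmersion X ν)
    (hu : ContMDiff (𝓡 n) 𝓘(ℝ, ℝ) 2 u) {φ : M → ℝ} (hφ : ContMDiff (𝓡 n) 𝓘(ℝ, ℝ) 1 φ) {δ : ℝ}
    (hδ : 0 < δ) (x : M) :
    hypGradient X (fun x => φ x * Real.sqrt (‖hypGradient X u x‖ ^ 2 + δ)) x =
      Real.sqrt (‖hypGradient X u x‖ ^ 2 + δ) • hypGradient X φ x +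
        (φ x / Real.sqrt (‖hypGradient X u x‖ ^ 2 + δ)) •
          hypHessian X ν u x (hypGradient X u x) := by
  have hpos : 0 < ‖hypGradient X u x‖ ^ 2 + δ := by positivity
  refine ext_inner_right ℝ fun a => ?_
  rw [inner_hypGradient, tangDeriv_mul ((hφ.mdifferentiable (by simp)) x)
    (((contMDiff_sqrt_norm_sq_add hX hu hδ).mdifferentiable (by simp)) x),
    tangDeriv_sqrt_norm_sq_add hX hu hpos, inner_add_left, inner_smul_left, inner_smul_left,
    inner_hypGradient]
  simp
  ring

/-- In the cross term the square roots cancel, so it does not depend on `δ` and matches the cross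
term of `bochnerIntegrand` exactly. -/
lemma norm_hypGradient_mul_sqrt_sq (hX : IsTwoSidedImmersion X ν)
    (hu : ContMDiff (𝓡 n) 𝓘(ℝ, ℝ) 2 u) {φ : M → ℝ} (hφ : ContMDiff (𝓡 n) 𝓘(ℝ, ℝ) 1 φ) {δ : ℝ}
    (hδ : 0 < δ) (x : M) :
    ‖hypGradient X (fun x => φ x * Real.sqrt (‖hypGradient X u x‖ ^ 2 + δ)) x‖ ^ 2 =
      (‖hypGradient X u x‖ ^ 2 + δ) * ‖hypGradient X φ x‖ ^ 2 +
        2 * φ x * inner ℝ (hypGradient X φ x) (hypHessian X ν u x (hypGradient X u x)) +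
        φ x ^ 2 * (‖hypHessian X ν u x (hypGradient X u x)‖ ^ 2 /
          (‖hypGradient X u x‖ ^ 2 + δ)) := by
  have hpos : 0 < ‖hypGradient X u x‖ ^ 2 + δ := by positivity
  have hs := Real.sqrt_pos.mpr hpos
  have hsq := Real.sq_sqrt hpos.le
  rw [hypGradient_mul_sqrt hX hu hφ hδ, norm_add_sq_real, norm_smul, norm_smul, inner_smul_left,
    inner_smul_right, mul_pow, mul_pow, Real.norm_eq_abs, Real.norm_eq_abs, sq_abs, sq_abs, div_pow,
    hsq]
  simp only [conj_trivial]
  field_simp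

variable [T2Space M] [SigmaCompactSpace M] [MeasurableSpace M] [BorelSpace M]

/-- The integrand of the Bochner identity for the harmonic function `u`, tested with `φ²`. -/
def bochnerIntegrand (X ν : M → EuclideanSpace ℝ (Fin (n + 1))) (u φ : M → ℝ) (x : M) : ℝ :=
  2 * φ x * inner ℝ (hypGradient X φ x) (hypHessian X ν u x (hypGradient X u x)) +
    φ x ^ 2 * (traceL _ (tangDeriv X (hypGradient X u) x ∘L tangDeriv X (hypGradient X u) x) +
      traceL _ (tangDeriv X ν x) *
        inner ℝ (tangDeriv X ν x (hypGradient X u x)) (hypGradient X u x) -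
      ‖tangDeriv X ν x (hypGradient X u x)‖ ^ 2)

/-- The Bochner identity in integrated form. -/
lemma integral_bochnerIntegrand (hX : IsTwoSidedImmersion X ν) (hu : IsHarmonicOn X u)
    {φ : M → ℝ} (hφ : ContMDiff (𝓡 n) 𝓘(ℝ, ℝ) 1 φ) (hφc : HasCompactSupport φ) :
    Integrable (bochnerIntegrand X ν u φ) (hypVolume X) ∧
      ∫ x, bochnerIntegrand X ν u φ x ∂(hypVolume X) = 0 := by
  have hv := contMDiff_hypGradient hX hu.contMDiff
  have hvν : ∀ x, inner ℝ (ν x) (hypGradient X u x) = 0 := fun x => by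
    rw [real_inner_comm, hX.inner_hypGradient_normal]
  have hφφ : ContMDiff (𝓡 n) 𝓘(ℝ, ℝ) 1 fun x => φ x * φ x := hφ.mul hφ
  have hφφc : HasCompactSupport fun x => φ x * φ x := hφc.mul_left
  have hφd : MDifferentiable (𝓡 n) 𝓘(ℝ, ℝ) φ := hφ.mdifferentiable (by simp)
  have cA := continuous_tangDeriv_normal hX
  have ct := (traceL (Euc (n + 1))).continuous
  have cD := continuous_tangDeriv hX hv
  have cν := hX.contMDiff_normal.continuous
  -- The choice `ζ = w = ∇u`, `ψ = φ²`: the divergence terms vanish by harmonicity, and the normal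
  -- terms give `H ⟨S v, v⟩ - |S v|²`, the Ricci curvature in the Gauss equation.
  have h := integral_commutator hX hv hvν hv hφφ hφφc
  have hint := integrable_hypVolume_of_continuous (hX.contMDiff.of_le (by norm_num))
    (continuous_tangDeriv_add_mul hX hφφ
      (a := fun x => tangDeriv X (hypGradient X u) x (hypGradient X u x) -
          traceL _ (tangDeriv X (hypGradient X u) x) • hypGradient X u x)
      (R := fun x => traceL _ (tangDeriv X (hypGradient X u) x ∘L tangDeriv X (hypGradient X u) x) -
          traceL _ (tangDeriv X (hypGradient X u) x) * traceL _ (tangDeriv X (hypGradient X u) x) -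
          traceL _ (tangDeriv X ν x) *
            inner ℝ (ν x) (tangDeriv X (hypGradient X u) x (hypGradient X u x)) +
          inner ℝ (ν x) (tangDeriv X (hypGradient X u) x (tangDeriv X ν x (hypGradient X u x))))
      ((cD.clm_apply hv.continuous).sub ((ct.comp cD).smul hv.continuous))
      ((((ct.comp (cD.clm_comp cD)).sub ((ct.comp cD).mul (ct.comp cD))).sub
      ((ct.comp cA).mul (cν.inner (cD.clm_apply hv.continuous)))).add
      (cν.inner (cD.clm_apply (cA.clm_apply hv.continuous)))))
      (hasCompactSupport_tangDeriv_add_mul hφφc _ _)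
  have key : ∀ x, tangDeriv X (fun x => φ x * φ x) x
        (tangDeriv X (hypGradient X u) x (hypGradient X u x) -
          traceL _ (tangDeriv X (hypGradient X u) x) • hypGradient X u x) +
      φ x * φ x * (traceL _ (tangDeriv X (hypGradient X u) x ∘L tangDeriv X (hypGradient X u) x) -
          traceL _ (tangDeriv X (hypGradient X u) x) * traceL _ (tangDeriv X (hypGradient X u) x) -
          traceL _ (tangDeriv X ν x) *
            inner ℝ (ν x) (tangDeriv X (hypGradient X u) x (hypGradient X u x)) +
          inner ℝ (ν x) (tangDeriv X (hypGradient X u) x (tangDeriv X ν x (hypGradient X u x)))) =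
      bochnerIntegrand X ν u φ x := by
    intro x
    have e1 : tangDeriv X φ x (tangDeriv X (hypGradient X u) x (hypGradient X u x)) =
        inner ℝ (hypGradient X φ x) (hypHessian X ν u x (hypGradient X u x)) := by
      rw [real_inner_comm, inner_hypHessian_of_tangent _ (hX.inner_hypGradient_normal φ x),
        real_inner_comm, inner_hypGradient]
    rw [hu.traceL_eq_zero, inner_normal_tangDeriv_hypGradient hX hu.contMDiff,
      inner_normal_tangDeriv_hypGradient hX hu.contMDiff, hX.inner_tangDeriv_normal_comm x
      (tangDeriv X ν x _), real_inner_self_eq_norm_sq, zero_smul, sub_zero,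
      tangDeriv_mul (hφd x) (hφd x), e1, bochnerIntegrand]
    ring
  simp only [key] at h hint
  exact ⟨hint, h⟩

end Harmonic

/-! ### The weighted inequality -/

section Final

variable {n : ℕ} {M : Type*} [TopologicalSpace M] [ChartedSpace (EuclideanSpace ℝ (Fin n)) M]
  [IsManifold (𝓡 n) ∞ M] {X ν : M → EuclideanSpace ℝ (Fin (n + 1))} {u φ : M → ℝ}

lemma secondFormNormSq_nonneg (hX : IsTwoSidedImmersion X ν) (x : M) :
    0 ≤ secondFormNormSq X ν x := by
  rw [secondFormNormSq_eq_traceL]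
  exact traceL_sq_nonneg (n := n) (by simp) (hX.inner_tangDeriv_normal_comm x)
    (hX.tangDeriv_normal_apply ν x) (hX.norm_normal x)

lemma traceL_tangDeriv_hypGradient_sq_nonneg (hX : IsTwoSidedImmersion X ν)
    (hu : ContMDiff (𝓡 n) 𝓘(ℝ, ℝ) 2 u) (x : M) :
    0 ≤ traceL _ (tangDeriv X (hypGradient X u) x ∘L tangDeriv X (hypGradient X u) x) := by
  rw [← traceL_hypHessian_comp_self hX]
  exact traceL_sq_nonneg (n := n) (by simp) (inner_hypHessian_comm hX hu x)
    (hypHessian_normal hX x) (hX.norm_normal x)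

/-- The refined Kato inequality: the traceless operator bound for the Hessian, applied to `∇u` and
divided by `|∇u|²`. -/
lemma norm_hypGradient_norm_sq_le (hn : 2 ≤ n) (hX : IsTwoSidedImmersion X ν)
    (hu : IsHarmonicOn X u) (x : M) :
    n * ‖hypGradient X (fun y => ‖hypGradient X u y‖) x‖ ^ 2 ≤ (n - 1) *
      traceL _ (tangDeriv X (hypGradient X u) x ∘L tangDeriv X (hypGradient X u) x) := by
  have hn' : (2 : ℝ) ≤ n := by exact_mod_cast hn
  rw [norm_hypGradient_norm_sq hX hu.contMDiff]
  rcases eq_or_ne (hypGradient X u x) 0 with hx | hx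
  · rw [hx]
    have := traceL_tangDeriv_hypGradient_sq_nonneg hX hu.contMDiff x
    simp only [map_zero, norm_zero]
    simp
    exact mul_nonneg (by linarith) this
  · have h0 : 0 < ‖hypGradient X u x‖ ^ 2 := by positivity
    rw [← mul_div_assoc, div_le_iff₀ h0]
    exact norm_hypHessian_apply_sq_le hn hX hu x _

lemma norm_hypHessian_sq_div_le (hX : IsTwoSidedImmersion X ν)
    (hu : ContMDiff (𝓡 n) 𝓘(ℝ, ℝ) 2 u) {δ : ℝ} (hδ : 0 < δ) (x : M) :
    ‖hypHessian X ν u x (hypGradient X u x)‖ ^ 2 / (‖hypGradient X u x‖ ^ 2 + δ) ≤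
      ‖hypGradient X (fun y => ‖hypGradient X u y‖) x‖ ^ 2 := by
  rw [norm_hypGradient_norm_sq hX hu]
  rcases eq_or_ne (hypGradient X u x) 0 with hx | hx
  · rw [hx]; simp
  · have h0 : 0 < ‖hypGradient X u x‖ ^ 2 := by positivity
    exact div_le_div_of_nonneg_left (sq_nonneg _) h0 (by linarith)

lemma abs_traceL_tangDeriv_normal_le {F : EuclideanSpace ℝ (Fin (n + 1)) → ℝ} {ε : ℝ}
    (hn : 2 ≤ n) (hε : IsPinched F ε) (hX : IsTwoSidedImmersion X ν) {x : M}
    (hx : traceL _ (hessOp F (ν x) ∘L tangDeriv X ν x) = 0) :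
    |traceL _ (tangDeriv X ν x)| ≤ Real.sqrt n * (ε / (1 + ε)) *
      Real.sqrt (traceL _ (tangDeriv X ν x ∘L tangDeriv X ν x)) :=
  abs_traceL_le_of_pinched (n := n) (by simp) (hX.inner_tangDeriv_normal_comm x)
    (hX.tangDeriv_normal_apply ν x) (hX.norm_normal x) (hε.nonneg (by omega))
    (fun ξ hξ => by
      rw [real_inner_comm, inner_hessOp]
      exact hε (ν x) (hX.norm_normal x) ξ hξ) hx

/-- The pointwise core. Subtracting the Bochner integrand, whose integral is zero, eliminates the
cross term; the curvature bound and the Kato inequality estimate what is left. -/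
lemma norm_hypGradient_sq_sub_bochnerIntegrand_le {F : EuclideanSpace ℝ (Fin (n + 1)) → ℝ} {ε : ℝ}
    (hn : 2 ≤ n) (hε : IsPinched F ε) (hX : IsTwoSidedImmersion X ν) (hu : IsHarmonicOn X u)
    (hφ : ContMDiff (𝓡 n) 𝓘(ℝ, ℝ) 1 φ) {δ : ℝ} (hδ : 0 < δ) {x : M}
    (hx : traceL _ (hessOp F (ν x) ∘L tangDeriv X ν x) = 0) :
    ‖hypGradient X (fun x => φ x * Real.sqrt (‖hypGradient X u x‖ ^ 2 + δ)) x‖ ^ 2 -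
        bochnerIntegrand X ν u φ x ≤
      ‖hypGradient X φ x‖ ^ 2 * ‖hypGradient X u x‖ ^ 2 + δ * ‖hypGradient X φ x‖ ^ 2 -
        1 / ((n : ℝ) - 1) *
          (φ x ^ 2 * ‖hypGradient X (fun y => ‖hypGradient X u y‖) x‖ ^ 2) +
        ((n : ℝ) - 1) / n * (1 + ((n : ℝ) - 2) / Real.sqrt ((n : ℝ) - 1) * (ε / (1 + ε))) *
          (φ x ^ 2 * secondFormNormSq X ν x * ‖hypGradient X u x‖ ^ 2) := by
  have hn' : (2 : ℝ) ≤ n := by exact_mod_cast hn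
  have hn1 : (0 : ℝ) < (n : ℝ) - 1 := by linarith
  have h1 := norm_apply_sq_sub_trace_mul_le (n := n) hn (by simp)
    (hX.inner_tangDeriv_normal_comm x) (hX.tangDeriv_normal_apply ν x) (hX.norm_normal x)
    (abs_traceL_tangDeriv_normal_le hn hε hX hx) (hX.inner_hypGradient_normal u x)
  have h2 := norm_hypGradient_norm_sq_le hn hX hu x
  have h3 := norm_hypHessian_sq_div_le hX hu.contMDiff hδ x
  rw [norm_hypGradient_mul_sqrt_sq hX hu.contMDiff hφ hδ, bochnerIntegrand,
    secondFormNormSq_eq_traceL]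
  set G := ‖hypGradient X (fun y => ‖hypGradient X u y‖) x‖ ^ 2
  set D2 := traceL _ (tangDeriv X (hypGradient X u) x ∘L tangDeriv X (hypGradient X u) x)
  set q := ‖hypHessian X ν u x (hypGradient X u x)‖ ^ 2 / (‖hypGradient X u x‖ ^ 2 + δ)
  -- Kato gives `D2 ≥ n / (n - 1) · G`, while `q ≤ G`; the excess `n / (n - 1) - 1` is the
  -- coefficient in the theorem.
  have h4 : q - D2 ≤ -(1 / ((n : ℝ) - 1) * G) := by
    have h5 : G + 1 / ((n : ℝ) - 1) * G ≤ D2 := by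
      have h6 : G + 1 / ((n : ℝ) - 1) * G = n * G / ((n : ℝ) - 1) := by
        field_simp
        ring
      rw [h6, div_le_iff₀ hn1]
      linarith
    linarith
  have h7 := mul_le_mul_of_nonneg_left (add_le_add h1 h4) (sq_nonneg (φ x))
  linarith

variable [T2Space M] [SigmaCompactSpace M] [MeasurableSpace M] [BorelSpace M]

lemma continuous_secondFormNormSq (hX : IsTwoSidedImmersion X ν) :
    Continuous (secondFormNormSq X ν) := by
  have h : secondFormNormSq X ν =
      fun x => traceL _ (tangDeriv X ν x ∘L tangDeriv X ν x) := by
    ext x; exact secondFormNormSq_eq_traceL x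
  rw [h]
  exact (traceL _).continuous.comp
    ((continuous_tangDeriv_normal hX).clm_comp (continuous_tangDeriv_normal hX))

lemma integrable_sq_mul_secondFormNormSq_mul (hX : IsTwoSidedImmersion X ν)
    (hu : ContMDiff (𝓡 n) 𝓘(ℝ, ℝ) 2 u) (hφ : ContMDiff (𝓡 n) 𝓘(ℝ, ℝ) 1 φ)
    (hφc : HasCompactSupport φ) :
    Integrable (fun x => φ x ^ 2 * secondFormNormSq X ν x * ‖hypGradient X u x‖ ^ 2)
      (hypVolume X) :=
  integrable_of_continuous_of_tsupport hX hφc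
    (((hφ.continuous.pow 2).mul (continuous_secondFormNormSq hX)).mul
      ((contMDiff_hypGradient hX hu).continuous.norm.pow 2)) fun x hx => by
    rw [image_eq_zero_of_notMem_tsupport hx]; simp

lemma integrable_norm_hypGradient_sq_mul (hX : IsTwoSidedImmersion X ν)
    (hu : ContMDiff (𝓡 n) 𝓘(ℝ, ℝ) 2 u) (hφ : ContMDiff (𝓡 n) 𝓘(ℝ, ℝ) 1 φ)
    (hφc : HasCompactSupport φ) :
    Integrable (fun x => ‖hypGradient X φ x‖ ^ 2 * ‖hypGradient X u x‖ ^ 2) (hypVolume X) :=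
  integrable_of_continuous_of_tsupport hX hφc
    (((continuous_hypGradient hX hφ).norm.pow 2).mul
      ((contMDiff_hypGradient hX hu).continuous.norm.pow 2)) fun x hx => by
    rw [hypGradient_eq_zero_of_notMem_tsupport hx]; simp

lemma integrable_norm_hypGradient_sq (hX : IsTwoSidedImmersion X ν)
    (hφ : ContMDiff (𝓡 n) 𝓘(ℝ, ℝ) 1 φ) (hφc : HasCompactSupport φ) :
    Integrable (fun x => ‖hypGradient X φ x‖ ^ 2) (hypVolume X) :=
  integrable_of_continuous_of_tsupport hX hφc
    ((continuous_hypGradient hX hφ).norm.pow 2) fun x hx => by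
    rw [hypGradient_eq_zero_of_notMem_tsupport hx]; simp

/-- `|∇|∇u||` may be discontinuous at zeros of `∇u`. Measurability comes from the quotient formula,
and the Kato inequality dominates it by the continuous `|D²u|²`. -/
lemma integrable_sq_mul_norm_hypGradient_norm_sq (hn : 2 ≤ n) (hX : IsTwoSidedImmersion X ν)
    (hu : IsHarmonicOn X u) (hφ : ContMDiff (𝓡 n) 𝓘(ℝ, ℝ) 1 φ) (hφc : HasCompactSupport φ) :
    Integrable (fun x => φ x ^ 2 * ‖hypGradient X (fun y => ‖hypGradient X u y‖) x‖ ^ 2)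
      (hypVolume X) := by
  have hn' : (2 : ℝ) ≤ n := by exact_mod_cast hn
  have hv := contMDiff_hypGradient hX hu.contMDiff
  have cD := continuous_tangDeriv hX hv
  have hint : Integrable (fun x => φ x ^ 2 *
      traceL _ (tangDeriv X (hypGradient X u) x ∘L tangDeriv X (hypGradient X u) x))
      (hypVolume X) :=
    integrable_of_continuous_of_tsupport hX hφc ((hφ.continuous.pow 2).mul
      ((traceL _).continuous.comp (cD.clm_comp cD))) fun x hx => by
      rw [image_eq_zero_of_notMem_tsupport hx]; simp
  have cH : Continuous fun x => hypHessian X ν u x (hypGradient X u x) := by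
    have c1 := cD.clm_apply hv.continuous
    have cν := hX.contMDiff_normal.continuous
    exact (continuous_congr fun x => hypHessian_apply x _).mpr (c1.sub ((Continuous.inner (𝕜 := ℝ) cν c1).smul cν))
  refine hint.mono' ?_ (Eventually.of_forall fun x => ?_)
  · simp only [norm_hypGradient_norm_sq hX hu.contMDiff]
    exact ((hφ.continuous.pow 2).measurable.mul ((cH.norm.pow 2).measurable.div
      (hv.continuous.norm.pow 2).measurable)).aestronglyMeasurable
  · have h1 := norm_hypGradient_norm_sq_le hn hX hu x
    have h2 : 0 ≤ φ x ^ 2 * ‖hypGradient X (fun y => ‖hypGradient X u y‖) x‖ ^ 2 := by positivity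
    rw [Real.norm_eq_abs, abs_of_nonneg h2]
    refine mul_le_mul_of_nonneg_left ?_ (sq_nonneg _)
    nlinarith [sq_nonneg ‖hypGradient X (fun y => ‖hypGradient X u y‖) x‖]

/-- Stability with `f = φ √(|∇u|² + δ)`, combined with the integrated pointwise estimate.
Regularizing keeps `f` of class `C¹` across zeros of `∇u`, at the cost of the last term. -/
lemma lambdaConst_mul_integral_add_le {F : EuclideanSpace ℝ (Fin (n + 1)) → ℝ} {ε : ℝ}
    (hn : 2 ≤ n) (hF : IsEllipticIntegrand F) (hε : IsPinched F ε)
    (hX : IsTwoSidedImmersion X ν) (hst : IsStableFMinimal F X ν) (hu : IsHarmonicOn X u)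
    (hφ : ContMDiff (𝓡 n) 𝓘(ℝ, ℝ) 1 φ) (hφc : HasCompactSupport φ) {δ : ℝ} (hδ : 0 < δ) :
    lambdaConst n ε *
          ∫ x, φ x ^ 2 * secondFormNormSq X ν x * ‖hypGradient X u x‖ ^ 2 ∂(hypVolume X) +
        1 / ((n : ℝ) - 1) *
          ∫ x, φ x ^ 2 * ‖hypGradient X (fun y => ‖hypGradient X u y‖) x‖ ^ 2 ∂(hypVolume X) ≤
      ∫ x, ‖hypGradient X φ x‖ ^ 2 * ‖hypGradient X u x‖ ^ 2 ∂(hypVolume X) +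
        δ * ∫ x, ‖hypGradient X φ x‖ ^ 2 ∂(hypVolume X) := by
  have hε0 : 0 ≤ ε := hε.nonneg (by omega)
  have hint1 := integrable_sq_mul_secondFormNormSq_mul hX hu.contMDiff hφ hφc
  have hint2 := integrable_sq_mul_norm_hypGradient_norm_sq hn hX hu hφ hφc
  have hint3 := integrable_norm_hypGradient_sq_mul hX hu.contMDiff hφ hφc
  have hint4 := integrable_norm_hypGradient_sq hX hφ hφc
  obtain ⟨hB, hB0⟩ := integral_bochnerIntegrand hX hu hφ hφc
  have hs := contMDiff_sqrt_norm_sq_add hX hu.contMDiff hδ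
  have hf : ContMDiff (𝓡 n) 𝓘(ℝ, ℝ) 1
      fun x => φ x * Real.sqrt (‖hypGradient X u x‖ ^ 2 + δ) := hφ.mul hs
  have hfc : HasCompactSupport fun x => φ x * Real.sqrt (‖hypGradient X u x‖ ^ 2 + δ) :=
    hφc.mul_right
  have hint5 := integrable_norm_hypGradient_sq hX hf hfc
  have hstab := integral_sq_mul_secondFormNormSq_le hn hF hε hX hst hf hfc
  -- On the curvature side `δ` only helps, as `f² ≥ φ² |∇u|²` and `|A|² ≥ 0`.
  have h1 : ∫ x, φ x ^ 2 * secondFormNormSq X ν x * ‖hypGradient X u x‖ ^ 2 ∂(hypVolume X) ≤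
      ∫ x, (φ x * Real.sqrt (‖hypGradient X u x‖ ^ 2 + δ)) ^ 2 *
        traceL _ (tangDeriv X ν x ∘L tangDeriv X ν x) ∂(hypVolume X) := by
    refine integral_mono hint1 (integrable_of_continuous_of_tsupport hX hfc ?_ fun x hx => ?_)
      fun x => ?_
    · exact (hf.continuous.pow 2).mul ((traceL _).continuous.comp
        ((continuous_tangDeriv_normal hX).clm_comp (continuous_tangDeriv_normal hX)))
    · rw [image_eq_zero_of_notMem_tsupport hx]; simp
    · have h2 := secondFormNormSq_nonneg hX x
      dsimp only
      rw [← secondFormNormSq_eq_traceL, mul_pow, Real.sq_sqrt (by positivity)]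
      have h3 : 0 ≤ φ x ^ 2 * secondFormNormSq X ν x * δ := by positivity
      linarith
  have h2 : ∫ x, ‖hypGradient X (fun x => φ x * Real.sqrt (‖hypGradient X u x‖ ^ 2 + δ)) x‖ ^ 2
        ∂(hypVolume X) ≤
      ∫ x, ‖hypGradient X φ x‖ ^ 2 * ‖hypGradient X u x‖ ^ 2 ∂(hypVolume X) +
        δ * ∫ x, ‖hypGradient X φ x‖ ^ 2 ∂(hypVolume X) - 1 / ((n : ℝ) - 1) *
          ∫ x, φ x ^ 2 * ‖hypGradient X (fun y => ‖hypGradient X u y‖) x‖ ^ 2 ∂(hypVolume X) +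
        ((n : ℝ) - 1) / n * (1 + ((n : ℝ) - 2) / Real.sqrt ((n : ℝ) - 1) * (ε / (1 + ε))) *
          ∫ x, φ x ^ 2 * secondFormNormSq X ν x * ‖hypGradient X u x‖ ^ 2 ∂(hypVolume X) := by
    have h := integral_mono_ae (hint5.sub hB) (((hint3.add (hint4.const_mul δ)).sub
      (hint2.const_mul (1 / ((n : ℝ) - 1)))).add (hint1.const_mul
      (((n : ℝ) - 1) / n * (1 + ((n : ℝ) - 2) / Real.sqrt ((n : ℝ) - 1) * (ε / (1 + ε)))))) (by
        filter_upwards [ae_traceL_hessOp_eq_zero hn hF hX hst.1] with x hx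
        exact norm_hypGradient_sq_sub_bochnerIntegrand_le hn hε hX hu hφ hδ hx)
    rw [integral_sub' hint5 hB, integral_add' ((hint3.add (hint4.const_mul _)).sub
      (hint2.const_mul _)) (hint1.const_mul _), integral_sub' (hint3.add (hint4.const_mul _))
      (hint2.const_mul _), integral_add' hint3 (hint4.const_mul _), integral_const_mul,
      integral_const_mul, integral_const_mul, hB0, sub_zero] at h
    exact h
  have h3 : 1 / (1 + ε) *
      ∫ x, φ x ^ 2 * secondFormNormSq X ν x * ‖hypGradient X u x‖ ^ 2 ∂(hypVolume X) ≤
      ∫ x, ‖hypGradient X (fun x => φ x * Real.sqrt (‖hypGradient X u x‖ ^ 2 + δ)) x‖ ^ 2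
        ∂(hypVolume X) := by
    rw [one_div, inv_mul_le_iff₀ (by linarith)]
    exact h1.trans hstab
  have h4 := h3.trans h2
  unfold lambdaConst
  rw [sub_mul]
  linarith

end Final

end

theorem mainTheorem6 (n : ℕ) (hn : 2 ≤ n)
    {M : Type*} [TopologicalSpace M] [ChartedSpace (EuclideanSpace ℝ (Fin n)) M]
    [IsManifold (𝓡 n) ∞ M] [T2Space M] [SigmaCompactSpace M] [MeasurableSpace M] [BorelSpace M]
    (F : EuclideanSpace ℝ (Fin (n + 1)) → ℝ) (hF : IsEllipticIntegrand F)
    (ε : ℝ) (hε : IsPinched F ε)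
    (X ν : M → EuclideanSpace ℝ (Fin (n + 1))) (hX : IsTwoSidedImmersion X ν)
    (hcomplete : IsCompleteImmersion X) (hstable : IsStableFMinimal F X ν)
    (u : M → ℝ) (hu : IsHarmonicOn X u)
    (φ : M → ℝ) (hφ : ContMDiff (𝓡 n) 𝓘(ℝ, ℝ) 1 φ) (hφc : HasCompactSupport φ) :
    Integrable (fun x => φ x ^ 2 * secondFormNormSq X ν x * ‖hypGradient X u x‖ ^ 2)
        (hypVolume X) ∧
      Integrable (fun x => φ x ^ 2 * ‖hypGradient X (fun y => ‖hypGradient X u y‖) x‖ ^ 2)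
        (hypVolume X) ∧
      Integrable (fun x => ‖hypGradient X φ x‖ ^ 2 * ‖hypGradient X u x‖ ^ 2) (hypVolume X) ∧
      lambdaConst n ε *
            ∫ x, φ x ^ 2 * secondFormNormSq X ν x * ‖hypGradient X u x‖ ^ 2 ∂(hypVolume X) +
          1 / ((n : ℝ) - 1) *
            ∫ x, φ x ^ 2 * ‖hypGradient X (fun y => ‖hypGradient X u y‖) x‖ ^ 2 ∂(hypVolume X) ≤
        ∫ x, ‖hypGradient X φ x‖ ^ 2 * ‖hypGradient X u x‖ ^ 2 ∂(hypVolume X) := by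
  refine ⟨integrable_sq_mul_secondFormNormSq_mul hX hu.contMDiff hφ hφc,
    integrable_sq_mul_norm_hypGradient_norm_sq hn hX hu hφ hφc,
    integrable_norm_hypGradient_sq_mul hX hu.contMDiff hφ hφc, ?_⟩
  refine le_of_forall_pos_le_add fun η hη => ?_
  have hJ : 0 ≤ ∫ x, ‖hypGradient X φ x‖ ^ 2 ∂(hypVolume X) :=
    integral_nonneg fun x => sq_nonneg _
  -- The `+ 1` keeps the denominator positive when `∇φ` vanishes; the error is then at most `η`.
  have h := lambdaConst_mul_integral_add_le hn hF hε hX hstable hu hφ hφc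
    (δ := η / (∫ x, ‖hypGradient X φ x‖ ^ 2 ∂(hypVolume X) + 1)) (by positivity)
  refine h.trans (add_le_add_right ?_ _)
  rw [div_mul_eq_mul_div, div_le_iff₀ (by linarith)]
  exact mul_le_mul_of_nonneg_left (by linarith) hη.le
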